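/- **Setting.** Let $q\in\mathbb C$, $q\neq 0,\pm1$ ($q$ may be a root of unity), and let $\mathcal A=U_q(sl_2)$, with coproduct $\Delta E=E\otimes K+1\otimes E$, $\Delta F=F\otimes 1+K^{-1}\otimes F$, $\Delta K=K\otimes K$ and the corresponding antipode $S$ and counit $\epsilon$. All irreducible representations are finite dimensional of type 1 (there is a highest weight vector of weight $q^{\dim-1}$); $\bar\alpha={}^t\alpha\circ S$ is the contragredient of $\alpha$ and $0$ is the trivial representation given by $\epsilon$. An irreducible $\alpha$ is *physical* if $\Psi\Phi\ne0$ for some intertwiners $\Phi:0\to\alpha\otimes\bar\alpha$, $\Psi:\alpha\otimes\bar\alpha\to 0$; $\mathrm{Phys}$ is a set of representatives, containing $0$, of the classes of physical representations (all spins if $q$ is not a root of unity; finitely many otherwise). For $a,b$ physical or contragredients of physical representations, and $\gamma\in\mathrm{Phys}$ a direct summand of $a\otimes b$ (its multiplicity is then one), choose intertwiners $\phi^{ab}_\gamma:\gamma\to a\otimes b$, $\psi_{ab}^\gamma:a\otimes b\to\gamma$ with $\psi_{ab}^\gamma\phi^{ab}_\gamma=1$; put $\phi^{ab}_\gamma=\psi^\gamma_{ab}=0$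 for the other $\gamma$. For $\alpha\in\mathrm{Phys}$, $\phi^{\alpha0}_\alpha,\phi^{0\alpha}_\alpha,\psi_{\alpha0}^\alpha,\psi_{0\alpha}^\alpha$ are the identity (with $\bar0=0$). The truncated tensor product is the image of the projector $\sum_\gamma\phi^{ab}_\gamma\psi_{ab}^\gamma$. The associator is $$\Theta^{abc}=\sum_{\mu,\delta,\nu}\{6j\}\,\phi^{bc}_\delta\phi^{a\delta}_\nu\psi^\nu_{\mu c}\psi^\mu_{ab},$$ where $\{6j\}$ is the scalar by which $\psi^\nu_{a\delta}\psi^\delta_{bc}\phi^{ab}_\mu\phi^{\mu c}_\nu$ acts on $\nu$; $\Theta^{-1}$ is its quasi-inverse (for the projectors on the truncated $(a\otimes b)\otimes c$ and $a\otimes(b\otimes c)$), and $\Theta,\Theta^{-1}$ extend to parenthesised words by the truncated coproduct $(a\otimes b)(\xi)=\sum_\gamma\phi^{ab}_\gamma\gamma(\xi)\psi^\gamma_{ab}$. Write $\Theta=\sum\theta^{(1)}\otimes\theta^{(2)}\otimes\theta^{(3)}$, similarly for $\Theta^{-1}$, and $\alpha(S(\xi))={}^t\bar\alpha(\xi)$.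 Define matrices $A^\alpha,B^\alpha$ by $\psi^0_{\bar\alpha\alpha}=\langle\cdot,A\,\cdot\rangle$ and $\phi_0^{\alpha\bar\alpha}(1)=\sum_iBe_i\otimes e^i$, normalised by $\sum\theta^{(1)}BS(\theta^{(2)})A\theta^{(3)}=1$ and $\sum S(\theta^{-1(1)})A\theta^{-1(2)}BS(\theta^{-1(3)})=1$. Put $$G^{\alpha\beta}=\sum\big(S(\theta^{-1(12)})\otimes S(\theta^{-1(11)})\big)\big(S(\theta^{(2)})\otimes S(\theta^{(1)})\big)(A\otimes A)(\theta^{(3)}\otimes1)\big(\theta^{-1(2)}\otimes\theta^{-1(3)}\big),$$ $$f^{\alpha\beta}=\sum\big(S(\theta^{-1(12)})\otimes S(\theta^{-1(11)})\big)\,G^{\alpha\beta}\,(\alpha\otimes\beta)\big(\theta^{-1(2)}BS(\theta^{-1(3)})\big),$$ and let $f^{-1}$ be the quasi-inverse of $f$ (with $f^{-1}f$ the projector on the truncated $\alpha\otimes\beta$ and $ff^{-1}$ the transposed projector of the truncated $\bar\beta\otimes\bar\alpha$). The truncated $R$-matrix is given by $P_{12}R^{ab}=\sum_\gamma\lambda_{ab\gamma}^{1/2}\phi^{ba}_\gamma\psi_{ab}^\gamma$,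 where $\lambda_{ab\gamma}=v_av_b/v_\gamma$, $v_\alpha=v_{\bar\alpha}=q^{(\dim(\alpha)^2-1)/2}$, and $\lambda^{1/2}$ is any choice of numbers with $\lambda^{1/2}_{ab\gamma}\lambda^{1/2}_{ba\gamma}=\lambda_{ab\gamma}$; $(S\otimes\mathrm{id})(R)$ and $(S\otimes S)(R)$ are obtained from $\alpha(S(\xi))={}^t\bar\alpha(\xi)$. *The dual quantum group* $\Gamma$ has basis $g^\alpha{}^i_j$ ($\alpha\in\mathrm{Phys}$), the (in general non-associative) product $g^\alpha_1g^\beta_2=\sum_\gamma\phi^{\alpha\beta}_\gamma g^\gamma\psi^\gamma_{\alpha\beta}$, unit $g^0$, coproduct $\Delta(g^\alpha{}^i_j)=\sum_kg^\alpha{}^i_k\otimes g^\alpha{}^k_j$, counit $\epsilon(g^\alpha{}^i_j)=\delta^i_j$ and antipode $S(g^\alpha{}^i_j)=g^{\bar\alpha}{}^j_i$ (the matrix $g^{\bar\alpha}$ being obtained from that of the equivalent element of $\mathrm{Phys}$ by the equivalence). Let $\Sigma$ be a compact connected oriented surface, possibly with boundary, with a triangulation with vertex set $\mathcal V$ and a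 ciliation. Let $\mathcal L$ be the set of oriented edges of the oriented faces (so an interior edge occurs with both orientations $l,-l$, a boundary edge with one); $xy\in\mathcal L$ has departure point $y$ and end point $x$; at a vertex, $<_c$ is the order of the incident (unoriented) links that starts from the cilium. The *gauge symmetry algebra* is $\hat\Gamma=\bigotimes_{z\in\mathcal V}\Gamma_z$, $\Gamma_z=\Gamma$, with the tensor product structure maps, and $g_x$ denotes $g$ in the factor $\Gamma_x$. The *gauge fields algebra* $\Lambda$ is the unital non-associative algebra generated by $u^\alpha(l)^i_j$ ($l\in\mathcal L$, $\alpha\in\mathrm{Phys}$) with the relations 1. whenever $x\ne z$, $xy<_cyz$ at $y$ and the links that occur are in $\mathcal L$: $R_{12}u^\alpha(yx)_1u^\beta(yz)_2=u^\beta(yz)_2u^\alpha(yx)_1$; $u^\alpha(xy)_1(S\otimes\mathrm{id})(R_{12})u^\beta(yz)_2=u^\beta(yz)_2u^\alpha(xy)_1$; $u^\alpha(xy)_1u^\beta(zy)_2(S\otimes S)(R_{12})=u^\beta(zy)_2u^\alpha(xy)_1$; 2. $u^\alpha(l)A^\alpha u^\alpha(-l)=B^\alpha$ for interior links $l$; 3.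 $u^\alpha(xy)_1u^\beta(zt)_2=u^\beta(zt)_2u^\alpha(xy)_1$ for $x,y,z,t$ pairwise distinct; 4. $u^\alpha(l)_1u^\beta(l)_2=\sum_\gamma\phi^{\alpha\beta}_\gamma u^\gamma(l)\psi^\gamma_{\beta\alpha}(f^{\beta\alpha})^{-1}P_{12}$ and $u^0(l)=1$; 5. (quasi-associativity) $\big(\prod_{x\in\mathcal V}\Theta_x\big)M_{P_1}=M_{P_2}$ for any two parenthesisings $P_1,P_2$ of a monomial $M$ in the $u^\alpha(l)$. Here $\Theta_x$ is any intertwiner composed of associators (the projector on the truncated tensor product if nothing is moved) between the tensor products, parenthesised by $P_1$ and $P_2$, of the representations attached to $x$: each factor $u^\alpha(l)$ contributes $\alpha$, $\bar\alpha$ or $0$ according to whether $x$ is the end point of $l$, the departure point of $l$, or not on $l$; $\Theta_x$ acts on the corresponding matrix indices. **Proposition (gauge covariance).** For every $q\ne0,\pm1$ (generic or, with truncation, a root of unity) all defining relations of $\Lambda$ are compatible with $u^\alpha(xy)\mapsto g^\alpha_x\,u^\alpha(xy)\,S(g^\alpha_y)$: the unital algebra morphism from the free unital non-associative algebra on the $u^\alpha(l)^i_j$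 to $\Lambda\otimes\hat\Gamma$ given by this formula takes equal values on the two sides of each relation. Hence there is a unique morphism of unital algebras $\Omega:\Lambda\to\Lambda\otimes\hat\Gamma$ with $$\Omega\big(u^\alpha(xy)^i_j\big)=\sum_{k,m}u^\alpha(xy)^k_m\otimes (g^\alpha_x)^i_k\,S\big((g^\alpha_y)^m_j\big),$$ and $\Omega$ makes $\Lambda$ a right $\hat\Gamma$-comodule, for the coproduct of $\hat\Gamma$ read in the order $\Delta^{\mathrm{op}}=\sigma\circ\Delta$: $$(\Omega\otimes\mathrm{id})\Omega=(\mathrm{id}\otimes\Delta^{\mathrm{op}})\Omega,\qquad(\mathrm{id}\otimes\epsilon)\Omega=\mathrm{id}$$ (equivalently, exchanging the tensor factors, a left comodule for $\Delta$). -/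

import Mathlib

open scoped TensorProduct Kronecker

/-- Generators of the quantised enveloping algebra of `sl₂`. -/
inductive UqGen
  | E | F | K | Kinv

open FreeAlgebra in
/-- Relations of `U_q(sl₂)`: `K K⁻¹ = K⁻¹ K = 1`, `K E = q² E K`, `F K = q² K F`,
`E F - F E = (K - K⁻¹) / (q - q⁻¹)`. -/
inductive UqRel (q : ℂ) : FreeAlgebra ℂ UqGen → FreeAlgebra ℂ UqGen → Prop
  | K_Kinv : UqRel q (ι ℂ UqGen.K * ι ℂ UqGen.Kinv) 1
  | Kinv_K : UqRel q (ι ℂ UqGen.Kinv * ι ℂ UqGen.K) 1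
  | K_E : UqRel q (ι ℂ UqGen.K * ι ℂ UqGen.E) (q ^ 2 • (ι ℂ UqGen.E * ι ℂ UqGen.K))
  | F_K : UqRel q (ι ℂ UqGen.F * ι ℂ UqGen.K) (q ^ 2 • (ι ℂ UqGen.K * ι ℂ UqGen.F))
  | E_F : UqRel q (ι ℂ UqGen.E * ι ℂ UqGen.F - ι ℂ UqGen.F * ι ℂ UqGen.E)
      ((q - q⁻¹)⁻¹ • (ι ℂ UqGen.K - ι ℂ UqGen.Kinv))

/-- The algebra `U_q(sl₂)`. -/
def Uq (q : ℂ) : Type := RingQuot (UqRel q)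

noncomputable instance (q : ℂ) : Ring (Uq q) := inferInstanceAs (Ring (RingQuot (UqRel q)))

noncomputable instance (q : ℂ) : Algebra ℂ (Uq q) :=
  inferInstanceAs (Algebra ℂ (RingQuot (UqRel q)))

namespace Uq

noncomputable def mk (q : ℂ) : FreeAlgebra ℂ UqGen →ₐ[ℂ] Uq q := RingQuot.mkAlgHom ℂ (UqRel q)

noncomputable def gen (q : ℂ) (x : UqGen) : Uq q := mk q (FreeAlgebra.ι ℂ x)

theorem mk_rel {q : ℂ} {x y : FreeAlgebra ℂ UqGen} (h : UqRel q x y) : mk q x = mk q y :=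
  RingQuot.mkAlgHom_rel ℂ h

variable {q : ℂ}

theorem K_mul_Kinv : gen q .K * gen q .Kinv = 1 := by
  simpa [gen] using mk_rel (UqRel.K_Kinv (q := q))

theorem Kinv_mul_K : gen q .Kinv * gen q .K = 1 := by
  simpa [gen] using mk_rel (UqRel.Kinv_K (q := q))

theorem K_mul_E : gen q .K * gen q .E = q ^ 2 • (gen q .E * gen q .K) := by
  simpa [gen] using mk_rel (UqRel.K_E (q := q))

theorem F_mul_K : gen q .F * gen q .K = q ^ 2 • (gen q .K * gen q .F) := by
  simpa [gen] using mk_rel (UqRel.F_K (q := q))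

theorem E_mul_F : gen q .E * gen q .F - gen q .F * gen q .E =
    (q - q⁻¹)⁻¹ • (gen q .K - gen q .Kinv) := by
  simpa [gen] using mk_rel (UqRel.E_F (q := q))

theorem E_mul_Kinv : gen q .E * gen q .Kinv = q ^ 2 • (gen q .Kinv * gen q .E) := by
  have h := congrArg (fun x => gen q .Kinv * x * gen q .Kinv) (K_mul_E (q := q))
  simp only [mul_smul_comm, smul_mul_assoc] at h
  rw [← mul_assoc, Kinv_mul_K, one_mul] at h
  rw [h, mul_assoc, mul_assoc, K_mul_Kinv, mul_one]

theorem Kinv_mul_F : gen q .Kinv * gen q .F = q ^ 2 • (gen q .F * gen q .Kinv) := by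
  have h := congrArg (fun x => gen q .Kinv * x * gen q .Kinv) (F_mul_K (q := q))
  simp only [mul_smul_comm, smul_mul_assoc] at h
  rw [mul_assoc, mul_assoc, K_mul_Kinv, mul_one, ← mul_assoc, Kinv_mul_K, one_mul] at h
  exact h

/-- Universal property of the presentation. -/
noncomputable def lift {A : Type*} [Ring A] [Algebra ℂ A] (e f k k' : A)
    (h₁ : k * k' = 1) (h₂ : k' * k = 1) (h₃ : k * e = q ^ 2 • (e * k))
    (h₄ : f * k = q ^ 2 • (k * f)) (h₅ : e * f - f * e = (q - q⁻¹)⁻¹ • (k - k')) :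
    Uq q →ₐ[ℂ] A :=
  RingQuot.liftAlgHom ℂ ⟨FreeAlgebra.lift ℂ fun
    | .E => e
    | .F => f
    | .K => k
    | .Kinv => k', by
      intro x y h
      cases h <;> simp [h₁, h₂, h₃, h₄, h₅]⟩

theorem E_F_K_comm : gen q .K * (gen q .F * gen q .E) = gen q .F * gen q .E * gen q .K := by
  rw [mul_assoc, ← sub_eq_zero]
  have h1 := K_mul_E (q := q)
  have h2 := F_mul_K (q := q)
  by_cases hq : q ^ 2 = 0
  · rw [hq, zero_smul] at h1 h2
    have hE : gen q .E = 0 := by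
      have := congrArg (fun x => gen q .Kinv * x) h1
      simpa [← mul_assoc, Kinv_mul_K] using this
    simp [hE]
  · have : gen q .F * (gen q .E * gen q .K) = (q ^ 2)⁻¹ • (gen q .F * (gen q .K * gen q .E)) := by
      rw [h1, mul_smul_comm, smul_smul, inv_mul_cancel₀ hq, one_smul]
    rw [this, ← mul_assoc (gen q .F), h2, smul_mul_assoc, smul_smul, inv_mul_cancel₀ hq, one_smul,
      mul_assoc, sub_self]


theorem comul_E_F :
    (gen q .E ⊗ₜ[ℂ] gen q .K + 1 ⊗ₜ[ℂ] gen q .E) * (gen q .F ⊗ₜ[ℂ] 1 + gen q .Kinv ⊗ₜ[ℂ] gen q .F) -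
      (gen q .F ⊗ₜ[ℂ] 1 + gen q .Kinv ⊗ₜ[ℂ] gen q .F) *
        (gen q .E ⊗ₜ[ℂ] gen q .K + 1 ⊗ₜ[ℂ] gen q .E) =
    (q - q⁻¹)⁻¹ • (gen q .K ⊗ₜ[ℂ] gen q .K - gen q .Kinv ⊗ₜ[ℂ] gen q .Kinv) := by
  have h : (gen q .E * gen q .Kinv) ⊗ₜ[ℂ] (gen q .K * gen q .F) =
      (gen q .Kinv * gen q .E) ⊗ₜ[ℂ] (gen q .F * gen q .K) := by
    rw [E_mul_Kinv, F_mul_K, TensorProduct.smul_tmul]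
  have e : (gen q .E * gen q .F) = gen q .F * gen q .E +
      (q - q⁻¹)⁻¹ • (gen q .K - gen q .Kinv) := by rw [← E_mul_F]; abel
  simp only [mul_add, add_mul, Algebra.TensorProduct.tmul_mul_tmul, one_mul, mul_one, h]
  rw [e]
  simp only [TensorProduct.add_tmul, TensorProduct.tmul_add, smul_sub,
    TensorProduct.sub_tmul, TensorProduct.tmul_sub, TensorProduct.tmul_smul,
    TensorProduct.smul_tmul']
  abel

/-- The coproduct: `ΔE = E ⊗ K + 1 ⊗ E`, `ΔF = F ⊗ 1 + K⁻¹ ⊗ F`, `ΔK = K ⊗ K`. -/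
noncomputable def comul : Uq q →ₐ[ℂ] Uq q ⊗[ℂ] Uq q :=
  lift (q := q) (gen q .E ⊗ₜ[ℂ] gen q .K + 1 ⊗ₜ[ℂ] gen q .E)
    (gen q .F ⊗ₜ[ℂ] 1 + gen q .Kinv ⊗ₜ[ℂ] gen q .F)
    (gen q .K ⊗ₜ[ℂ] gen q .K) (gen q .Kinv ⊗ₜ[ℂ] gen q .Kinv)
    (by rw [Algebra.TensorProduct.tmul_mul_tmul, K_mul_Kinv, Algebra.TensorProduct.one_def])
    (by rw [Algebra.TensorProduct.tmul_mul_tmul, Kinv_mul_K, Algebra.TensorProduct.one_def])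
    (by
      rw [mul_add, add_mul, smul_add]
      simp only [Algebra.TensorProduct.tmul_mul_tmul, K_mul_E, one_mul, mul_one,
        TensorProduct.tmul_smul, TensorProduct.smul_tmul'])
    (by
      rw [mul_add, add_mul, smul_add]
      simp only [Algebra.TensorProduct.tmul_mul_tmul, F_mul_K, one_mul, mul_one, K_mul_Kinv,
        Kinv_mul_K, TensorProduct.tmul_smul, TensorProduct.smul_tmul'])
    comul_E_F

/-- The counit. -/
noncomputable def counit : Uq q →ₐ[ℂ] ℂ :=
  lift 0 0 1 1 (mul_one 1) (mul_one 1) (by rw [mul_zero, zero_mul, smul_zero])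
    (by rw [mul_zero, zero_mul, smul_zero]) (by rw [mul_zero, sub_self, sub_self, smul_zero])

open MulOpposite in
/-- The antipode `S(E) = -E K⁻¹`, `S(F) = -K F`, `S(K) = K⁻¹`, as a morphism to the opposite
algebra. -/
noncomputable def antipode : Uq q →ₐ[ℂ] (Uq q)ᵐᵒᵖ :=
  lift (op (-(gen q .E * gen q .Kinv))) (op (-(gen q .K * gen q .F))) (op (gen q .Kinv))
    (op (gen q .K))
    (by rw [← op_mul, K_mul_Kinv, op_one]) (by rw [← op_mul, Kinv_mul_K, op_one])
    (by
      rw [← op_mul, ← op_mul, ← op_smul]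
      congr 1
      have := congrArg (fun x => -(x * gen q .Kinv)) (E_mul_Kinv (q := q))
      simpa only [neg_mul, mul_neg, smul_neg, smul_mul_assoc, mul_assoc] using this)
    (by
      rw [← op_mul, ← op_mul, ← op_smul]
      congr 1
      have := congrArg (fun x => -(gen q .K * x)) (Kinv_mul_F (q := q))
      simp only [mul_smul_comm] at this
      rw [← mul_assoc, K_mul_Kinv, one_mul] at this
      rw [mul_neg, ← mul_assoc, Kinv_mul_K, one_mul, this, neg_mul, smul_neg, mul_assoc])
    (by
      rw [← op_mul, ← op_mul, ← op_sub, ← op_sub, ← op_smul]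
      congr 1
      have h1 : -(gen q .K * gen q .F) * -(gen q .E * gen q .Kinv) = gen q .F * gen q .E := by
        rw [neg_mul_neg]
        calc _ = gen q .K * (gen q .F * gen q .E) * gen q .Kinv := by simp only [mul_assoc]
          _ = _ := by rw [E_F_K_comm, mul_assoc, K_mul_Kinv, mul_one]
      have h2 : -(gen q .E * gen q .Kinv) * -(gen q .K * gen q .F) = gen q .E * gen q .F := by
        rw [neg_mul_neg]
        calc _ = gen q .E * (gen q .Kinv * gen q .K) * gen q .F := by simp only [mul_assoc]
          _ = _ := by rw [Kinv_mul_K, mul_one]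
      rw [h1, h2, ← neg_sub, E_mul_F, ← smul_neg, neg_sub])

end Uq

open Matrix

/-- `X` intertwines the matrix-valued maps `f` and `g`: `X f(ξ) = g(ξ) X` for all `ξ`. -/
def Intertwines {A : Type*} {m n : Type*} [Fintype m] [Fintype n]
    (f : A → Matrix m m ℂ) (g : A → Matrix n n ℂ) (X : Matrix n m ℂ) : Prop :=
  ∀ ξ, X * f ξ = g ξ * X

/-- Matrix representations of `U_q(sl₂)` on `ℂ^d`. -/
abbrev UqRep (q : ℂ) (d : ℕ) : Type := Uq q →ₐ[ℂ] Matrix (Fin d) (Fin d) ℂ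

namespace UqRep

variable {q : ℂ} {d e : ℕ}

/-- No invariant subspace except `0` and the whole (nonzero) space. -/
def IsIrreducible (ρ : UqRep q d) : Prop :=
  0 < d ∧ ∀ W : Submodule ℂ (Fin d → ℂ), (∀ ξ, ∀ w ∈ W, ρ ξ *ᵥ w ∈ W) → W = ⊥ ∨ W = ⊤

/-- Type 1: there is a highest weight vector, of weight `q^(d-1)` (spin `(d-1)/2`). -/
def IsTypeOne (ρ : UqRep q d) : Prop :=
  ∃ w : Fin d → ℂ, w ≠ 0 ∧ ρ (Uq.gen q .E) *ᵥ w = 0 ∧ ρ (Uq.gen q .K) *ᵥ w = q ^ (d - 1) • w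

/-- Equivalence of representations. -/
def Equivalent (ρ : UqRep q d) (σ : UqRep q e) : Prop :=
  ∃ (X : Matrix (Fin e) (Fin d) ℂ) (Y : Matrix (Fin d) (Fin e) ℂ),
    Intertwines ρ σ X ∧ X * Y = 1 ∧ Y * X = 1

/-- The contragredient representation `ᵗρ ∘ S`. -/
noncomputable def dual (ρ : UqRep q d) (ξ : Uq q) : Matrix (Fin d) (Fin d) ℂ :=
  (ρ (Uq.antipode ξ).unop)ᵀ

end UqRep

/-- The tensor product of two matrix-valued maps on `U_q(sl₂)`, through the coproduct. -/
noncomputable def tensorRep {q : ℂ} {m n : Type*}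
    (f : Uq q →ₗ[ℂ] Matrix m m ℂ) (g : Uq q →ₗ[ℂ] Matrix n n ℂ) :
    Uq q →ₗ[ℂ] Matrix (m × n) (m × n) ℂ :=
  TensorProduct.lift ((Matrix.kroneckerBilinear (R := ℂ) (α := ℂ)).compl₁₂ f g) ∘ₗ (Uq.comul (q := q)).toLinearMap

noncomputable def UqRep.dualLin {q : ℂ} {d : ℕ} (ρ : UqRep q d) :
    Uq q →ₗ[ℂ] Matrix (Fin d) (Fin d) ℂ where
  toFun := ρ.dual
  map_add' := by intro x y; simp [UqRep.dual]
  map_smul' := by intro c x; simp [UqRep.dual]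

/-- An irreducible representation of type 1 is physical if
`Ψ_{αᾱ}^0 Φ_0^{αᾱ} ≠ 0` for intertwiners `Φ : 0 → α ⊗ ᾱ` and `Ψ : α ⊗ ᾱ → 0`. -/
def UqRep.IsPhysical {q : ℂ} {d : ℕ} (ρ : UqRep q d) : Prop :=
  ρ.IsIrreducible ∧ ρ.IsTypeOne ∧
    ∃ (Φ : Matrix (Fin d × Fin d) Unit ℂ) (Ψ : Matrix Unit (Fin d × Fin d) ℂ),
      Intertwines (fun ξ => Uq.counit (q := q) ξ • (1 : Matrix Unit Unit ℂ))
        (tensorRep ρ.toLinearMap ρ.dualLin) Φ ∧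
      Intertwines (tensorRep ρ.toLinearMap ρ.dualLin)
        (fun ξ => Uq.counit (q := q) ξ • (1 : Matrix Unit Unit ℂ)) Ψ ∧
      Ψ * Φ ≠ 0

/-- `Phys(U_q(sl₂))`: a system of representatives of the equivalence classes of physical
representations, in which the trivial class is represented by the counit. -/
structure PhysSystem (q : ℂ) where
  I : Type
  d : I → ℕ
  ρ : ∀ α, UqRep q (d α)
  physical : ∀ α, (ρ α).IsPhysical
  eq_of_equivalent : ∀ α β, (ρ α).Equivalent (ρ β) → α = β
  exists_equivalent : ∀ (e : ℕ) (σ : UqRep q e), σ.IsPhysical → ∃ α, σ.Equivalent (ρ α)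
  zero : I
  d_zero : d zero = 1
  ρ_zero : ∀ ξ, ρ zero ξ = Uq.counit (q := q) ξ • (1 : Matrix (Fin (d zero)) (Fin (d zero)) ℂ)

namespace PhysSystem

variable {q : ℂ} (P : PhysSystem q)

/-- The representations `α` (as `(α, false)`) and `ᾱ` (as `(α, true)`), `α` physical. -/
abbrev Obj : Type := P.I × Bool

abbrev dim (a : P.Obj) : ℕ := P.d a.1

abbrev Ix (a : P.Obj) : Type := Fin (P.dim a)

/-- The matrices of the representation `α` or `ᾱ`. -/
noncomputable def rep (a : P.Obj) : Uq q →ₗ[ℂ] Matrix (P.Ix a) (P.Ix a) ℂ :=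
  match a with
  | (α, false) => (P.ρ α).toLinearMap
  | (α, true) => (P.ρ α).dualLin

abbrev o (α : P.I) : P.Obj := (α, false)

abbrev bar (α : P.I) : P.Obj := (α, true)

/-- The index of the unique basis vector of the trivial representation. -/
def ix0 : Fin (P.d P.zero) := ⟨0, by rw [P.d_zero]; exact Nat.one_pos⟩

/-- `δ(a b γ) = 1`: the physical representation `γ` is a direct summand of `a ⊗ b`. -/
def Occurs (a b : P.Obj) (γ : P.I) : Prop :=
  ∃ (φ : Matrix (P.Ix a × P.Ix b) (Fin (P.d γ)) ℂ) (ψ : Matrix (Fin (P.d γ)) (P.Ix a × P.Ix b) ℂ),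
    Intertwines (P.ρ γ) (tensorRep (P.rep a) (P.rep b)) φ ∧
    Intertwines (tensorRep (P.rep a) (P.rep b)) (P.ρ γ) ψ ∧ ψ * φ = 1

theorem schur {α β : P.I} (X : Matrix (Fin (P.d β)) (Fin (P.d α)) ℂ)
    (hX : Intertwines (P.ρ α) (P.ρ β) X) (h0 : X ≠ 0) : α = β := by
  have hc : ∀ ξ v, X *ᵥ (P.ρ α ξ *ᵥ v) = P.ρ β ξ *ᵥ (X *ᵥ v) := fun ξ v => by
    rw [mulVec_mulVec, hX ξ, mulVec_mulVec]
  have hne : ∃ v, X *ᵥ v ≠ 0 := by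
    by_contra! h
    exact h0 (Matrix.mulVec_injective (funext fun v => by rw [h v, zero_mulVec]))
  obtain ⟨v, hv⟩ := hne
  have hker : LinearMap.ker X.mulVecLin = ⊥ := by
    refine ((P.physical α).1.2 _ ?_).resolve_right ?_
    · intro ξ w hw
      simp only [LinearMap.mem_ker, mulVecLin_apply] at hw ⊢
      rw [hc, hw, mulVec_zero]
    · intro h
      have : v ∈ LinearMap.ker X.mulVecLin := h ▸ Submodule.mem_top
      exact hv (by simpa using this)
  have hran : LinearMap.range X.mulVecLin = ⊤ := by
    refine ((P.physical β).1.2 _ ?_).resolve_left ?_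
    · rintro ξ w ⟨u, rfl⟩
      exact ⟨P.ρ α ξ *ᵥ u, by simp [hc]⟩
    · intro h
      have : X *ᵥ v ∈ LinearMap.range X.mulVecLin := ⟨v, rfl⟩
      rw [h] at this
      exact hv (by simpa using this)
  let e := LinearEquiv.ofBijective X.mulVecLin
    ⟨LinearMap.ker_eq_bot.mp hker, LinearMap.range_eq_top.mp hran⟩
  refine P.eq_of_equivalent α β ⟨X, LinearMap.toMatrix' e.symm.toLinearMap, hX, ?_, ?_⟩
  · apply Matrix.mulVec_injective
    funext w
    rw [← mulVec_mulVec, one_mulVec]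
    have : LinearMap.toMatrix' e.symm.toLinearMap *ᵥ w = e.symm w := by
      rw [← Matrix.toLin'_apply, Matrix.toLin'_toMatrix']; rfl
    rw [this]
    exact e.apply_symm_apply w
  · apply Matrix.mulVec_injective
    funext w
    rw [← mulVec_mulVec, one_mulVec]
    rw [← Matrix.toLin'_apply, Matrix.toLin'_toMatrix']
    exact e.symm_apply_apply w

theorem finite_occurs (a b : P.Obj) : {γ | P.Occurs a b γ}.Finite := by
  classical
  have hch : ∀ γ : {γ | P.Occurs a b γ}, P.Occurs a b γ := fun γ => γ.2
  choose φ ψ hφ hψ h1 using hch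
  have hli : LinearIndependent ℂ fun γ : {γ | P.Occurs a b γ} => φ γ * ψ γ := by
    rw [linearIndependent_iff']
    intro s c hs γ hγ
    have h := congrArg (fun X => ψ γ * X * φ γ) hs
    simp only [Matrix.mul_zero, Matrix.zero_mul, Matrix.mul_sum, Matrix.sum_mul] at h
    rw [Finset.sum_eq_single γ] at h
    · rw [Matrix.mul_smul, Matrix.smul_mul, ← Matrix.mul_assoc, h1, Matrix.one_mul, h1] at h
      have hd : 0 < P.d γ := (P.physical γ).1.1
      have := congrFun (congrFun h ⟨0, hd⟩) ⟨0, hd⟩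
      simpa using this
    · intro δ _ hne
      have hz : ψ γ * φ δ = 0 := by
        by_contra h0
        refine hne (Subtype.ext (P.schur (ψ γ * φ δ) ?_ h0))
        intro ξ
        rw [Matrix.mul_assoc, hφ, ← Matrix.mul_assoc, hψ, Matrix.mul_assoc]
      rw [Matrix.mul_smul, Matrix.smul_mul, ← Matrix.mul_assoc, hz]
      simp
    · intro h; exact absurd hγ h
  have := hli.finite
  exact Set.toFinite _

/-- The finite set of the physical `γ` occurring in the truncated tensor product of `a`, `b`. -/
noncomputable def fusion (a b : P.Obj) : Finset P.I := (P.finite_occurs a b).toFinset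

/-- `λ_{abγ} = v_a v_b / v_γ`, where `v_α = q^{C(α)}` with `C(α) = n(n+2)/2 = (d_α² - 1)/2` the
quadratic Casimir of the representation of spin `n/2`; here `t = q^{1/2}`. -/
noncomputable def casimirRatio (t : ℂ) (a b : P.Obj) (γ : P.I) : ℂ :=
  t ^ (P.dim a ^ 2 - 1) * t ^ (P.dim b ^ 2 - 1) / t ^ (P.d γ ^ 2 - 1)

end PhysSystem

/-- A choice of the inclusions `φ^{ab}_γ` and projections `ψ_{ab}^γ` of the truncated tensor
products of physical representations and their contragredients (all multiplicities are at most
one for `U_q(sl₂)`), normalised to the identity when one factor is the trivial representation. -/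
structure ClebschGordan {q : ℂ} (P : PhysSystem q) where
  φ : ∀ (a b : P.Obj) (γ : P.I), Matrix (P.Ix a × P.Ix b) (Fin (P.d γ)) ℂ
  ψ : ∀ (a b : P.Obj) (γ : P.I), Matrix (Fin (P.d γ)) (P.Ix a × P.Ix b) ℂ
  φ_intertwines : ∀ a b γ, Intertwines (P.ρ γ) (tensorRep (P.rep a) (P.rep b)) (φ a b γ)
  ψ_intertwines : ∀ a b γ, Intertwines (tensorRep (P.rep a) (P.rep b)) (P.ρ γ) (ψ a b γ)
  ψ_mul_φ : ∀ a b γ, P.Occurs a b γ → ψ a b γ * φ a b γ = 1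
  φ_eq_zero : ∀ a b γ, ¬ P.Occurs a b γ → φ a b γ = 0
  ψ_eq_zero : ∀ a b γ, ¬ P.Occurs a b γ → ψ a b γ = 0
  φ_right_zero : ∀ α s, φ (P.o α) (P.zero, s) α = Matrix.of fun p n => if p.1 = n then 1 else 0
  φ_left_zero : ∀ α s, φ (P.zero, s) (P.o α) α = Matrix.of fun p n => if p.2 = n then 1 else 0
  ψ_right_zero : ∀ α s, ψ (P.o α) (P.zero, s) α = Matrix.of fun n p => if p.1 = n then 1 else 0
  ψ_left_zero : ∀ α s, ψ (P.zero, s) (P.o α) α = Matrix.of fun n p => if p.2 = n then 1 else 0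

/-- The quasi-inverse of `M` relative to the projectors `p` and `p'`: the unique matrix `N` with
`N M = p`, `M N = p'`, `N p' = N` (and `0` if there is none). -/
noncomputable def quasiInverse {m n : Type*} [Fintype m] [Fintype n]
    (p : Matrix m m ℂ) (p' : Matrix n n ℂ) (M : Matrix n m ℂ) : Matrix m n ℂ :=
  open Classical in
  if h : ∃ N : Matrix m n ℂ, N * M = p ∧ M * N = p' ∧ N * p' = N then h.choose else 0

/-- Parenthesised words. -/
inductive PTree (X : Type) : Type
  | leaf : X → PTree X
  | node : PTree X → PTree X → PTree X

namespace PTree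

def map {X Y : Type} (f : X → Y) : PTree X → PTree Y
  | leaf x => leaf (f x)
  | node s t => node (s.map f) (t.map f)

/-- The index set of the tensor product of the representations in a parenthesised word. -/
def Idx {q : ℂ} {P : PhysSystem q} : PTree P.Obj → Type
  | leaf a => P.Ix a
  | node s t => s.Idx × t.Idx

instance instFintypeIdx {q : ℂ} {P : PhysSystem q} : (T : PTree P.Obj) → Fintype T.Idx
  | leaf a => inferInstanceAs (Fintype (P.Ix a))
  | node s t =>
    haveI := instFintypeIdx s
    haveI := instFintypeIdx t
    inferInstanceAs (Fintype (s.Idx × t.Idx))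

/-- The tensor product of two matrices indexed by parenthesised words. -/
def kron {q : ℂ} {P : PhysSystem q} {s s' t t' : PTree P.Obj}
    (X : Matrix s'.Idx s.Idx ℂ) (Y : Matrix t'.Idx t.Idx ℂ) :
    Matrix (node s' t').Idx (node s t).Idx ℂ :=
  X ⊗ₖ Y

end PTree

namespace ClebschGordan

variable {q : ℂ} {P : PhysSystem q} (C : ClebschGordan P)

section Associator

variable (a b c : P.Obj)

/-- `φ_μ^{ab} φ_ν^{μc}`. -/
noncomputable def φL (μ ν : P.I) : Matrix ((P.Ix a × P.Ix b) × P.Ix c) (Fin (P.d ν)) ℂ :=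
  (C.φ a b μ ⊗ₖ (1 : Matrix (P.Ix c) (P.Ix c) ℂ)) * C.φ (P.o μ) c ν

/-- `ψ^ν_{μc} ψ^μ_{ab}`. -/
noncomputable def ψL (μ ν : P.I) : Matrix (Fin (P.d ν)) ((P.Ix a × P.Ix b) × P.Ix c) ℂ :=
  C.ψ (P.o μ) c ν * (C.ψ a b μ ⊗ₖ (1 : Matrix (P.Ix c) (P.Ix c) ℂ))

/-- `φ_δ^{bc} φ_ν^{aδ}`. -/
noncomputable def φR (δ ν : P.I) : Matrix (P.Ix a × (P.Ix b × P.Ix c)) (Fin (P.d ν)) ℂ :=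
  ((1 : Matrix (P.Ix a) (P.Ix a) ℂ) ⊗ₖ C.φ b c δ) * C.φ a (P.o δ) ν

/-- `ψ^ν_{aδ} ψ^δ_{bc}`. -/
noncomputable def ψR (δ ν : P.I) : Matrix (Fin (P.d ν)) (P.Ix a × (P.Ix b × P.Ix c)) ℂ :=
  C.ψ a (P.o δ) ν * ((1 : Matrix (P.Ix a) (P.Ix a) ℂ) ⊗ₖ C.ψ b c δ)

/-- The `6j` symbol: the scalar by which `ψ^ν_{aδ} ψ^δ_{bc} φ_μ^{ab} φ_ν^{μc}` acts on `ν`. -/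
noncomputable def sixj (μ δ ν : P.I) : ℂ :=
  (P.d ν : ℂ)⁻¹ *
    (C.ψR a b c δ ν * (C.φL a b c μ ν).submatrix (Equiv.prodAssoc _ _ _).symm id).trace

/-- The associator `Θ^{abc} = ∑ {6j} φ_δ^{bc} φ_ν^{aδ} ψ^ν_{μc} ψ^μ_{ab}`, from the truncated
`(a ⊗ b) ⊗ c` to the truncated `a ⊗ (b ⊗ c)`. -/
noncomputable def Θ : Matrix (P.Ix a × (P.Ix b × P.Ix c)) ((P.Ix a × P.Ix b) × P.Ix c) ℂ :=
  ∑ μ ∈ P.fusion a b, ∑ δ ∈ P.fusion b c, ∑ ν ∈ P.fusion (P.o μ) c,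
    C.sixj a b c μ δ ν • (C.φR a b c δ ν * C.ψL a b c μ ν)

/-- The projector onto the truncated `(a ⊗ b) ⊗ c`. -/
noncomputable def projL :
    Matrix ((P.Ix a × P.Ix b) × P.Ix c) ((P.Ix a × P.Ix b) × P.Ix c) ℂ :=
  ∑ μ ∈ P.fusion a b, ∑ ν ∈ P.fusion (P.o μ) c, C.φL a b c μ ν * C.ψL a b c μ ν

/-- The projector onto the truncated `a ⊗ (b ⊗ c)`. -/
noncomputable def projR :
    Matrix (P.Ix a × (P.Ix b × P.Ix c)) (P.Ix a × (P.Ix b × P.Ix c)) ℂ :=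
  ∑ δ ∈ P.fusion b c, ∑ ν ∈ P.fusion a (P.o δ), C.φR a b c δ ν * C.ψR a b c δ ν

/-- The quasi-inverse of the associator. -/
noncomputable def Θinv : Matrix ((P.Ix a × P.Ix b) × P.Ix c) (P.Ix a × (P.Ix b × P.Ix c)) ℂ :=
  quasiInverse (C.projL a b c) (C.projR a b c) (C.Θ a b c)

end Associator

/-- Summation over the decomposition `∑ e ⋯ p` of the truncated tensor product attached to a
parenthesised word: `e` runs through the iterated inclusions `φ φ ⋯` of its components `a` and
`p` through the corresponding projections `⋯ ψ ψ`. -/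
noncomputable def sumComponents {M : Type} [AddCommMonoid M] :
    (T : PTree P.Obj) →
      (∀ a : P.Obj, Matrix T.Idx (P.Ix a) ℂ → Matrix (P.Ix a) T.Idx ℂ → M) → M
  | .leaf a, f => f a (1 : Matrix (P.Ix a) (P.Ix a) ℂ) (1 : Matrix (P.Ix a) (P.Ix a) ℂ)
  | .node s t, f =>
    sumComponents s fun a e p => sumComponents t fun b e' p' =>
      ∑ γ ∈ P.fusion a b, f (P.o γ) ((e ⊗ₖ e') * C.φ a b γ) (C.ψ a b γ * (p ⊗ₖ p'))

/-- The projector onto the truncated tensor product of a parenthesised word. -/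
noncomputable def proj (T : PTree P.Obj) : Matrix T.Idx T.Idx ℂ :=
  C.sumComponents T fun _ e p => e * p

/-- `Θ^{r s t}` for parenthesised words `r`, `s`, `t`, through the truncated coproduct. -/
noncomputable def Θtree (r s t : PTree P.Obj) :
    Matrix (PTree.node r (PTree.node s t)).Idx (PTree.node (PTree.node r s) t).Idx ℂ :=
  C.sumComponents r fun a e p => C.sumComponents s fun b e' p' => C.sumComponents t fun c e'' p'' =>
    (e ⊗ₖ (e' ⊗ₖ e'')) * C.Θ a b c * ((p ⊗ₖ p') ⊗ₖ p'')

/-- `(Θ^{-1})^{r s t}` for parenthesised words `r`, `s`, `t`. -/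
noncomputable def Θinvtree (r s t : PTree P.Obj) :
    Matrix (PTree.node (PTree.node r s) t).Idx (PTree.node r (PTree.node s t)).Idx ℂ :=
  C.sumComponents r fun a e p => C.sumComponents s fun b e' p' => C.sumComponents t fun c e'' p'' =>
    ((e ⊗ₖ e') ⊗ₖ e'') * C.Θinv a b c * (p ⊗ₖ (p' ⊗ₖ p''))

/-- `A`: `ψ^0_{ᾱα} = ⟨·, A ·⟩`. -/
def A (α : P.I) : Matrix (Fin (P.d α)) (Fin (P.d α)) ℂ :=
  fun i j => C.ψ (P.bar α) (P.o α) P.zero P.ix0 (i, j)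

/-- `B`: `φ_0^{αᾱ}(1) = ∑ B e_i ⊗ e^i`. -/
def B (α : P.I) : Matrix (Fin (P.d α)) (Fin (P.d α)) ℂ :=
  fun i j => C.φ (P.o α) (P.bar α) P.zero (i, j) P.ix0

/-- The ambient isotopy normalisation
`∑ θ⁽¹⁾ B S(θ⁽²⁾) A θ⁽³⁾ = 1` and `∑ S(θ⁻¹⁽¹⁾) A θ⁻¹⁽²⁾ B S(θ⁻¹⁽³⁾) = 1`. -/
def AmbientIsotopy : Prop :=
  ∀ (α : P.I) (i l : Fin (P.d α)),
    (∑ j, ∑ k, ∑ m, ∑ n,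
      C.Θ (P.o α) (P.bar α) (P.o α) (i, (m, n)) ((j, k), l) * C.B α j k * C.A α m n =
        if i = l then 1 else 0) ∧
    (∑ j, ∑ k, ∑ m, ∑ n,
      C.Θinv (P.bar α) (P.o α) (P.bar α) ((j, k), l) (i, (m, n)) * C.A α j k * C.B α m n =
        if i = l then 1 else 0)

/-- The word `(β̄ ᾱ)`. -/
abbrev dualWord (α β : P.I) : PTree P.Obj :=
  .node (.leaf (P.bar β)) (.leaf (P.bar α))

/-- `G^{αβ} = ∑ (S(θ⁻¹⁽¹²⁾) ⊗ S(θ⁻¹⁽¹¹⁾)) (S(θ⁽²⁾) ⊗ S(θ⁽¹⁾)) (A ⊗ A) (θ⁽³⁾ ⊗ 1) (θ⁻¹⁽²⁾ ⊗ θ⁻¹⁽³⁾)`,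
written with `α(S(ξ)) = ᵗᾱ(ξ)`: the bilinear pairing of `β̄ ⊗ ᾱ` with `α ⊗ β` obtained from
`β̄ᾱ(αβ) → ((β̄ᾱ)α)β → (β̄(ᾱα))β` and the contractions by `A`. -/
noncomputable def G (α β : P.I) :
    Matrix (Fin (P.d α) × Fin (P.d β)) (Fin (P.d α) × Fin (P.d β)) ℂ :=
  fun x y => ∑ j₁, ∑ i₁, ∑ k₁, ∑ l₁, ∑ j₂, ∑ i₂, ∑ k₂,
    C.A α i₂ k₂ * C.A β j₂ l₁ *
      C.Θ (P.bar β) (P.bar α) (P.o α) (j₂, (i₂, k₂)) ((j₁, i₁), k₁) *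
      C.Θinvtree (dualWord α β) (.leaf (P.o α)) (.leaf (P.o β))
        ((((j₁, i₁), k₁), l₁) : (_ × _) × _) ((x.2, x.1), (y.1, y.2))

/-- `f^{αβ} = ∑ (S(θ⁻¹⁽¹²⁾) ⊗ S(θ⁻¹⁽¹¹⁾)) G (α ⊗ β)(θ⁻¹⁽²⁾ B S(θ⁻¹⁽³⁾))`, where
`(α ⊗ β)(ξ) = ∑ φ_γ γ(ξ) ψ_γ`. -/
noncomputable def f (α β : P.I) :
    Matrix (Fin (P.d α) × Fin (P.d β)) (Fin (P.d α) × Fin (P.d β)) ℂ :=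
  fun x y => ∑ γ ∈ P.fusion (P.o α) (P.o β), ∑ j, ∑ i, ∑ k, ∑ n, ∑ k', ∑ m,
    (C.G α β * C.φ (P.o α) (P.o β) γ) (i, j) k *
      C.Θinvtree (dualWord α β) (.leaf (P.o γ)) (.leaf (P.bar γ))
        ((((j, i), k), n) : (_ × _) × _) ((x.2, x.1), (k', m)) *
      C.B γ k' m * C.ψ (P.o α) (P.o β) γ n y

/-- The quasi-inverse of `f`: `f⁻¹ f` and `f f⁻¹` are the projectors given by the truncated
`α ⊗ β` and by the transpose of the truncated `β̄ ⊗ ᾱ`. -/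
noncomputable def finv (α β : P.I) :
    Matrix (Fin (P.d α) × Fin (P.d β)) (Fin (P.d α) × Fin (P.d β)) ℂ :=
  quasiInverse
    (∑ γ ∈ P.fusion (P.o α) (P.o β), C.φ (P.o α) (P.o β) γ * C.ψ (P.o α) (P.o β) γ)
    (fun x y => ∑ γ ∈ P.fusion (P.bar β) (P.bar α),
      (C.φ (P.bar β) (P.bar α) γ * C.ψ (P.bar β) (P.bar α) γ) (y.2, y.1) (x.2, x.1))
    (C.f α β)

end ClebschGordan

/-- The underlying space of the dual quantum group `Γ`, with basis the `g^α_{ij}`, `α` physical. -/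
def QGamma {q : ℂ} {P : PhysSystem q} (_C : ClebschGordan P) : Type :=
  (Σ α : P.I, Fin (P.d α) × Fin (P.d α)) →₀ ℂ

namespace QGamma

variable {q : ℂ} {P : PhysSystem q} (C : ClebschGordan P)

noncomputable instance : AddCommGroup (QGamma C) :=
  inferInstanceAs (AddCommGroup ((Σ α : P.I, Fin (P.d α) × Fin (P.d α)) →₀ ℂ))

noncomputable instance : Module ℂ (QGamma C) :=
  inferInstanceAs (Module ℂ ((Σ α : P.I, Fin (P.d α) × Fin (P.d α)) →₀ ℂ))

noncomputable def basis : Module.Basis (Σ α : P.I, Fin (P.d α) × Fin (P.d α)) ℂ (QGamma C) :=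
  ⟨LinearEquiv.refl ℂ ((Σ α : P.I, Fin (P.d α) × Fin (P.d α)) →₀ ℂ)⟩

/-- The generator `g^α_{ij}`. -/
noncomputable def g (α : P.I) (i j : Fin (P.d α)) : QGamma C := basis C ⟨α, (i, j)⟩

/-- The product: `g^α_1 g^β_2 = ∑ φ^{αβ}_γ g^γ ψ_{αβ}^γ`. -/
noncomputable def mulLin : QGamma C →ₗ[ℂ] QGamma C →ₗ[ℂ] QGamma C :=
  (basis C).constr ℂ fun x => (basis C).constr ℂ fun y =>
    ∑ γ ∈ P.fusion (P.o x.1) (P.o y.1), ∑ m, ∑ n,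
      (C.φ (P.o x.1) (P.o y.1) γ (x.2.1, y.2.1) m *
        C.ψ (P.o x.1) (P.o y.1) γ n (x.2.2, y.2.2)) • g C γ m n

noncomputable instance : Mul (QGamma C) := ⟨fun a b => mulLin C a b⟩

/-- The unit `g^0`. -/
noncomputable instance : One (QGamma C) := ⟨g C P.zero P.ix0 P.ix0⟩

theorem mul_eq (a b : QGamma C) : a * b = mulLin C a b := rfl

theorem g_mul_g (α β : P.I) (i j : Fin (P.d α)) (k l : Fin (P.d β)) :
    g C α i j * g C β k l = ∑ γ ∈ P.fusion (P.o α) (P.o β), ∑ m, ∑ n,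
      (C.φ (P.o α) (P.o β) γ (i, k) m * C.ψ (P.o α) (P.o β) γ n (j, l)) • g C γ m n := by
  simp [mul_eq, mulLin, g, Module.Basis.constr_basis]

theorem fusion_eq_singleton (a b : P.Obj) (α : P.I) (h : P.Occurs a b α)
    (h1 : C.φ a b α * C.ψ a b α = 1) : P.fusion a b = {α} := by
  ext γ
  simp only [PhysSystem.fusion, Set.Finite.mem_toFinset, Set.mem_ofPred_eq, Finset.mem_singleton]
  constructor
  · intro hγ
    by_contra hne
    have e := C.ψ_mul_φ a b γ hγ
    have hz : C.ψ a b α * C.φ a b γ = 0 := by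
      by_contra h0
      refine hne (P.schur (C.ψ a b α * C.φ a b γ) ?_ h0)
      intro ξ
      rw [Matrix.mul_assoc, C.φ_intertwines, ← Matrix.mul_assoc, C.ψ_intertwines, Matrix.mul_assoc]
    have h2 : C.ψ a b γ * (C.φ a b α * C.ψ a b α) * C.φ a b γ = 0 := by
      rw [Matrix.mul_assoc, Matrix.mul_assoc, hz, Matrix.mul_zero, Matrix.mul_zero]
    rw [h1, Matrix.mul_one, e] at h2
    have hd : 0 < P.d γ := (P.physical γ).1.1
    simpa using congrFun (congrFun h2 ⟨0, hd⟩) ⟨0, hd⟩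
  · rintro rfl
    exact h

theorem eq_ix0 (i : Fin (P.d P.zero)) : i = P.ix0 :=
  Fin.ext (by have := i.2; have := P.d_zero; simp [PhysSystem.ix0]; omega)

theorem occurs_of_ne_zero (a b : P.Obj) (α : P.I) (h : C.φ a b α ≠ 0) : P.Occurs a b α := by
  by_contra h'
  exact h (C.φ_eq_zero a b α h')

theorem fusion_zero_left (C : ClebschGordan P) (α : P.I) : P.fusion (P.o P.zero) (P.o α) = {α} := by
  have hd : 0 < P.d α := (P.physical α).1.1
  refine fusion_eq_singleton C _ _ α (occurs_of_ne_zero C _ _ _ fun h => ?_) ?_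
  · have := congrFun (congrFun h (P.ix0, ⟨0, hd⟩)) ⟨0, hd⟩
    simp [C.φ_left_zero] at this
  · ext ⟨i, j⟩ ⟨k, l⟩
    rw [C.φ_left_zero, C.ψ_left_zero]
    simp [Matrix.mul_apply, Matrix.one_apply, eq_ix0 i, eq_ix0 k, eq_comm]

theorem fusion_zero_right (C : ClebschGordan P) (α : P.I) : P.fusion (P.o α) (P.o P.zero) = {α} := by
  have hd : 0 < P.d α := (P.physical α).1.1
  refine fusion_eq_singleton C _ _ α (occurs_of_ne_zero C _ _ _ fun h => ?_) ?_
  · have := congrFun (congrFun h (⟨0, hd⟩, P.ix0)) ⟨0, hd⟩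
    simp [C.φ_right_zero] at this
  · ext ⟨i, j⟩ ⟨k, l⟩
    rw [C.φ_right_zero, C.ψ_right_zero]
    simp [Matrix.mul_apply, Matrix.one_apply, eq_ix0 j, eq_ix0 l, eq_comm]

noncomputable instance : NonAssocRing (QGamma C) where
  __ := (inferInstance : AddCommGroup (QGamma C))
  mul := (· * ·)
  one := 1
  left_distrib a b c := by simp [mul_eq]
  right_distrib a b c := by simp [mul_eq]
  zero_mul a := by simp [mul_eq]
  mul_zero a := by simp [mul_eq]
  one_mul a := by
    have : mulLin C (g C P.zero P.ix0 P.ix0) = LinearMap.id := by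
      refine (basis C).ext fun x => ?_
      obtain ⟨α, i, j⟩ := x
      change g C P.zero P.ix0 P.ix0 * g C α i j = g C α i j
      rw [g_mul_g, fusion_zero_left C α, Finset.sum_singleton, C.φ_left_zero, C.ψ_left_zero]
      simp
    exact congrArg (fun L => L a) this
  mul_one a := by
    have : (mulLin C).flip (g C P.zero P.ix0 P.ix0) = LinearMap.id := by
      refine (basis C).ext fun x => ?_
      obtain ⟨α, i, j⟩ := x
      change g C α i j * g C P.zero P.ix0 P.ix0 = g C α i j
      rw [g_mul_g, fusion_zero_right C α, Finset.sum_singleton, C.φ_right_zero, C.ψ_right_zero]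
      simp
    exact congrArg (fun L => L a) this

instance : SMulCommClass ℂ (QGamma C) (QGamma C) :=
  ⟨fun c a b => ((mulLin C a).map_smul c b).symm⟩

instance : IsScalarTower ℂ (QGamma C) (QGamma C) :=
  ⟨fun c a b => by
    change mulLin C (c • a) b = c • mulLin C a b
    rw [map_smul, LinearMap.smul_apply]⟩

/-- The coproduct `Δ(g^α_{ij}) = ∑ g^α_{ik} ⊗ g^α_{kj}`. -/
noncomputable def comul : QGamma C →ₗ[ℂ] QGamma C ⊗[ℂ] QGamma C :=
  (basis C).constr ℂ fun x => ∑ k, g C x.1 x.2.1 k ⊗ₜ[ℂ] g C x.1 k x.2.2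

/-- The counit `ε(g^α_{ij}) = δ_{ij}`. -/
noncomputable def counit : QGamma C →ₗ[ℂ] ℂ :=
  (basis C).constr ℂ fun x => if x.2.1 = x.2.2 then 1 else 0

/-- The matrix `g^a` of a physical representation or of a contragredient one: for a contragredient
`a ≅ a ⊗ 0`, equivalent to the physical representation `γ` through `φ^{a0}_γ`, it is
`φ^{a0}_γ g^γ ψ_{a0}^γ`. -/
noncomputable def gObj (a : P.Obj) (i j : P.Ix a) : QGamma C :=
  ∑ γ ∈ P.fusion a (P.o P.zero), ∑ m, ∑ n,
    (C.φ a (P.o P.zero) γ (i, P.ix0) m * C.ψ a (P.o P.zero) γ n (j, P.ix0)) • g C γ m n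

/-- The antipode `S(g^α_{ij}) = g^{ᾱ}_{ji}`. -/
noncomputable def antipode : QGamma C →ₗ[ℂ] QGamma C :=
  (basis C).constr ℂ fun x => gObj C (P.bar x.1) x.2.2 x.2.1

end QGamma

/-- The gauge symmetry algebra `Γ̂ = ⨂_{z ∈ V} Γ_z`. -/
abbrev GaugeSymmetry {q : ℂ} {P : PhysSystem q} (C : ClebschGordan P) (V : Type) : Type :=
  PiTensorProduct ℂ fun _ : V => QGamma C

namespace GaugeSymmetry

variable {q : ℂ} {P : PhysSystem q} (C : ClebschGordan P) {V : Type} [Fintype V] [DecidableEq V]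

instance : SMulCommClass ℂ (GaugeSymmetry C V) (GaugeSymmetry C V) :=
  ⟨fun s a b => ((PiTensorProduct.mul a).map_smul s b).symm⟩

instance : IsScalarTower ℂ (GaugeSymmetry C V) (GaugeSymmetry C V) :=
  ⟨fun s a b => by
    change PiTensorProduct.mul (s • a) b = s • PiTensorProduct.mul a b
    rw [map_smul, LinearMap.smul_apply]⟩

/-- The embedding `a ↦ a_x` of `Γ` as the factor `Γ_x`. -/
noncomputable def single (x : V) (a : QGamma C) : GaugeSymmetry C V :=
  PiTensorProduct.tprod ℂ fun z => if z = x then a else 1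

/-- The basis of `Γ̂` formed by the pure tensors of generators. -/
noncomputable def basis :
    Module.Basis (V → Σ α : P.I, Fin (P.d α) × Fin (P.d α)) ℂ (GaugeSymmetry C V) :=
  Basis.piTensorProduct fun _ : V => QGamma.basis C

/-- The coproduct of `Γ̂`, the tensor product of the coproducts of the factors. -/
noncomputable def comul :
    GaugeSymmetry C V →ₗ[ℂ] GaugeSymmetry C V ⊗[ℂ] GaugeSymmetry C V :=
  (basis C).constr ℂ fun x => ∑ k : ∀ z, Fin (P.d (x z).1),
    (PiTensorProduct.tprod ℂ fun z => QGamma.g C (x z).1 (x z).2.1 (k z)) ⊗ₜ[ℂ]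
      (PiTensorProduct.tprod ℂ fun z => QGamma.g C (x z).1 (k z) (x z).2.2)

/-- The coproduct followed by the exchange of the two factors. -/
noncomputable def comulOp :
    GaugeSymmetry C V →ₗ[ℂ] GaugeSymmetry C V ⊗[ℂ] GaugeSymmetry C V :=
  (TensorProduct.comm ℂ _ _).toLinearMap ∘ₗ comul C

/-- The counit of `Γ̂`, the tensor product of the counits of the factors. -/
noncomputable def counit : GaugeSymmetry C V →ₗ[ℂ] ℂ :=
  (basis C).constr ℂ fun x => ∏ z, QGamma.counit C (QGamma.basis C (x z))

end GaugeSymmetry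

/-- A triangulated compact connected oriented surface with (possibly empty) boundary, given by
its positively oriented triangles `tri x y z`. -/
structure TriangulatedSurface (V : Type) where
  tri : V → V → V → Prop
  cyclic : ∀ x y z, tri x y z → tri y z x
  ne : ∀ x y z, tri x y z → x ≠ y
  /-- An oriented edge is in the boundary of at most one positively oriented triangle. -/
  unique : ∀ x y z w, tri x y z → tri x y w → z = w
  /-- A triangle is positively oriented for only one of its two orientations. -/
  asymm : ∀ x y z, tri x y z → ¬ tri y x z
  exists_tri : ∀ x, ∃ y z, tri x y z
  nonempty : Nonempty V
  connected : ∀ x y, Relation.ReflTransGen (fun a b => ∃ c, tri a b c ∨ tri b a c) x y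
  /-- The link of every vertex is connected, hence a circle or a segment. -/
  link_connected : ∀ x y z, (∃ w, tri x y w ∨ tri x w y) → (∃ w, tri x z w ∨ tri x w z) →
    Relation.ReflTransGen (fun a b => tri x a b ∨ tri x b a) y z

namespace TriangulatedSurface

variable {V : Type} (T : TriangulatedSurface V)

/-- `x` and `y` are neighbours. -/
def Adj (x y : V) : Prop := ∃ w, T.tri x y w ∨ T.tri x w y

/-- `xy ∈ L`: the link with departure point `y` and end point `x` is an edge, with its
orientation, of the boundary of an oriented face. Both orientations of an interior edge are
links, and exactly one orientation of a boundary edge. -/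
def IsLink (x y : V) : Prop := ∃ w, T.tri y x w

/-- The links, as pairs (end point, departure point). -/
abbrev Link : Type := {l : V × V // T.IsLink l.1 l.2}

end TriangulatedSurface

/-- A ciliation: at each vertex `x` the cilium cuts the cyclic order, given by the orientation, of
the neighbours of `x` (at a boundary vertex the cycle is closed through the outside of the surface)
into the linear order `order x`. -/
structure Ciliation {V : Type} [DecidableEq V] (T : TriangulatedSurface V) where
  order : V → List V
  nodup : ∀ x, (order x).Nodup
  mem_iff : ∀ x y, y ∈ order x ↔ T.Adj x y
  next_eq : ∀ x y z, T.tri x y z → ∃ h : y ∈ order x, (order x).next y h = z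

/-- `xy <_c xz` at the vertex `x` (for unoriented links). -/
def Ciliation.lt {V : Type} [DecidableEq V] {T : TriangulatedSurface V} (c : Ciliation T)
    (x y z : V) : Prop :=
  y ∈ c.order x ∧ z ∈ c.order x ∧ (c.order x).idxOf y < (c.order x).idxOf z

namespace ClebschGordan

variable {q : ℂ} {P : PhysSystem q} (C : ClebschGordan P)

/-- The truncated `R`-matrix: `P₁₂ R^{ab} = ∑ r_{abγ} φ^{ba}_γ ψ_{ab}^γ` with `r = λ^{1/2}`. -/
noncomputable def R (r : P.Obj → P.Obj → P.I → ℂ) (a b : P.Obj) :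
    Matrix (P.Ix a × P.Ix b) (P.Ix a × P.Ix b) ℂ :=
  fun x y => ∑ γ ∈ P.fusion a b, r a b γ * (C.φ b a γ * C.ψ a b γ) (x.2, x.1) y

/-- `(S ⊗ id)(R)` on `α ⊗ β`, through `α(S(ξ)) = ᵗᾱ(ξ)`. -/
noncomputable def SidR (r : P.Obj → P.Obj → P.I → ℂ) (α β : P.I) :
    Matrix (Fin (P.d α) × Fin (P.d β)) (Fin (P.d α) × Fin (P.d β)) ℂ :=
  fun x y => C.R r (P.bar α) (P.o β) (y.1, x.2) (x.1, y.2)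

/-- `(S ⊗ S)(R)` on `α ⊗ β`. -/
noncomputable def SSR (r : P.Obj → P.Obj → P.I → ℂ) (α β : P.I) :
    Matrix (Fin (P.d α) × Fin (P.d β)) (Fin (P.d α) × Fin (P.d β)) ℂ :=
  fun x y => C.R r (P.bar α) (P.bar β) y x

end ClebschGordan

/-- `r` is a square root of `λ`: `r_{abγ} r_{baγ} = λ_{abγ} = v_a v_b / v_γ`. (For a single-valued
`λ^{1/2}` symmetric in `a`, `b` this says `r² = λ`; in general `r_{abγ}` also depends on
the relative normalisation of `φ^{ab}_γ` and `φ^{ba}_γ`.) -/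
def IsSqrtCasimirRatio {q : ℂ} (P : PhysSystem q) (t : ℂ) (r : P.Obj → P.Obj → P.I → ℂ) : Prop :=
  ∀ a b γ, r a b γ * r b a γ = P.casimirRatio t a b γ

/-- How a vertex lies on a link: as its end point, as its departure point, or not at all. -/
inductive Incidence
  | target
  | source
  | away

namespace Incidence

variable {q : ℂ} {P : PhysSystem q}

/-- The representation `α`, `ᾱ` or `0` attached to a vertex of a link coloured by `α`. -/
def obj (α : P.I) : Incidence → P.Obj
  | target => P.o α
  | source => P.bar α
  | away => P.o P.zero

def index (α : P.I) (x : Fin (P.d α) × Fin (P.d α)) : (c : Incidence) → P.Ix (obj α c)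
  | target => x.1
  | source => x.2
  | away => P.ix0

end Incidence

section GaugeFields

variable {q : ℂ} {P : PhysSystem q} (C : ClebschGordan P) {V : Type} [Fintype V] [DecidableEq V]
  (T : TriangulatedSurface V)

def TriangulatedSurface.incidence (x : V) (l : T.Link) : Incidence :=
  if x = l.1.1 then .target else if x = l.1.2 then .source else .away

/-- The generators `u^α(l)^i_j`. -/
abbrev FieldGen (P : PhysSystem q) (T : TriangulatedSurface V) : Type :=
  Σ (_ : T.Link) (α : P.I), Fin (P.d α) × Fin (P.d α)

/-- The free unital non-associative algebra on the `u^α(l)^i_j`. -/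
abbrev FreeFields (P : PhysSystem q) (T : TriangulatedSurface V) : Type :=
  MonoidAlgebra ℂ (WithOne (FreeMagma (FieldGen P T)))

variable (P) in
/-- `u^α(l)^i_j` in the free algebra. -/
noncomputable def uFree (l : T.Link) (α : P.I) (i j : Fin (P.d α)) : FreeFields P T :=
  MonoidAlgebra.single (FreeMagma.of (⟨l, α, (i, j)⟩ : FieldGen P T) : WithOne (FreeMagma _)) 1

/-- Coloured parenthesised words of links. -/
abbrev Word (P : PhysSystem q) (T : TriangulatedSurface V) : Type := PTree (T.Link × P.I)

namespace Word

variable {T}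

/-- The parenthesised word of representations at the vertex `x`. -/
def at_ (x : V) (M : Word P T) : PTree P.Obj :=
  PTree.map (fun l => (T.incidence x l.1).obj l.2) M

/-- The matrix indices of a monomial. -/
def Idx : Word P T → Type
  | .leaf l => Fin (P.d l.2) × Fin (P.d l.2)
  | .node s t => Idx s × Idx t

instance instFintypeIdx : (M : Word P T) → Fintype (Idx M)
  | .leaf l => inferInstanceAs (Fintype (Fin (P.d l.2) × Fin (P.d l.2)))
  | .node s t =>
    haveI := instFintypeIdx s
    haveI := instFintypeIdx t
    inferInstanceAs (Fintype (Idx s × Idx t))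

/-- The part of the indices of a monomial that belongs to the vertex `x`. -/
def indexAt (x : V) : (M : Word P T) → Idx M → (at_ x M).Idx
  | .leaf l, i => (T.incidence x l.1).index l.2 i
  | .node s t, i => (indexAt x s i.1, indexAt x t i.2)

/-- The monomial with given parenthesising and indices. -/
noncomputable def monomial : (M : Word P T) → Idx M → FreeFields P T
  | .leaf l, i => uFree P T l.1 l.2 i.1 i.2
  | .node s t, i => monomial s i.1 * monomial t i.2

end Word

/-- `Reparenthesise M M' Θ`: `M` and `M'` are the same monomial up to parenthesising, and `Θ x`
is an intertwiner composed of associators from the tensor product at the vertex `x` of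
representations parenthesised as in `M` to the one parenthesised as in `M'`. -/
inductive Reparenthesise : (M M' : Word P T) →
    (∀ x : V, Matrix (M'.at_ x).Idx (M.at_ x).Idx ℂ) → Prop
  | refl (M : Word P T) : Reparenthesise M M fun x => C.proj (M.at_ x)
  | assoc (M N K : Word P T) :
      Reparenthesise (.node (.node M N) K) (.node M (.node N K))
        fun x => C.Θtree (M.at_ x) (N.at_ x) (K.at_ x)
  | assoc_inv (M N K : Word P T) :
      Reparenthesise (.node M (.node N K)) (.node (.node M N) K)
        fun x => C.Θinvtree (M.at_ x) (N.at_ x) (K.at_ x)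
  | node (M M' N N' : Word P T) (Θ Θ') :
      Reparenthesise M M' Θ → Reparenthesise N N' Θ' →
      Reparenthesise (.node M N) (.node M' N') fun x =>
        C.proj (.node (M'.at_ x) (N'.at_ x)) *
          PTree.kron (Θ x) (Θ' x) *
          C.proj (.node (M.at_ x) (N.at_ x))
  | trans (M M' M'' : Word P T) (Θ Θ') :
      Reparenthesise M M' Θ → Reparenthesise M' M'' Θ' →
      Reparenthesise M M'' fun x => Θ' x * Θ x

/-- The defining relations of the algebra of gauge fields. -/
inductive FieldRel (c : Ciliation T) (r : P.Obj → P.Obj → P.I → ℂ) :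
    FreeFields P T → FreeFields P T → Prop
  /-- `R₁₂ u(yx)₁ u(yz)₂ = u(yz)₂ u(yx)₁`. -/
  | target_target (x y z : V) (hx : T.IsLink y x) (hz : T.IsLink y z) (hne : x ≠ z)
      (hlt : c.lt y x z) (α β : P.I) (i j : Fin (P.d α)) (k l : Fin (P.d β)) :
      FieldRel c r
        (∑ m, ∑ n, C.R r (P.o α) (P.o β) (i, k) (m, n) •
          (uFree P T ⟨(y, x), hx⟩ α m j * uFree P T ⟨(y, z), hz⟩ β n l))
        (uFree P T ⟨(y, z), hz⟩ β k l * uFree P T ⟨(y, x), hx⟩ α i j)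
  /-- `u(xy)₁ (S ⊗ id)(R₁₂) u(yz)₂ = u(yz)₂ u(xy)₁`. -/
  | source_target (x y z : V) (hx : T.IsLink x y) (hz : T.IsLink y z) (hne : x ≠ z)
      (hlt : c.lt y x z) (α β : P.I) (i j : Fin (P.d α)) (k l : Fin (P.d β)) :
      FieldRel c r
        (∑ m, ∑ n, C.SidR r α β (m, k) (j, n) •
          (uFree P T ⟨(x, y), hx⟩ α i m * uFree P T ⟨(y, z), hz⟩ β n l))
        (uFree P T ⟨(y, z), hz⟩ β k l * uFree P T ⟨(x, y), hx⟩ α i j)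
  /-- `u(xy)₁ u(zy)₂ (S ⊗ S)(R₁₂) = u(zy)₂ u(xy)₁`. -/
  | source_source (x y z : V) (hx : T.IsLink x y) (hz : T.IsLink z y) (hne : x ≠ z)
      (hlt : c.lt y x z) (α β : P.I) (i j : Fin (P.d α)) (k l : Fin (P.d β)) :
      FieldRel c r
        (∑ m, ∑ n, C.SSR r α β (m, n) (j, l) •
          (uFree P T ⟨(x, y), hx⟩ α i m * uFree P T ⟨(z, y), hz⟩ β k n))
        (uFree P T ⟨(z, y), hz⟩ β k l * uFree P T ⟨(x, y), hx⟩ α i j)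
  /-- `u(l) A u(-l) = B` for interior links. -/
  | inverse (x y : V) (h : T.IsLink x y) (h' : T.IsLink y x) (α : P.I) (i j : Fin (P.d α)) :
      FieldRel c r
        (∑ m, ∑ n, C.A α m n • (uFree P T ⟨(x, y), h⟩ α i m * uFree P T ⟨(y, x), h'⟩ α n j))
        (C.B α i j • 1)
  /-- Links without a common vertex commute. -/
  | disjoint (x y z w : V) (h : T.IsLink x y) (h' : T.IsLink z w) (hxz : x ≠ z) (hxw : x ≠ w)
      (hyz : y ≠ z) (hyw : y ≠ w) (α β : P.I) (i j : Fin (P.d α)) (k l : Fin (P.d β)) :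
      FieldRel c r
        (uFree P T ⟨(x, y), h⟩ α i j * uFree P T ⟨(z, w), h'⟩ β k l)
        (uFree P T ⟨(z, w), h'⟩ β k l * uFree P T ⟨(x, y), h⟩ α i j)
  /-- `u^α(l)₁ u^β(l)₂ = ∑ φ^{αβ}_γ u^γ(l) ψ_{βα}^γ f⁻¹ P₁₂`. -/
  | decomposition (a : T.Link) (α β : P.I) (i j : Fin (P.d α)) (k l : Fin (P.d β)) :
      FieldRel c r
        (uFree P T a α i j * uFree P T a β k l)
        (∑ γ ∈ P.fusion (P.o α) (P.o β), ∑ m, ∑ n,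
          (C.φ (P.o α) (P.o β) γ (i, k) m *
            (C.ψ (P.o β) (P.o α) γ * C.finv β α) n (l, j)) • uFree P T a γ m n)
  /-- `u^0(l) = 1`. -/
  | unit (a : T.Link) (i j : Fin (P.d P.zero)) : FieldRel c r (uFree P T a P.zero i j) 1
  /-- `(∏_x Θ_x) M = M'`. -/
  | quasi_assoc (M M' : Word P T) (Θ : ∀ x : V, Matrix (M'.at_ x).Idx (M.at_ x).Idx ℂ)
      (h : Reparenthesise C T M M' Θ) (i : M'.Idx) :
      FieldRel c r
        (∑ j : M.Idx, (∏ x, Θ x (M'.indexAt x i) (M.indexAt x j)) • M.monomial j)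
        (M'.monomial i)

/-- The gauge fields algebra `Λ`: the quotient of the free algebra by the two-sided ideal
generated by the defining relations. -/
def GaugeFields (c : Ciliation T) (r : P.Obj → P.Obj → P.I → ℂ) : Type :=
  (ringConGen (FieldRel C T c r)).Quotient

variable {T} (c : Ciliation T) (r : P.Obj → P.Obj → P.I → ℂ)

noncomputable instance : NonAssocRing (GaugeFields C T c r) :=
  inferInstanceAs (NonAssocRing (ringConGen (FieldRel C T c r)).Quotient)

/-- The quotient map. -/
noncomputable def GaugeFields.mk (a : FreeFields P T) : GaugeFields C T c r :=
  (a : (ringConGen (FieldRel C T c r)).Quotient)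

noncomputable instance : DistribMulAction ℂ (GaugeFields C T c r) :=
  inferInstanceAs (DistribMulAction ℂ (ringConGen (FieldRel C T c r)).Quotient)

noncomputable instance : Module ℂ (GaugeFields C T c r) where
  add_smul s t := by
    rintro ⟨a⟩
    exact congrArg (GaugeFields.mk C c r) (add_smul s t a)
  zero_smul := by
    rintro ⟨a⟩
    exact congrArg (GaugeFields.mk C c r) (zero_smul ℂ a)

instance : SMulCommClass ℂ (GaugeFields C T c r) (GaugeFields C T c r) :=
  inferInstanceAs (SMulCommClass ℂ (ringConGen (FieldRel C T c r)).Quotient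
    (ringConGen (FieldRel C T c r)).Quotient)

instance : IsScalarTower ℂ (GaugeFields C T c r) (GaugeFields C T c r) :=
  inferInstanceAs (IsScalarTower ℂ (ringConGen (FieldRel C T c r)).Quotient
    (ringConGen (FieldRel C T c r)).Quotient)

/-- The class `u^α(l)^i_j` in `Λ`. -/
noncomputable def GaugeFields.u (l : T.Link) (α : P.I) (i j : Fin (P.d α)) : GaugeFields C T c r :=
  GaugeFields.mk C c r (uFree P T l α i j)

/-- `(g^α_x u^α(xy) S(g^α_y))^i_j`, an element of `Λ ⊗ Γ̂`. -/
noncomputable def gaugeTransform (l : T.Link) (α : P.I) (i j : Fin (P.d α)) :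
    GaugeFields C T c r ⊗[ℂ] GaugeSymmetry C V :=
  ∑ k, ∑ m, GaugeFields.u C c r l α k m ⊗ₜ[ℂ]
    (GaugeSymmetry.single C l.1.1 (QGamma.g C α i k) *
      GaugeSymmetry.single C l.1.2 (QGamma.antipode C (QGamma.g C α m j)))

/-- The morphism of unital algebras from the free algebra to `Λ ⊗ Γ̂` that sends `u^α(xy)` to
`g^α_x u^α(xy) S(g^α_y)`. -/
noncomputable def freeCoaction :
    FreeFields P T →ₙₐ[ℂ] GaugeFields C T c r ⊗[ℂ] GaugeSymmetry C V :=
  MonoidAlgebra.liftMagma ℂ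
    (WithOne.lift (FreeMagma.lift fun x : FieldGen P T =>
      gaugeTransform C c r x.1 x.2.1 x.2.2.1 x.2.2.2) : _ →* _).toMulHom

end GaugeFields

/-! Attach to every object `a`, a physical representation or the contragredient of one, its matrix
g^a with entries in Γ. Call a scalar matrix X covariant if X U = U' X, where U and U' are such
matrices or Kronecker products of them. The product of Γ reads g^a ⊗ g^b = ∑ φ_γ g^γ ψ^γ, and ψ^γ
φ_δ vanishes for γ ≠ δ, so φ and ψ are covariant (`ClebschGordan.cov_φ`, `ClebschGordan.cov_ψ`).
Covariance survives sums, products, Kronecker products (`Cov.kronecker`) and quasi-inverses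
(`Cov.quasiInverse`). Hence the truncation projectors, the associators and their quasi-inverses, the
braiding, and A and B as invariant form and vector are all covariant. For f one argues
componentwise: each component β̄ ⊗ ᾱ → γ̄ is covariant, and so are the components of the
quasi-inverse (`ClebschGordan.cov_fComponent`, `ClebschGordan.cov_finv`).

The product law is built into Γ only for physical `a` and `b`; for a contragredient, g^a is
transported from the equivalent physical representation. Extending the law is where the
representation theory of U_q(sl₂) is needed. The quantum dimension tr K of a physical representation
is nonzero, which forces the order of q² to exceed the dimension (`UqRep.IsPhysical.pow_ne_one`). A
physical representation and its contragredient then have the same standard form F^i w, hence are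
equivalent, and each γ occurs in a ⊗ b at most once. So the transported φ and ψ differ from the
chosen ones by mutually inverse scalars, which cancel in φ g ψ (`QGamma.gObj_mul_gObj`).

Since Γ̂ is a tensor product over the vertices, the coefficients by which it coacts on a monomial
factor over the vertices; the factor at x is a product of matrices g^α, g^ᾱ and g^0 = 1
(`freeCoaction_monomial`). Each defining relation contracts products of the generators with matrices
living at vertices. Covariance moves these matrices to the other side of the coefficients, and the
relation itself, which holds in Λ, finishes the argument (`sum_smul_tmul_exchange`,
`Word.coeff_cov`). The free coaction therefore descends to Λ.

For the comodule axioms, Δ is multiplicative on Γ, again by covariance (`QGamma.comul_of_cov`,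
`QGamma.comul_mul`), so the coefficients of a monomial comultiply like matrix coefficients. With
truncation ε need not be multiplicative: applied to a product of the g^a it gives the truncation
projector instead of the identity (`ClebschGordan.counit_gTree`). The counit axiom holds because
quasi-associativity with nothing moved says that these projectors fix every monomial of Λ. -/

set_option linter.unusedSectionVars false

/-! ### The structure maps of U_q(sl₂) on generators. -/

namespace Uq

variable {q : ℂ}

theorem mk_surjective : Function.Surjective (mk q) := RingQuot.mkAlgHom_surjective ℂ (UqRel q)

@[elab_as_elim]
theorem induction {p : Uq q → Prop} (halg : ∀ c, p (algebraMap ℂ (Uq q) c))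
    (hgen : ∀ x, p (gen q x)) (hmul : ∀ a b, p a → p b → p (a * b))
    (hadd : ∀ a b, p a → p b → p (a + b)) (ξ : Uq q) : p ξ := by
  obtain ⟨a, rfl⟩ := mk_surjective ξ
  induction a using FreeAlgebra.induction with
  | grade0 c => rw [AlgHom.commutes]; exact halg c
  | grade1 x => exact hgen x
  | mul a b ha hb => rw [map_mul]; exact hmul _ _ ha hb
  | add a b ha hb => rw [map_add]; exact hadd _ _ ha hb

theorem lift_gen {A : Type*} [Ring A] [Algebra ℂ A] (e f k k' : A)
    (h₁ : k * k' = 1) (h₂ : k' * k = 1) (h₃ : k * e = q ^ 2 • (e * k))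
    (h₄ : f * k = q ^ 2 • (k * f)) (h₅ : e * f - f * e = (q - q⁻¹)⁻¹ • (k - k')) (x : UqGen) :
    lift (q := q) e f k k' h₁ h₂ h₃ h₄ h₅ (gen q x) =
      match x with
      | .E => e
      | .F => f
      | .K => k
      | .Kinv => k' := by
  simp only [lift, gen, mk]
  erw [RingQuot.liftAlgHom_mkAlgHom_apply]
  simp only [FreeAlgebra.lift_ι_apply]

theorem comul_E : comul (gen q .E) = gen q .E ⊗ₜ[ℂ] gen q .K + 1 ⊗ₜ[ℂ] gen q .E := lift_gen ..
theorem comul_F : comul (gen q .F) = gen q .F ⊗ₜ[ℂ] 1 + gen q .Kinv ⊗ₜ[ℂ] gen q .F := lift_gen ..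
theorem comul_K : comul (gen q .K) = gen q .K ⊗ₜ[ℂ] gen q .K := lift_gen ..
theorem comul_Kinv : comul (gen q .Kinv) = gen q .Kinv ⊗ₜ[ℂ] gen q .Kinv := lift_gen ..
theorem counit_E : counit (gen q .E) = 0 := lift_gen ..
theorem counit_F : counit (gen q .F) = 0 := lift_gen ..
theorem counit_K : counit (gen q .K) = 1 := lift_gen ..
theorem counit_Kinv : counit (gen q .Kinv) = 1 := lift_gen ..

open MulOpposite in
theorem antipode_E : (antipode (gen q .E)).unop = -(gen q .E * gen q .Kinv) :=
  congrArg unop (lift_gen ..)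
open MulOpposite in
theorem antipode_F : (antipode (gen q .F)).unop = -(gen q .K * gen q .F) :=
  congrArg unop (lift_gen ..)
open MulOpposite in
theorem antipode_K : (antipode (gen q .K)).unop = gen q .Kinv := congrArg unop (lift_gen ..)

/-- The counit property, in the form `(id ⊗ ε) Δ = id`. -/
theorem counit_comul (ξ : Uq q) :
    Algebra.TensorProduct.rid ℂ ℂ (Uq q)
      (Algebra.TensorProduct.map (AlgHom.id ℂ (Uq q)) (counit (q := q)) (comul ξ)) = ξ := by
  induction ξ using Uq.induction with
  | halg c => simp only [AlgHom.commutes, AlgEquiv.commutes]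
  | hgen x =>
    cases x
    · simp [comul_E, counit_E, counit_K]
    · simp [comul_F, counit_F]
    · simp [comul_K, counit_K]
    · simp [comul_Kinv, counit_Kinv]
  | hmul a b ha hb => rw [map_mul, map_mul, map_mul, ha, hb]
  | hadd a b ha hb => rw [map_add, map_add, map_add, ha, hb]

end Uq

/-! ### Tensor products of representations and of intertwiners. -/

section TensorRep

variable {q : ℂ} {m n m' n' : Type*} [Fintype m] [Fintype n] [Fintype m'] [Fintype n']

/-- The tensor product of two matrix-valued maps, before restriction along the coproduct. -/
theorem tensorRep_apply (f : Uq q →ₗ[ℂ] Matrix m m ℂ) (g : Uq q →ₗ[ℂ] Matrix n n ℂ) (ξ : Uq q) :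
    tensorRep f g ξ = TensorProduct.lift
      ((Matrix.kroneckerBilinear (R := ℂ) (α := ℂ)).compl₁₂ f g) (Uq.comul ξ) := rfl

theorem tensorRep_E (f : Uq q →ₗ[ℂ] Matrix m m ℂ) (g : Uq q →ₗ[ℂ] Matrix n n ℂ) :
    tensorRep f g (Uq.gen q .E) = f (Uq.gen q .E) ⊗ₖ g (Uq.gen q .K) + f 1 ⊗ₖ g (Uq.gen q .E) := by
  rw [tensorRep_apply, Uq.comul_E]; rfl

theorem tensorRep_F (f : Uq q →ₗ[ℂ] Matrix m m ℂ) (g : Uq q →ₗ[ℂ] Matrix n n ℂ) :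
    tensorRep f g (Uq.gen q .F) =
      f (Uq.gen q .F) ⊗ₖ g 1 + f (Uq.gen q .Kinv) ⊗ₖ g (Uq.gen q .F) := by
  rw [tensorRep_apply, Uq.comul_F]; rfl

theorem tensorRep_K (f : Uq q →ₗ[ℂ] Matrix m m ℂ) (g : Uq q →ₗ[ℂ] Matrix n n ℂ) :
    tensorRep f g (Uq.gen q .K) = f (Uq.gen q .K) ⊗ₖ g (Uq.gen q .K) := by
  rw [tensorRep_apply, Uq.comul_K]; rfl

/-- Intertwiners can be tensored. -/
theorem tensorRep_intertwines {f : Uq q →ₗ[ℂ] Matrix m m ℂ} {g : Uq q →ₗ[ℂ] Matrix n n ℂ}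
    {f' : Uq q →ₗ[ℂ] Matrix m' m' ℂ} {g' : Uq q →ₗ[ℂ] Matrix n' n' ℂ}
    {X : Matrix m' m ℂ} {Y : Matrix n' n ℂ} (hX : Intertwines f f' X) (hY : Intertwines g g' Y) :
    Intertwines (tensorRep f g) (tensorRep f' g') (X ⊗ₖ Y) := by
  intro ξ
  rw [tensorRep_apply, tensorRep_apply]
  induction Uq.comul ξ using TensorProduct.induction_on with
  | zero => simp
  | tmul x y =>
    change X ⊗ₖ Y * f x ⊗ₖ g y = f' x ⊗ₖ g' y * X ⊗ₖ Y
    rw [← Matrix.mul_kronecker_mul, ← Matrix.mul_kronecker_mul, hX x, hY y]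
  | add a b ha hb => rw [map_add, map_add, Matrix.mul_add, Matrix.add_mul, ha, hb]

/-- Tensoring with the counit does nothing. -/
theorem tensorRep_counit_apply (f : Uq q →ₗ[ℂ] Matrix m m ℂ)
    (g : Uq q →ₗ[ℂ] Matrix n n ℂ) (k : n) (hg : ∀ ξ, g ξ k k = Uq.counit (q := q) ξ)
    (ξ : Uq q) (i j : m) : tensorRep f g ξ (i, k) (j, k) = f ξ i j := by
  conv_rhs => rw [← Uq.counit_comul ξ]
  rw [tensorRep_apply]
  induction Uq.comul ξ using TensorProduct.induction_on with
  | zero => simp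
  | tmul x y =>
    change f x i j * g y k k = _
    rw [hg]
    simp [mul_comm]
  | add a b ha hb => simp only [map_add, Matrix.add_apply, ha, hb]

end TensorRep

/-! ### Reduction to generators, Schur's lemma, and the contragredient. -/

namespace UqRep

variable {q : ℂ} {d e : ℕ}

/-- Intertwining can be checked on generators. -/
theorem intertwines_of_gen (ρ : UqRep q d) (σ : UqRep q e) (X : Matrix (Fin e) (Fin d) ℂ)
    (h : ∀ x, X * ρ (Uq.gen q x) = σ (Uq.gen q x) * X) : Intertwines ρ σ X := by
  intro ξ
  induction ξ using Uq.induction with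
  | halg c =>
    rw [AlgHom.commutes, AlgHom.commutes, Algebra.algebraMap_eq_smul_one,
      Algebra.algebraMap_eq_smul_one]
    simp
  | hgen x => exact h x
  | hmul a b ha hb =>
    rw [map_mul, map_mul, ← Matrix.mul_assoc, ha, Matrix.mul_assoc, hb, Matrix.mul_assoc]
  | hadd a b ha hb => rw [map_add, map_add, Matrix.mul_add, Matrix.add_mul, ha, hb]

theorem invariant_of_gen (ρ : UqRep q d) (W : Submodule ℂ (Fin d → ℂ))
    (h : ∀ x, ∀ w ∈ W, ρ (Uq.gen q x) *ᵥ w ∈ W) (ξ : Uq q) : ∀ w ∈ W, ρ ξ *ᵥ w ∈ W := by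
  induction ξ using Uq.induction with
  | halg c =>
    intro w hw
    rw [AlgHom.commutes, Algebra.algebraMap_eq_smul_one, Matrix.smul_mulVec, one_mulVec]
    exact W.smul_mem _ hw
  | hgen x => exact h x
  | hmul a b ha hb =>
    intro w hw
    rw [map_mul, ← mulVec_mulVec]
    exact ha _ (hb _ hw)
  | hadd a b ha hb =>
    intro w hw
    rw [map_add, add_mulVec]
    exact W.add_mem (ha _ hw) (hb _ hw)

/-- Schur's lemma: a matrix that commutes with an irreducible representation is a scalar. -/
theorem IsIrreducible.eq_smul_one {ρ : UqRep q d} (h : ρ.IsIrreducible)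
    (M : Matrix (Fin d) (Fin d) ℂ) (hM : ∀ x, M * ρ (Uq.gen q x) = ρ (Uq.gen q x) * M) :
    ∃ c : ℂ, M = c • (1 : Matrix (Fin d) (Fin d) ℂ) := by
  have : Nonempty (Fin d) := ⟨⟨0, h.1⟩⟩
  obtain ⟨c, hc⟩ := Module.End.exists_eigenvalue (K := ℂ) (V := Fin d → ℂ) M.mulVecLin
  refine ⟨c, ?_⟩
  have hmem : ∀ w, w ∈ Module.End.eigenspace M.mulVecLin c ↔ M *ᵥ w = c • w := fun w => by
    rw [Module.End.mem_eigenspace_iff, mulVecLin_apply]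
  have htop := (h.2 (Module.End.eigenspace M.mulVecLin c) (ρ.invariant_of_gen _ (by
    intro x w hw
    rw [hmem] at hw ⊢
    rw [mulVec_mulVec, hM, ← mulVec_mulVec, hw, mulVec_smul]))).resolve_left hc
  apply Matrix.mulVec_injective
  funext w
  have : w ∈ Module.End.eigenspace M.mulVecLin c := htop ▸ Submodule.mem_top
  rw [hmem] at this
  rw [this, smul_mulVec, one_mulVec]

/-- The contragredient representation as an algebra morphism. -/
noncomputable def dualHom (ρ : UqRep q d) : UqRep q d :=
  AlgHom.ofLinearMap ρ.dualLin
    (by change (ρ (Uq.antipode 1).unop)ᵀ = 1; simp)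
    (by
      intro x y
      change (ρ (Uq.antipode (x * y)).unop)ᵀ = (ρ (Uq.antipode x).unop)ᵀ * (ρ (Uq.antipode y).unop)ᵀ
      rw [map_mul, MulOpposite.unop_mul, map_mul, Matrix.transpose_mul])

theorem dualHom_apply (ρ : UqRep q d) (ξ : Uq q) : ρ.dualHom ξ = (ρ (Uq.antipode ξ).unop)ᵀ := rfl

end UqRep

/-! ### Highest weight vectors and the standard form of a type 1 representation. -/

namespace UqRep

variable {q : ℂ} {d e : ℕ}

/-- The `K`-weight of `F^i w` for `w` a highest weight vector of weight `q^(d-1)`. -/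
noncomputable def weight (q : ℂ) (d i : ℕ) : ℂ := q ^ ((d : ℤ) - 1 - 2 * i)

/-- The scalar `[i][d-i]` by which `E` maps `F^i w` to `F^(i-1) w`. -/
noncomputable def raise (q : ℂ) (d i : ℕ) : ℂ :=
  (q ^ (i : ℤ) - q ^ (-(i : ℤ))) * (q ^ ((d : ℤ) - i) - q ^ ((i : ℤ) - d)) / (q - q⁻¹) ^ 2

theorem weight_ne_zero (hq : q ≠ 0) (i : ℕ) : weight q d i ≠ 0 := zpow_ne_zero _ hq

theorem weight_succ (hq : q ≠ 0) (i : ℕ) : weight q d (i + 1) = (q ^ 2)⁻¹ * weight q d i := by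
  unfold weight
  rw [show (d : ℤ) - 1 - 2 * ((i + 1 : ℕ) : ℤ) = -2 + (d - 1 - 2 * i) by push_cast; ring,
    zpow_add₀ hq, _root_.zpow_neg]
  norm_cast

theorem sub_inv_ne_zero (hq : q ≠ 0) (h : q ^ 2 ≠ 1) : q - q⁻¹ ≠ 0 := by
  intro h0
  apply h
  field_simp at h0
  linear_combination h0

/-- The increment is the eigenvalue of EF - FE on F^i w, so this is the recursion that determines
the action of E on the orbit of a highest weight vector. -/
theorem raise_succ (hq : q ≠ 0) (h : q ^ 2 ≠ 1) (i : ℕ) :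
    raise q d (i + 1) = raise q d i + (q - q⁻¹)⁻¹ * (weight q d i - (weight q d i)⁻¹) := by
  have hs := sub_inv_ne_zero hq h
  have e1 : q ^ ((i + 1 : ℕ) : ℤ) = q ^ i * q := by norm_cast
  have e2 : q ^ (-((i + 1 : ℕ) : ℤ)) = (q ^ i)⁻¹ * q⁻¹ := by
    rw [_root_.zpow_neg, e1, mul_inv]
  have e3 : q ^ ((d : ℤ) - ((i + 1 : ℕ) : ℤ)) = q ^ d * (q ^ i)⁻¹ * q⁻¹ := by
    rw [zpow_sub₀ hq, e1]; field_simp; norm_cast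
  have e4 : q ^ (((i + 1 : ℕ) : ℤ) - (d : ℤ)) = (q ^ d)⁻¹ * q ^ i * q := by
    rw [zpow_sub₀ hq, e1]; field_simp; norm_cast
  have e5 : q ^ ((d : ℤ) - (i : ℤ)) = q ^ d * (q ^ i)⁻¹ := by
    rw [zpow_sub₀ hq]; norm_cast
  have e6 : q ^ ((i : ℤ) - (d : ℤ)) = (q ^ d)⁻¹ * q ^ i := by
    rw [zpow_sub₀ hq, mul_comm]; norm_cast
  have e7 : weight q d i = q ^ d * q⁻¹ * (q ^ i)⁻¹ * (q ^ i)⁻¹ := by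
    unfold weight
    rw [zpow_sub₀ hq, zpow_sub₀ hq, two_mul, zpow_add₀ hq,
      zpow_natCast, zpow_natCast, zpow_one]
    field_simp
  have e8 : q ^ (i : ℤ) = q ^ i := by norm_cast
  have e9 : q ^ (-(i : ℤ)) = (q ^ i)⁻¹ := by rw [_root_.zpow_neg, e8]
  have hs' : (q - q⁻¹)⁻¹ = (q - q⁻¹) / (q - q⁻¹) ^ 2 := by field_simp
  unfold raise
  rw [e1, e2, e3, e4, e5, e6, e7, e8, e9, hs', div_mul_eq_mul_div, ← add_div]
  congr 1
  have ha : q ^ i ≠ 0 := pow_ne_zero _ hq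
  have hb : q ^ d ≠ 0 := pow_ne_zero _ hq
  generalize q ^ i = a at *
  generalize q ^ d = b at *
  field_simp
  ring

theorem zpow_sub_zpow_neg_ne_zero (hq : q ≠ 0) (i : ℕ) (h : q ^ (2 * i) ≠ 1) :
    q ^ (i : ℤ) - q ^ (-(i : ℤ)) ≠ 0 := by
  intro h0
  apply h
  rw [_root_.zpow_neg, zpow_natCast, sub_eq_zero] at h0
  rw [two_mul, pow_add]
  nth_rewrite 1 [h0]
  exact inv_mul_cancel₀ (pow_ne_zero _ hq)

/-- Both quantum integers [i] and [d - i] have index between 1 and d - 1, and [j] vanishes only when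
q^(2j) = 1. -/
theorem raise_ne_zero (hq : q ≠ 0) (h : ∀ j, 0 < j → j ≤ d → q ^ (2 * j) ≠ 1) (i : ℕ) (hi : 0 < i)
    (hid : i < d) : raise q d i ≠ 0 := by
  have hs := sub_inv_ne_zero hq (by simpa using h 1 Nat.one_pos (by omega))
  have h1 := zpow_sub_zpow_neg_ne_zero hq i (h i hi hid.le)
  have h2 := zpow_sub_zpow_neg_ne_zero hq (d - i) (h (d - i) (by omega) (by omega))
  rw [Nat.cast_sub hid.le, neg_sub] at h2
  exact div_ne_zero (mul_ne_zero h1 h2) (pow_ne_zero _ hs)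

theorem raise_zero : raise q d 0 = 0 := by simp [raise]

/-- Two weights differ by the factor q^(2(j-i)). The index d is admitted, one beyond the dimension,
so that F^d w can be compared with the earlier vectors when it is shown to vanish. -/
theorem weight_injective (hq : q ≠ 0) (h : ∀ j, 0 < j → j ≤ d → q ^ (2 * j) ≠ 1) {i j : ℕ}
    (hi : i ≤ d) (hj : j ≤ d) (hij : weight q d i = weight q d j) : i = j := by
  have key : ∀ i j : ℕ, i < j → j ≤ d → weight q d i ≠ weight q d j := by
    intro i j hlt hj he
    apply h (j - i) (by omega) (by omega)
    unfold weight at he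
    rw [show (d : ℤ) - 1 - 2 * (i : ℤ) = (d - 1 - 2 * j) + ((2 * (j - i) : ℕ) : ℤ) by
      push_cast [Nat.cast_sub hlt.le]; ring, zpow_add₀ hq, zpow_natCast] at he
    exact mul_left_cancel₀ (zpow_ne_zero _ hq) (he.trans (mul_one _).symm)
  rcases lt_trichotomy i j with h1 | h1 | h1
  · exact absurd hij (key i j h1 hj)
  · exact h1
  · exact absurd hij.symm (key j i h1 hi)

section HighestWeight

variable (ρ : UqRep q d)

theorem map_K_mul_Kinv : ρ (Uq.gen q .K) * ρ (Uq.gen q .Kinv) = 1 := by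
  rw [← map_mul, Uq.K_mul_Kinv, map_one]
theorem map_Kinv_mul_K : ρ (Uq.gen q .Kinv) * ρ (Uq.gen q .K) = 1 := by
  rw [← map_mul, Uq.Kinv_mul_K, map_one]
theorem map_F_mul_K : ρ (Uq.gen q .F) * ρ (Uq.gen q .K) =
    q ^ 2 • (ρ (Uq.gen q .K) * ρ (Uq.gen q .F)) := by
  rw [← map_mul, Uq.F_mul_K, map_smul, map_mul]
theorem map_Kinv_mul_F : ρ (Uq.gen q .Kinv) * ρ (Uq.gen q .F) =
    q ^ 2 • (ρ (Uq.gen q .F) * ρ (Uq.gen q .Kinv)) := by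
  rw [← map_mul, Uq.Kinv_mul_F, map_smul, map_mul]
theorem map_E_mul_F : ρ (Uq.gen q .E) * ρ (Uq.gen q .F) = ρ (Uq.gen q .F) * ρ (Uq.gen q .E) +
    (q - q⁻¹)⁻¹ • (ρ (Uq.gen q .K) - ρ (Uq.gen q .Kinv)) := by
  rw [← map_mul, ← map_sub, ← map_smul, ← Uq.E_mul_F, map_sub, map_mul, map_mul]; abel

variable {ρ} {w : Fin d → ℂ}

/-- The vectors `F^i w`. -/
noncomputable def orbit (ρ : UqRep q d) (w : Fin d → ℂ) (i : ℕ) : Fin d → ℂ :=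
  ρ (Uq.gen q .F) ^ i *ᵥ w

theorem F_orbit (i : ℕ) : ρ (Uq.gen q .F) *ᵥ orbit ρ w i = orbit ρ w (i + 1) := by
  rw [orbit, orbit, mulVec_mulVec, ← pow_succ']

theorem K_orbit (hq : q ≠ 0) (hd : 0 < d) (hK : ρ (Uq.gen q .K) *ᵥ w = q ^ (d - 1) • w) (i : ℕ) :
    ρ (Uq.gen q .K) *ᵥ orbit ρ w i = weight q d i • orbit ρ w i := by
  induction i with
  | zero =>
    have : weight q d 0 = q ^ (d - 1) := by
      unfold weight
      rw [← zpow_natCast]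
      congr 1
      push_cast [Nat.cast_sub (show 1 ≤ d from hd)]
      ring
    simpa [orbit, this] using hK
  | succ i ih =>
    have h := congrArg (fun M => (q ^ 2)⁻¹ • M *ᵥ orbit ρ w i) (map_F_mul_K ρ)
    simp only [smul_mulVec, ← mulVec_mulVec, ih, F_orbit, mulVec_smul, smul_smul] at h
    rw [inv_mul_cancel₀ (pow_ne_zero 2 hq), one_smul] at h
    rw [← h, weight_succ hq]

theorem Kinv_orbit (hq : q ≠ 0) (hd : 0 < d) (hK : ρ (Uq.gen q .K) *ᵥ w = q ^ (d - 1) • w) (i : ℕ) :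
    ρ (Uq.gen q .Kinv) *ᵥ orbit ρ w i = (weight q d i)⁻¹ • orbit ρ w i := by
  have h := congrArg (fun v => (weight q d i)⁻¹ • ρ (Uq.gen q .Kinv) *ᵥ v) (K_orbit hq hd hK i)
  simp only [mulVec_mulVec, map_Kinv_mul_K, one_mulVec, mulVec_smul, smul_smul] at h
  rw [inv_mul_cancel₀ (weight_ne_zero hq i), one_smul] at h
  exact h.symm

theorem E_orbit (hq : q ≠ 0) (hq2 : q ^ 2 ≠ 1) (hd : 0 < d) (hE : ρ (Uq.gen q .E) *ᵥ w = 0)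
    (hK : ρ (Uq.gen q .K) *ᵥ w = q ^ (d - 1) • w) (i : ℕ) :
    ρ (Uq.gen q .E) *ᵥ orbit ρ w (i + 1) = raise q d (i + 1) • orbit ρ w i := by
  -- The induction runs on FE F^i w instead of E F^i w, so that the case i = 0, where E w = 0, needs
  -- no vector of index -1.
  have key : ∀ i, ρ (Uq.gen q .F) *ᵥ (ρ (Uq.gen q .E) *ᵥ orbit ρ w i) = raise q d i • orbit ρ w i →
      ρ (Uq.gen q .E) *ᵥ orbit ρ w (i + 1) = raise q d (i + 1) • orbit ρ w i := by
    intro i hi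
    rw [← F_orbit, mulVec_mulVec, map_E_mul_F, add_mulVec, ← mulVec_mulVec, hi, smul_mulVec,
      sub_mulVec, K_orbit hq hd hK, Kinv_orbit hq hd hK, ← sub_smul, smul_smul, ← add_smul,
      raise_succ hq hq2]
  induction i with
  | zero => exact key 0 (by simp [orbit, hE, raise_zero])
  | succ i ih => exact key _ (by rw [ih, mulVec_smul, F_orbit])

/-- The matrices of the generators in the basis `F^i w`. -/
noncomputable def std (q : ℂ) (d : ℕ) : UqGen → Matrix (Fin d) (Fin d) ℂ
  | .E => Matrix.of fun i j => if (j : ℕ) = i + 1 then raise q d j else 0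
  | .F => Matrix.of fun i j => if (i : ℕ) = j + 1 then 1 else 0
  | .K => Matrix.diagonal fun i => weight q d i
  | .Kinv => Matrix.diagonal fun i => (weight q d i)⁻¹

theorem mul_eq_mul_std (hq : q ≠ 0) (hq2 : q ^ 2 ≠ 1) (hd : 0 < d)
    (hE : ρ (Uq.gen q .E) *ᵥ w = 0) (hK : ρ (Uq.gen q .K) *ᵥ w = q ^ (d - 1) • w)
    (hF : orbit ρ w d = 0) (x : UqGen) :
    ρ (Uq.gen q x) * (Matrix.of fun i (j : Fin d) => orbit ρ w j i) =
      (Matrix.of fun i (j : Fin d) => orbit ρ w j i) * std q d x := by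
  have hl : ∀ (X : Matrix (Fin d) (Fin d) ℂ) i j,
      (X * (Matrix.of fun i (j : Fin d) => orbit ρ w j i)) i j = (X *ᵥ orbit ρ w j) i :=
    fun X i j => rfl
  ext i j
  rw [hl]
  cases x
  · simp only [std, Matrix.mul_apply, Matrix.of_apply, mul_ite, mul_zero]
    rcases hj : (j : ℕ) with _ | k
    · rw [Finset.sum_eq_zero fun x _ => by simp]
      simp [orbit, hE]
    · rw [E_orbit hq hq2 hd hE hK, Finset.sum_eq_single (⟨k, by omega⟩ : Fin d)]
      · simp [mul_comm]
      · intro b _ hb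
        rw [if_neg]
        intro h
        exact hb (Fin.ext (by simp; omega))
      · simp
  · simp only [std, Matrix.mul_apply, Matrix.of_apply, mul_ite, mul_zero, mul_one]
    rw [F_orbit]
    by_cases hj : (j : ℕ) + 1 < d
    · rw [Finset.sum_eq_single (⟨j + 1, hj⟩ : Fin d)]
      · simp
      · intro b _ hb
        rw [if_neg]
        intro h
        exact hb (Fin.ext h)
      · simp
    · have : (j : ℕ) + 1 = d := by omega
      rw [this, hF, Finset.sum_eq_zero]
      · rfl
      · intro x _
        rw [if_neg]
        omega
  · rw [K_orbit hq hd hK]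
    simp [std, mul_comm]
  · rw [Kinv_orbit hq hd hK]
    simp [std, mul_comm]

theorem orbit_ne_zero (hq : q ≠ 0) (h : ∀ j, 0 < j → j ≤ d → q ^ (2 * j) ≠ 1) (hd : 0 < d)
    (hw : w ≠ 0) (hE : ρ (Uq.gen q .E) *ᵥ w = 0)
    (hK : ρ (Uq.gen q .K) *ᵥ w = q ^ (d - 1) • w) (i : ℕ) (hi : i < d) : orbit ρ w i ≠ 0 := by
  induction i with
  | zero => simpa [orbit] using hw
  | succ i ih =>
    intro h0
    have hE' := E_orbit hq (by simpa using h 1 Nat.one_pos (by omega)) hd hE hK i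
    rw [h0, mulVec_zero] at hE'
    exact smul_ne_zero (raise_ne_zero hq h (i + 1) (by omega) hi) (ih (by omega)) hE'.symm

/-- Nonzero F^i w are eigenvectors of K for distinct eigenvalues. -/
theorem linearIndependent_orbit (hq : q ≠ 0) (h : ∀ j, 0 < j → j ≤ d → q ^ (2 * j) ≠ 1)
    (hd : 0 < d) (hK : ρ (Uq.gen q .K) *ᵥ w = q ^ (d - 1) • w) (n : ℕ) (hn : n ≤ d + 1)
    (h0 : ∀ i < n, orbit ρ w i ≠ 0) : LinearIndependent ℂ fun i : Fin n => orbit ρ w i := by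
  refine Module.End.eigenvectors_linearIndependent' (ρ (Uq.gen q .K)).mulVecLin
    (fun i : Fin n => weight q d i) ?_ _ fun i => ?_
  · intro i j hij
    exact Fin.ext (weight_injective hq h (by omega) (by omega) hij)
  · rw [Module.End.hasEigenvector_iff, Module.End.mem_eigenspace_iff]
    exact ⟨K_orbit hq hd hK i, h0 i i.2⟩

/-- The standard form of a representation with a highest weight vector of weight `q^(d-1)`. -/
theorem exists_std (hq : q ≠ 0) (h : ∀ j, 0 < j → j ≤ d → q ^ (2 * j) ≠ 1) (hd : 0 < d)
    (hρ : ρ.IsTypeOne) :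
    ∃ T T' : Matrix (Fin d) (Fin d) ℂ, T * T' = 1 ∧ T' * T = 1 ∧
      ∀ x, ρ (Uq.gen q x) * T = T * std q d x := by
  obtain ⟨w, hw, hE, hK⟩ := hρ
  have h0 := orbit_ne_zero hq h hd hw hE hK
  -- Otherwise the d + 1 vectors w, …, F^d w would be independent in a space of dimension d.
  have hF : orbit ρ w d = 0 := by
    by_contra hne
    have := (linearIndependent_orbit hq h hd hK (d + 1) le_rfl fun i hi => by
      rcases Nat.lt_succ_iff_lt_or_eq.mp hi with h1 | h1
      · exact h0 i h1
      · rwa [h1]).fintype_card_le_finrank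
    simp at this
  have hli := linearIndependent_orbit hq h hd hK d (Nat.le_succ d) h0
  have hu : IsUnit (Matrix.of fun i (j : Fin d) => orbit ρ w j i) :=
    Matrix.linearIndependent_cols_iff_isUnit.mp hli
  rw [Matrix.isUnit_iff_isUnit_det] at hu
  exact ⟨_, _, Matrix.mul_nonsing_inv _ hu, Matrix.nonsing_inv_mul _ hu,
    mul_eq_mul_std hq (by simpa using h 1 Nat.one_pos hd) hd hE hK hF⟩

end HighestWeight

end UqRep

/-! ### The quantum dimension and the order of q². -/

namespace UqRep

variable {q : ℂ} {d : ℕ}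

/-- Vectors of a tensor product are read as matrices, X ⊗ Y acting by M ↦ X M Yᵀ. Invariance of a
vector in α ⊗ ᾱ then becomes a commutation relation. -/
theorem kronecker_mul_apply {m n o : Type*} [Fintype m] [Fintype n] (X : Matrix m m ℂ)
    (Y : Matrix n n ℂ) (Φ : Matrix (m × n) o ℂ) (i : m) (j : n) (u : o) :
    (X ⊗ₖ Y * Φ) (i, j) u = (X * (Matrix.of fun a b => Φ (a, b) u) * Yᵀ) i j := by
  simp only [Matrix.mul_apply, Fintype.sum_prod_type, kroneckerMap_apply, Matrix.transpose_apply,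
    Matrix.of_apply, Finset.sum_mul]
  rw [Finset.sum_comm]
  exact Finset.sum_congr rfl fun _ _ => Finset.sum_congr rfl fun _ _ => by ring

theorem mul_kronecker_apply {m n o : Type*} [Fintype m] [Fintype n] (X : Matrix m m ℂ)
    (Y : Matrix n n ℂ) (Ψ : Matrix o (m × n) ℂ) (i : m) (j : n) (u : o) :
    (Ψ * X ⊗ₖ Y) u (i, j) = (Xᵀ * (Matrix.of fun a b => Ψ u (a, b)) * Y) i j := by
  simp only [Matrix.mul_apply, Fintype.sum_prod_type, kroneckerMap_apply, Matrix.transpose_apply,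
    Matrix.of_apply, Finset.sum_mul]
  rw [Finset.sum_comm]
  exact Finset.sum_congr rfl fun _ _ => Finset.sum_congr rfl fun _ _ => by ring

/-- The quantum dimension `tr ρ(K)` of a physical representation does not vanish. -/
theorem IsPhysical.trace_K_ne_zero {ρ : UqRep q d} (h : ρ.IsPhysical) :
    (ρ (Uq.gen q .K)).trace ≠ 0 := by
  obtain ⟨hirr, -, Φ, Ψ, hΦ, hΨ, hne⟩ := h
  set M : Matrix (Fin d) (Fin d) ℂ := Matrix.of fun a b => Φ (a, b) () with hM
  set N : Matrix (Fin d) (Fin d) ℂ := Matrix.of fun a b => Ψ () (a, b) with hN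
  set e := ρ (Uq.gen q .E)
  set f := ρ (Uq.gen q .F)
  set k := ρ (Uq.gen q .K) with hk
  set k' := ρ (Uq.gen q .Kinv) with hk'
  have hkk' : k * k' = 1 := map_K_mul_Kinv ρ
  have hk'k : k' * k = 1 := map_Kinv_mul_K ρ
  have d1 : ρ.dualLin 1 = 1 := map_one ρ.dualHom
  have dE : ρ.dualLin (Uq.gen q .E) = (-(e * k'))ᵀ := by
    change (ρ _)ᵀ = _; rw [Uq.antipode_E, map_neg, map_mul]
  have dF : ρ.dualLin (Uq.gen q .F) = (-(k * f))ᵀ := by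
    change (ρ _)ᵀ = _; rw [Uq.antipode_F, map_neg, map_mul]
  have dK : ρ.dualLin (Uq.gen q .K) = k'ᵀ := by
    change (ρ _)ᵀ = _; rw [Uq.antipode_K]
  have l1 : ρ.toLinearMap 1 = 1 := map_one ρ
  have hMK : k * M * k' = M := by
    ext i j
    have := congrFun (congrFun (hΦ (Uq.gen q .K)) (i, j)) ()
    dsimp only at this
    rw [Uq.counit_K, one_smul, Matrix.mul_one, tensorRep_K, kronecker_mul_apply, dK,
      transpose_transpose] at this
    exact this.symm
  have hME : e * M * k' + M * (-(e * k')) = 0 := by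
    ext i j
    have := congrFun (congrFun (hΦ (Uq.gen q .E)) (i, j)) ()
    dsimp only at this
    rw [Uq.counit_E, zero_smul, Matrix.mul_zero, tensorRep_E, Matrix.add_mul, Matrix.add_apply,
      kronecker_mul_apply, kronecker_mul_apply, dK, dE, transpose_transpose, transpose_transpose,
      l1, Matrix.one_mul] at this
    exact this.symm
  have hMF : f * M + k' * M * (-(k * f)) = 0 := by
    ext i j
    have := congrFun (congrFun (hΦ (Uq.gen q .F)) (i, j)) ()
    dsimp only at this
    rw [Uq.counit_F, zero_smul, Matrix.mul_zero, tensorRep_F, Matrix.add_mul, Matrix.add_apply,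
      kronecker_mul_apply, kronecker_mul_apply, d1, dF, transpose_transpose, transpose_one,
      Matrix.mul_one] at this
    exact this.symm
  have hNK : kᵀ * N * k'ᵀ = N := by
    ext i j
    have := congrFun (congrFun (hΨ (Uq.gen q .K)) ()) (i, j)
    dsimp only at this
    rw [Uq.counit_K, one_smul, Matrix.one_mul, tensorRep_K, mul_kronecker_apply, dK] at this
    exact this
  have hNE : eᵀ * N * k'ᵀ + N * (-(e * k'))ᵀ = 0 := by
    ext i j
    have := congrFun (congrFun (hΨ (Uq.gen q .E)) ()) (i, j)
    dsimp only at this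
    rw [Uq.counit_E, zero_smul, Matrix.zero_mul, tensorRep_E, Matrix.mul_add, Matrix.add_apply,
      mul_kronecker_apply, mul_kronecker_apply, dK, dE, l1, transpose_one, Matrix.one_mul] at this
    exact this
  have hNF : fᵀ * N + k'ᵀ * N * (-(k * f))ᵀ = 0 := by
    ext i j
    have := congrFun (congrFun (hΨ (Uq.gen q .F)) ()) (i, j)
    dsimp only at this
    rw [Uq.counit_F, zero_smul, Matrix.zero_mul, tensorRep_F, Matrix.mul_add, Matrix.add_apply,
      mul_kronecker_apply, mul_kronecker_apply, dF, d1, Matrix.mul_one] at this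
    exact this
  have comm_k' : ∀ X : Matrix (Fin d) (Fin d) ℂ, X * k = k * X → X * k' = k' * X := by
    intro X hX
    calc X * k' = k' * (k * X) * k' := by rw [← Matrix.mul_assoc, hk'k, Matrix.one_mul]
      _ = k' * X := by rw [← hX, Matrix.mul_assoc, Matrix.mul_assoc, hkk', Matrix.mul_one]
  have cMK : M * k = k * M := by
    conv_lhs => rw [← hMK]
    rw [Matrix.mul_assoc, hk'k, Matrix.mul_one]
  have cMk' := comm_k' M cMK
  -- As the second factor of Φ carries the antipode, invariance means that M commutes with every
  -- generator; Schur's lemma makes it a scalar.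
  obtain ⟨c, hc⟩ := hirr.eq_smul_one M (fun
    | .E => by
      have := congrArg (· * k) hME
      simp only [Matrix.add_mul, Matrix.mul_neg, Matrix.neg_mul, Matrix.mul_assoc, hk'k,
        Matrix.mul_one, Matrix.zero_mul] at this
      exact (eq_neg_of_add_eq_zero_left this |>.trans (neg_neg _)).symm
    | .F => by
      rw [← cMk', Matrix.mul_neg, Matrix.mul_assoc M, ← Matrix.mul_assoc k', hk'k,
        Matrix.one_mul] at hMF
      exact (eq_neg_of_add_eq_zero_left hMF |>.trans (neg_neg _)).symm
    | .K => cMK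
    | .Kinv => cMk')
  have tNK : k' * Nᵀ * k = Nᵀ := by
    conv_rhs => rw [← hNK]
    simp [Matrix.mul_assoc]
  have tNE : k' * Nᵀ * e - e * k' * Nᵀ = 0 := by
    have := congrArg Matrix.transpose hNE
    simpa [Matrix.mul_assoc, ← sub_eq_add_neg] using this
  have tNF : Nᵀ * f - k * f * Nᵀ * k' = 0 := by
    have := congrArg Matrix.transpose hNF
    simpa [Matrix.mul_assoc, ← sub_eq_add_neg] using this
  have cNK : Nᵀ * k = k * Nᵀ := by
    conv_rhs => rw [← tNK]
    rw [← Matrix.mul_assoc, ← Matrix.mul_assoc, hkk', Matrix.one_mul]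
  have cNk' := comm_k' Nᵀ cNK
  -- A form on α ⊗ ᾱ, in this order, commutes only up to the square of the antipode, which is
  -- conjugation by K. The factor K⁻¹ compensates for it.
  obtain ⟨c', hc'⟩ := hirr.eq_smul_one (k' * Nᵀ) (fun
    | .E => by rw [sub_eq_zero.mp tNE, Matrix.mul_assoc]
    | .F => by
      rw [Matrix.mul_assoc, sub_eq_zero.mp tNF, Matrix.mul_assoc k, Matrix.mul_assoc k,
        ← Matrix.mul_assoc k', hk'k, Matrix.one_mul, Matrix.mul_assoc f, cNk']
    | .K => by rw [Matrix.mul_assoc, cNK, ← Matrix.mul_assoc, hk'k, ← Matrix.mul_assoc, hkk']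
    | .Kinv => by rw [Matrix.mul_assoc, cNk'])
  have hN' : Nᵀ = c' • k := by
    have := congrArg (k * ·) hc'
    simpa [← Matrix.mul_assoc, hkk'] using this
  intro h0
  apply hne
  ext u v
  -- With M = c and Nᵀ = c' K, the composite ΨΦ is c c' tr K.
  have : (Ψ * Φ) u v = (Nᵀ * M).trace := by
    simp only [Matrix.mul_apply, Fintype.sum_prod_type, Matrix.trace, Matrix.diag, hM, hN,
      Matrix.transpose_apply, Matrix.of_apply]
    rw [Finset.sum_comm]
  rw [this, hc, hN']
  simp [h0]

theorem geom_sum_eq_zero {x : ℂ} {n : ℕ} (h : x ^ n = 1) (h1 : x ≠ 1) :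
    ∑ i ∈ Finset.range n, x ^ i = 0 := by
  have := geom_sum_mul x n
  rw [h, sub_self] at this
  exact (mul_eq_zero.mp this).resolve_right (sub_ne_zero.mpr h1)

/-- `[E, F^n] = F^(n-1) ([n]-type combination of K and K⁻¹)`. -/
theorem map_E_mul_F_pow (hq : q ≠ 0) (ρ : UqRep q d) (n : ℕ) :
    ρ (Uq.gen q .E) * ρ (Uq.gen q .F) ^ (n + 1) =
      ρ (Uq.gen q .F) ^ (n + 1) * ρ (Uq.gen q .E) + (q - q⁻¹)⁻¹ • (ρ (Uq.gen q .F) ^ n *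
        ((∑ i ∈ Finset.range (n + 1), ((q ^ 2)⁻¹) ^ i) • ρ (Uq.gen q .K) -
          (∑ i ∈ Finset.range (n + 1), (q ^ 2) ^ i) • ρ (Uq.gen q .Kinv))) := by
  have hKF : ρ (Uq.gen q .K) * ρ (Uq.gen q .F) =
      (q ^ 2)⁻¹ • (ρ (Uq.gen q .F) * ρ (Uq.gen q .K)) := by
    rw [map_F_mul_K, smul_smul, inv_mul_cancel₀ (pow_ne_zero 2 hq), one_smul]
  induction n with
  | zero => simp [map_E_mul_F]
  | succ n ih =>
    rw [pow_succ _ (n + 1), ← Matrix.mul_assoc, ih, Matrix.add_mul, Matrix.mul_assoc, map_E_mul_F,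
      Matrix.mul_add, add_assoc, ← Matrix.mul_assoc, Matrix.mul_smul, Matrix.smul_mul, ← smul_add]
    congr 2
    rw [Matrix.mul_assoc, Matrix.sub_mul, Matrix.smul_mul, Matrix.smul_mul, hKF, map_Kinv_mul_F,
      geom_sum_succ (n := n + 1), geom_sum_succ (n := n + 1), pow_succ, Matrix.mul_assoc,
      Matrix.mul_assoc, ← Matrix.mul_add]
    congr 1
    simp only [Matrix.mul_sub, Matrix.mul_add, Matrix.mul_smul, smul_smul, add_smul, one_smul]
    rw [mul_comm (q ^ 2)⁻¹, mul_comm (q ^ 2)]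
    abel

/-- For a physical representation of dimension `d`, the order of `q²` exceeds `d`. -/
theorem IsPhysical.pow_ne_one (hq : q ≠ 0) (hq2 : q ^ 2 ≠ 1) {ρ : UqRep q d} (h : ρ.IsPhysical) :
    ∀ j, 0 < j → j ≤ d → q ^ (2 * j) ≠ 1 := by
  classical
  intro j0 hj0 hjd0 h0
  have hex : ∃ j, 0 < j ∧ j ≤ d ∧ q ^ (2 * j) = 1 := ⟨j0, hj0, hjd0, h0⟩
  obtain ⟨hj, hjd, hj1⟩ := Nat.find_spec hex
  set l := Nat.find hex
  have hd : 0 < d := hj.trans_le hjd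
  obtain ⟨hirr, ⟨w, hw, hE, hK⟩, -⟩ := id h
  have hpow : (q ^ 2) ^ l = 1 := by rw [← pow_mul, hj1]
  -- F^l commutes with K because q^(2l) = 1, and with E because the two geometric sums of length l
  -- in the commutator formula vanish. So F^l acts as a scalar.
  have hc : ∀ x, ρ (Uq.gen q .F) ^ l * ρ (Uq.gen q x) = ρ (Uq.gen q x) * ρ (Uq.gen q .F) ^ l := by
    have hFK : ∀ n, ρ (Uq.gen q .F) ^ n * ρ (Uq.gen q .K) =
        (q ^ 2) ^ n • (ρ (Uq.gen q .K) * ρ (Uq.gen q .F) ^ n) := by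
      intro n
      induction n with
      | zero => simp
      | succ n ih =>
        rw [pow_succ, Matrix.mul_assoc, map_F_mul_K, Matrix.mul_smul, ← Matrix.mul_assoc, ih,
          Matrix.smul_mul, smul_smul, ← _root_.pow_succ', Matrix.mul_assoc]
    have hcK := hFK l
    rw [hpow, one_smul] at hcK
    rintro (_ | _ | _ | _)
    · obtain ⟨n, hn⟩ : ∃ n, l = n + 1 := ⟨l - 1, by omega⟩
      rw [hn, map_E_mul_F_pow hq, ← hn, geom_sum_eq_zero hpow hq2,
        geom_sum_eq_zero (by rw [inv_pow, hpow, inv_one]) (by simpa using hq2)]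
      simp
    · rw [← pow_succ, ← pow_succ']
    · exact hcK
    · have := congrArg (fun X => ρ (Uq.gen q .Kinv) * X * ρ (Uq.gen q .Kinv)) hcK
      simp only [Matrix.mul_assoc, map_K_mul_Kinv, Matrix.mul_one] at this
      rw [← Matrix.mul_assoc (ρ (Uq.gen q .Kinv)) (ρ (Uq.gen q .K)), map_Kinv_mul_K,
        Matrix.one_mul] at this
      exact this.symm
  obtain ⟨c, hFl⟩ := hirr.eq_smul_one _ hc
  have hol : orbit ρ w l = c • w := by rw [orbit, hFl, smul_mulVec, one_mulVec]
  -- Since F^l w is a multiple of w, the first l vectors of the orbit already span an invariant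
  -- subspace. Irreducibility makes it everything, whence l = d.
  set W := Submodule.span ℂ (Set.range fun i : Fin l => orbit ρ w i)
  have hmem : ∀ i, i < l → orbit ρ w i ∈ W := fun i hi => Submodule.subset_span ⟨⟨i, hi⟩, rfl⟩
  have hw0 : orbit ρ w 0 = w := by simp [orbit]
  have hgen : ∀ x, ∀ v ∈ W, ρ (Uq.gen q x) *ᵥ v ∈ W := by
    intro x v hv
    induction hv using Submodule.span_induction with
    | mem v hv =>
      obtain ⟨i, rfl⟩ := hv
      cases x
      · rcases hi : (i : ℕ) with _ | k
        · simp only [hi, hw0, hE]; exact W.zero_mem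
        · simp only [hi, E_orbit hq hq2 hd hE hK]
          exact W.smul_mem _ (hmem k (by omega))
      · simp only [F_orbit]
        by_cases h1 : (i : ℕ) + 1 < l
        · exact hmem _ h1
        · rw [show (i : ℕ) + 1 = l by omega, hol]
          exact W.smul_mem _ (hw0 ▸ hmem 0 hj)
      · simp only [K_orbit hq hd hK]
        exact W.smul_mem _ (hmem _ i.2)
      · simp only [Kinv_orbit hq hd hK]
        exact W.smul_mem _ (hmem _ i.2)
    | zero => rw [mulVec_zero]; exact W.zero_mem
    | add a b _ _ ha hb => rw [mulVec_add]; exact W.add_mem ha hb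
    | smul c a _ ha => rw [mulVec_smul]; exact W.smul_mem _ ha
  have htop : W = ⊤ := (hirr.2 W (ρ.invariant_of_gen W hgen)).resolve_left fun hbot => by
    have := hmem 0 hj
    rw [hbot, hw0] at this
    exact hw (by simpa using this)
  have hld : l = d := by
    refine le_antisymm hjd ?_
    have := finrank_range_le_card (R := ℂ) (fun i : Fin l => orbit ρ w i)
    rw [Set.finrank] at this
    change Module.finrank ℂ W ≤ _ at this
    rw [htop, finrank_top] at this
    simpa using this
  clear_value l
  obtain rfl := hld.symm
  have hli : LinearIndependent ℂ fun i : Fin d => orbit ρ w i := by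
    exact linearIndependent_of_top_le_span_of_card_eq_finrank htop.ge (by simp)
  set Tm : Matrix (Fin d) (Fin d) ℂ := Matrix.of fun i j => orbit ρ w j i with hT
  have hu : IsUnit Tm := Matrix.linearIndependent_cols_iff_isUnit.mp hli
  rw [Matrix.isUnit_iff_isUnit_det] at hu
  have hKT : ρ (Uq.gen q .K) * Tm = Tm * Matrix.diagonal fun i : Fin d => weight q d i := by
    ext i j
    change (ρ (Uq.gen q .K) *ᵥ orbit ρ w j) i = _
    rw [K_orbit hq hd hK]
    simp [hT, mul_comm]
  -- For d = l the orbit is a basis of weight vectors, and tr K is a geometric sum of length l in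
  -- q⁻², hence zero: the quantum dimension would vanish.
  apply h.trace_K_ne_zero
  calc (ρ (Uq.gen q .K)).trace = (ρ (Uq.gen q .K) * Tm * Tm⁻¹).trace := by
        rw [Matrix.mul_assoc, Matrix.mul_nonsing_inv _ hu, Matrix.mul_one]
    _ = ∑ i : Fin d, weight q d i := by
        rw [hKT, Matrix.trace_mul_comm, ← Matrix.mul_assoc, Matrix.nonsing_inv_mul _ hu,
          Matrix.one_mul, Matrix.trace_diagonal]
    _ = ∑ i ∈ Finset.range d, weight q d 0 * ((q ^ 2)⁻¹) ^ i := by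
        rw [Finset.sum_range]
        refine Finset.sum_congr rfl fun i _ => ?_
        generalize (i : ℕ) = k
        induction k with
        | zero => simp
        | succ k ih => rw [weight_succ hq, ih, pow_succ]; ring
    _ = 0 := by
        rw [← Finset.mul_sum, geom_sum_eq_zero (by rw [inv_pow, hpow, inv_one])
          (by simpa using hq2), mul_zero]

/-- The contragredient of a representation in standard form is of type one. -/
theorem dualHom_isTypeOne (hd : 0 < d) {ρ : UqRep q d} {T T' : Matrix (Fin d) (Fin d) ℂ}
    (hT : T * T' = 1) (hT' : T' * T = 1)
    (h : ∀ x, ρ (Uq.gen q x) * T = T * std q d x) : ρ.dualHom.IsTypeOne := by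
  have h' : ∀ x, T' * ρ (Uq.gen q x) = std q d x * T' := fun x => by
    calc T' * ρ (Uq.gen q x) = T' * (ρ (Uq.gen q x) * T) * T' := by
          rw [Matrix.mul_assoc, Matrix.mul_assoc, hT, Matrix.mul_one]
      _ = _ := by rw [h, ← Matrix.mul_assoc, hT', Matrix.one_mul]
  -- The coordinate of the lowest weight vector F^(d-1) w is the highest weight vector of the
  -- contragredient: the antipode inverts K and so turns the weight q^(1-d) into q^(d-1).
  set z : Fin d := ⟨d - 1, by omega⟩ with hz
  refine ⟨Pi.single z 1 ᵥ* T', ?_, ?_, ?_⟩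
  · intro h0
    have := congrArg (· ᵥ* T) h0
    simp only [vecMul_vecMul, hT', vecMul_one, zero_vecMul] at this
    simpa using congrFun this z
  · rw [dualHom_apply, Uq.antipode_E, map_neg, map_mul, mulVec_transpose, vecMul_neg,
      vecMul_vecMul, ← Matrix.mul_assoc, h', ← vecMul_vecMul, ← vecMul_vecMul]
    have : Pi.single z 1 ᵥ* std q d .E = 0 := by
      ext j
      simp only [single_one_vecMul, std, Matrix.row_apply, Matrix.of_apply, Pi.zero_apply, hz]
      rw [if_neg]
      omega
    rw [this]
    simp
  · rw [dualHom_apply, Uq.antipode_K, mulVec_transpose, vecMul_vecMul, h', ← vecMul_vecMul]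
    have : Pi.single z 1 ᵥ* std q d .Kinv = (q ^ (d - 1)) • Pi.single z (1 : ℂ) := by
      have hz' : (weight q d z)⁻¹ = q ^ (d - 1) := by
        unfold weight
        rw [← _root_.zpow_neg, ← zpow_natCast]
        congr 1
        push_cast [hz, Nat.cast_sub (show 1 ≤ d from hd)]
        ring
      ext j
      simp only [single_one_vecMul, std, Matrix.row_apply, Pi.smul_apply, smul_eq_mul]
      by_cases hj : z = j
      · subst hj
        simp [hz']
      · simp [Matrix.diagonal_apply_ne _ hj, Ne.symm hj]
    rw [this, smul_vecMul]

end UqRep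

/-! ### Intertwiners with tensor products, in standard bases. -/

namespace UqRep

variable {q : ℂ} {d m n : ℕ}

theorem std_E_mul {o : Type*} (A : Matrix (Fin m) o ℂ) (i : Fin m) (j : o) :
    (std q m .E * A) i j = if h : (i : ℕ) + 1 < m then raise q m (i + 1) * A ⟨i + 1, h⟩ j else 0 := by
  rw [Matrix.mul_apply]
  split_ifs with h
  · rw [Finset.sum_eq_single (⟨i + 1, h⟩ : Fin m)]
    · simp [std]
    · intro b _ hb
      rw [std, Matrix.of_apply, if_neg fun h' => hb (Fin.ext h'), zero_mul]
    · simp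
  · refine Finset.sum_eq_zero fun b _ => ?_
    rw [std, Matrix.of_apply, if_neg (by omega), zero_mul]

theorem mul_std_F {o : Type*} (A : Matrix o (Fin n) ℂ) (i : o) (j : Fin n) :
    (A * std q n .F) i j = if h : (j : ℕ) + 1 < n then A i ⟨j + 1, h⟩ else 0 := by
  rw [Matrix.mul_apply]
  split_ifs with h
  · rw [Finset.sum_eq_single (⟨j + 1, h⟩ : Fin n)]
    · simp [std]
    · intro b _ hb
      rw [std, Matrix.of_apply, if_neg fun h' => hb (Fin.ext h'), mul_zero]
    · simp
  · refine Finset.sum_eq_zero fun b _ => ?_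
    rw [std, Matrix.of_apply, if_neg (by omega), mul_zero]

theorem mul_std_E_transpose {o : Type*} (A : Matrix o (Fin n) ℂ) (i : o) (j : Fin n) :
    (A * (std q n .E)ᵀ) i j =
      if h : (j : ℕ) + 1 < n then raise q n (j + 1) * A i ⟨j + 1, h⟩ else 0 := by
  rw [← Matrix.transpose_transpose A, ← Matrix.transpose_mul, Matrix.transpose_apply, std_E_mul]
  rfl

theorem std_F_transpose_mul {o : Type*} (A : Matrix (Fin m) o ℂ) (i : Fin m) (j : o) :
    ((std q m .F)ᵀ * A) i j = if h : (i : ℕ) + 1 < m then A ⟨i + 1, h⟩ j else 0 := by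
  rw [← Matrix.transpose_transpose A, ← Matrix.transpose_mul, Matrix.transpose_apply, mul_std_F]
  rfl

theorem mul_std_E_zero {o : Type*} (A : Matrix o (Fin d) ℂ) (i : o) (hd : 0 < d) :
    (A * std q d .E) i ⟨0, hd⟩ = 0 := by
  rw [Matrix.mul_apply]
  exact Finset.sum_eq_zero fun b _ => by simp [std]

theorem std_F_mul_zero {o : Type*} (A : Matrix (Fin d) o ℂ) (i : o) (hd : 0 < d) :
    (std q d .F * A) ⟨0, hd⟩ i = 0 := by
  rw [Matrix.mul_apply]
  exact Finset.sum_eq_zero fun b _ => by simp [std]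

/-- An intertwiner into a tensor product is determined by the components along `F^0 w ⊗ F^j w'`
of the image of the highest weight vector. -/
theorem eq_zero_of_hom (hq : q ≠ 0) (hm : ∀ j, 0 < j → j ≤ m → q ^ (2 * j) ≠ 1) (hm0 : 0 < m)
    (hd : 0 < d) (Z : Matrix (Fin m × Fin n) (Fin d) ℂ)
    (hE : Z * std q d .E = (std q m .E ⊗ₖ std q n .K + 1 ⊗ₖ std q n .E) * Z)
    (hF : Z * std q d .F = (std q m .F ⊗ₖ 1 + std q m .Kinv ⊗ₖ std q n .F) * Z)
    (h0 : ∀ j, Z (⟨0, hm0⟩, j) ⟨0, hd⟩ = 0) : Z = 0 := by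
  -- The image of the highest weight vector is killed by ΔE. In its component along F^k w ⊗ F^j w',
  -- the coefficient of F^(k+1) w ⊗ F^j w' appears with a nonzero factor, next to a coefficient
  -- already known to vanish.
  have col0 : ∀ k (hk : k < m) j, Z (⟨k, hk⟩, j) ⟨0, hd⟩ = 0 := by
    intro k
    induction k with
    | zero => exact fun _ => h0
    | succ k ih =>
      intro hk j
      have h := congrFun (congrFun hE (⟨k, by omega⟩, j)) ⟨0, hd⟩
      rw [mul_std_E_zero, Matrix.add_mul, Matrix.add_apply, kronecker_mul_apply,
        kronecker_mul_apply, Matrix.one_mul, mul_std_E_transpose] at h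
      have h2 : (if h : (j : ℕ) + 1 < n then raise q n (j + 1) *
          (Matrix.of fun a b => Z (a, b) (⟨0, hd⟩ : Fin d)) ⟨k, by omega⟩ ⟨j + 1, h⟩ else 0) = 0 := by
        split_ifs with h3
        · rw [Matrix.of_apply, ih, mul_zero]
        · rfl
      have hKt : (std q n .K)ᵀ = Matrix.diagonal fun i : Fin n => weight q n i :=
        Matrix.diagonal_transpose _
      rw [h2, add_zero, hKt, Matrix.mul_diagonal, std_E_mul,
        dif_pos (by simpa using hk), Matrix.of_apply] at h
      have h4 := (mul_eq_zero.mp h.symm).resolve_right (weight_ne_zero hq j)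
      exact (mul_eq_zero.mp h4).resolve_left (raise_ne_zero hq hm (k + 1) (by omega) hk)
  -- The remaining columns are obtained from the first by applying ΔF.
  have cols : ∀ k (hk : k < d) p, Z p ⟨k, hk⟩ = 0 := by
    intro k
    induction k with
    | zero => rintro hk ⟨i, j⟩; exact col0 i i.2 j
    | succ k ih =>
      intro hk p
      have h := congrFun (congrFun hF p) ⟨k, by omega⟩
      rw [mul_std_F, dif_pos (by simpa using hk), Matrix.mul_apply, Finset.sum_eq_zero] at h
      · exact h
      · intro r _
        rw [ih, mul_zero]
  ext p k
  exact cols k k.2 p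

/-- An intertwiner from a tensor product is determined by the components along `F^0 w ⊗ F^j w'`
of the coefficient of the highest weight vector. -/
theorem eq_zero_of_cohom (hq : q ≠ 0) (hd : ∀ j, 0 < j → j ≤ d → q ^ (2 * j) ≠ 1) (hm0 : 0 < m)
    (hd0 : 0 < d) (Z : Matrix (Fin d) (Fin m × Fin n) ℂ)
    (hE : std q d .E * Z = Z * (std q m .E ⊗ₖ std q n .K + 1 ⊗ₖ std q n .E))
    (hF : std q d .F * Z = Z * (std q m .F ⊗ₖ 1 + std q m .Kinv ⊗ₖ std q n .F))
    (h0 : ∀ j, Z ⟨0, hd0⟩ (⟨0, hm0⟩, j) = 0) : Z = 0 := by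
  -- F and E exchange roles here: F never reaches the highest weight vector, so the top row vanishes
  -- on the image of ΔF, and E carries this to the lower rows.
  have row0 : ∀ k (hk : k < m) j, Z ⟨0, hd0⟩ (⟨k, hk⟩, j) = 0 := by
    intro k
    induction k with
    | zero => exact fun _ => h0
    | succ k ih =>
      intro hk j
      have h := congrFun (congrFun hF ⟨0, hd0⟩) (⟨k, by omega⟩, j)
      rw [std_F_mul_zero, Matrix.mul_add, Matrix.add_apply, mul_kronecker_apply,
        mul_kronecker_apply, Matrix.mul_one, std_F_transpose_mul, dif_pos (by simpa using hk),
        mul_std_F, Matrix.of_apply] at h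
      have h2 : (if h : (j : ℕ) + 1 < n then ((std q m .Kinv)ᵀ *
          (Matrix.of fun a b => Z (⟨0, hd0⟩ : Fin d) (a, b))) ⟨k, by omega⟩ ⟨j + 1, h⟩ else 0) = 0 := by
        split_ifs with h3
        · rw [std, Matrix.diagonal_transpose, Matrix.diagonal_mul, Matrix.of_apply, ih, mul_zero]
        · rfl
      rw [h2, add_zero] at h
      exact h.symm
  have rows : ∀ k (hk : k < d) p, Z ⟨k, hk⟩ p = 0 := by
    intro k
    induction k with
    | zero => rintro hk ⟨i, j⟩; exact row0 i i.2 j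
    | succ k ih =>
      intro hk p
      have h := congrFun (congrFun hE ⟨k, by omega⟩) p
      rw [std_E_mul, dif_pos (by simpa using hk), Matrix.mul_apply, Finset.sum_eq_zero] at h
      · exact (mul_eq_zero.mp h).resolve_left (raise_ne_zero hq hd (k + 1) (by omega) hk)
      · intro r _
        rw [ih, zero_mul]
  ext k p
  exact rows k k.2 p

/-- A nonzero entry forces its K-weight to be the product of those of its tensor factors, which
fixes the weight of the second factor and hence its index. Together with `eq_zero_of_hom` this
leaves one free scalar in an intertwiner. -/
theorem eq_of_hom_weight (hq : q ≠ 0) (hn : ∀ j, 0 < j → j ≤ n → q ^ (2 * j) ≠ 1)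
    {i : Fin m} {k : Fin d} {j j' : Fin n}
    {Z Z' : Matrix (Fin m × Fin n) (Fin d) ℂ}
    (hK : Z * std q d .K = (std q m .K ⊗ₖ std q n .K) * Z)
    (hK' : Z' * std q d .K = (std q m .K ⊗ₖ std q n .K) * Z')
    (h : Z (i, j) k ≠ 0) (h' : Z' (i, j') k ≠ 0) : j = j' := by
  have key : ∀ (Z : Matrix (Fin m × Fin n) (Fin d) ℂ) (j : Fin n),
      Z * std q d .K = (std q m .K ⊗ₖ std q n .K) * Z → Z (i, j) k ≠ 0 →
      weight q n j = (weight q m i)⁻¹ * weight q d k := by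
    intro Z j hK h
    have e := congrFun (congrFun hK (i, j)) k
    rw [kronecker_mul_apply] at e
    simp only [std, Matrix.diagonal_transpose, Matrix.mul_diagonal, Matrix.diagonal_mul,
      Matrix.of_apply] at e
    have hw := weight_ne_zero (d := m) hq i
    have : weight q d k = weight q m i * weight q n j := by
      apply mul_left_cancel₀ h
      rw [e]; ring
    rw [this]; field_simp
  exact Fin.ext (weight_injective hq hn j.2.le j'.2.le ((key Z j hK h).trans (key Z' j' hK' h').symm))

theorem eq_of_cohom_weight (hq : q ≠ 0) (hn : ∀ j, 0 < j → j ≤ n → q ^ (2 * j) ≠ 1)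
    {i : Fin m} {k : Fin d} {j j' : Fin n}
    {Z Z' : Matrix (Fin d) (Fin m × Fin n) ℂ}
    (hK : std q d .K * Z = Z * (std q m .K ⊗ₖ std q n .K))
    (hK' : std q d .K * Z' = Z' * (std q m .K ⊗ₖ std q n .K))
    (h : Z k (i, j) ≠ 0) (h' : Z' k (i, j') ≠ 0) : j = j' := by
  refine eq_of_hom_weight (Z := Zᵀ) (Z' := Z'ᵀ) (i := i) (k := k) hq hn ?_ ?_ h h'
  · have := congrArg Matrix.transpose hK
    simpa [std, ← Matrix.kroneckerMap_transpose, diagonal_kronecker_diagonal] using this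
  · have := congrArg Matrix.transpose hK'
    simpa [std, ← Matrix.kroneckerMap_transpose, diagonal_kronecker_diagonal] using this

end UqRep

/-! ### Equivalence with the contragredient, and multiplicity one. -/

namespace PhysSystem

variable {q : ℂ} (P : PhysSystem q)

/-- The representation `a` as a morphism of algebras. -/
noncomputable def repHom : (a : P.Obj) → UqRep q (P.dim a)
  | (α, false) => P.ρ α
  | (α, true) => (P.ρ α).dualHom

theorem repHom_apply (a : P.Obj) (ξ : Uq q) : P.repHom a ξ = P.rep a ξ := by
  obtain ⟨α, _ | _⟩ := a <;> rfl

theorem dim_pos (a : P.Obj) : 0 < P.dim a := (P.physical a.1).1.1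

theorem rep_one (a : P.Obj) : P.rep a 1 = 1 := by rw [← repHom_apply, map_one]

/-- The standard matrices depend only on q and the dimension, and the contragredient is again of
type 1. One standard form therefore serves α and ᾱ, which is why they are equivalent. -/
theorem exists_std (hq : q ≠ 0) (hq2 : q ^ 2 ≠ 1) (a : P.Obj) :
    ∃ T T' : Matrix (P.Ix a) (P.Ix a) ℂ, T * T' = 1 ∧ T' * T = 1 ∧
      (∀ x, P.rep a (Uq.gen q x) * T = T * UqRep.std q (P.dim a) x) ∧
      (∀ x, T' * P.rep a (Uq.gen q x) = UqRep.std q (P.dim a) x * T') := by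
  obtain ⟨T, T', h1, h2, h3⟩ : ∃ T T' : Matrix (P.Ix a) (P.Ix a) ℂ, T * T' = 1 ∧ T' * T = 1 ∧
      (∀ x, P.rep a (Uq.gen q x) * T = T * UqRep.std q (P.dim a) x) := by
    have hord := (P.physical a.1).pow_ne_one hq hq2
    have hstd := UqRep.exists_std hq hord (P.dim_pos a) (P.physical a.1).2.1
    obtain ⟨α, _ | _⟩ := a
    · exact hstd
    · obtain ⟨T, T', h1, h2, h3⟩ := hstd
      exact UqRep.exists_std hq hord (P.dim_pos (α, true))
        (UqRep.dualHom_isTypeOne (P.dim_pos (α, true)) h1 h2 h3)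
  refine ⟨T, T', h1, h2, h3, fun x => ?_⟩
  calc T' * P.rep a (Uq.gen q x) = T' * (P.rep a (Uq.gen q x) * T) * T' := by
        rw [Matrix.mul_assoc, Matrix.mul_assoc, h1, Matrix.mul_one]
    _ = _ := by rw [h3, ← Matrix.mul_assoc, h2, Matrix.one_mul]

/-- A contragredient representation is equivalent to the representation itself. -/
theorem exists_equiv (hq : q ≠ 0) (hq2 : q ^ 2 ≠ 1) (a : P.Obj) :
    ∃ X Y : Matrix (P.Ix a) (P.Ix a) ℂ, X * Y = 1 ∧ Y * X = 1 ∧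
      Intertwines (P.ρ a.1) (P.rep a) X ∧ Intertwines (P.rep a) (P.ρ a.1) Y := by
  obtain ⟨T, T', h1, h2, h3, h4⟩ := P.exists_std hq hq2 a
  obtain ⟨U, U', g1, g2, g3, g4⟩ := P.exists_std hq hq2 (P.o a.1)
  refine ⟨T * U', U * T', ?_, ?_, ?_, ?_⟩
  · rw [Matrix.mul_assoc, ← Matrix.mul_assoc U', g2, Matrix.one_mul, h1]
  · rw [Matrix.mul_assoc, ← Matrix.mul_assoc T', h2, Matrix.one_mul, g1]
  · intro ξ
    rw [← repHom_apply]
    refine UqRep.intertwines_of_gen (P.ρ a.1) (P.repHom a) (T * U') (fun x => ?_) ξ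
    rw [Matrix.mul_assoc]
    erw [g4 x]
    rw [repHom_apply, ← Matrix.mul_assoc, ← Matrix.mul_assoc, h3]
  · intro ξ
    rw [← repHom_apply]
    refine UqRep.intertwines_of_gen (P.repHom a) (P.ρ a.1) (U * T') (fun x => ?_) ξ
    rw [Matrix.mul_assoc, repHom_apply, h4 x, ← Matrix.mul_assoc, ← Matrix.mul_assoc]
    congr 1
    exact (g3 x).symm

section Multiplicity

variable {P} {a b : P.Obj} {γ : P.I}

/-- The multiplicity of `γ` in `a ⊗ b` is at most one, as a subrepresentation. -/
theorem eq_smul_of_intertwines (hq : q ≠ 0) (hq2 : q ^ 2 ≠ 1)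
    {φ φ' : Matrix (P.Ix a × P.Ix b) (Fin (P.d γ)) ℂ}
    (h : Intertwines (P.ρ γ) (tensorRep (P.rep a) (P.rep b)) φ)
    (h' : Intertwines (P.ρ γ) (tensorRep (P.rep a) (P.rep b)) φ') (hne : φ' ≠ 0) :
    ∃ c : ℂ, φ = c • φ' := by
  obtain ⟨T, T', t1, t2, t3, t4⟩ := P.exists_std hq hq2 a
  obtain ⟨U, U', u1, u2, u3, u4⟩ := P.exists_std hq hq2 b
  obtain ⟨W, W', w1, w2, w3, w4⟩ := P.exists_std hq hq2 (P.o γ)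
  -- `Z φ` is φ written in the standard bases of the three representations.
  let Z (φ : Matrix (P.Ix a × P.Ix b) (Fin (P.d γ)) ℂ) :
    Matrix (P.Ix a × P.Ix b) (Fin (P.d γ)) ℂ := (T' ⊗ₖ U') * φ * W
  have hZ0 : ∀ φ, Z φ = 0 → φ = 0 := by
    intro φ h0
    have : (T ⊗ₖ U) * Z φ * W' = φ := by
      simp only [Z]
      rw [← Matrix.mul_assoc, ← Matrix.mul_assoc, ← Matrix.mul_kronecker_mul, t1, u1,
        Matrix.one_kronecker_one, Matrix.one_mul, Matrix.mul_assoc, w1, Matrix.mul_one]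
    rw [← this, h0]
    simp
  have hZ : ∀ φ, Intertwines (P.ρ γ) (tensorRep (P.rep a) (P.rep b)) φ → ∀ x D,
      (T' ⊗ₖ U') * tensorRep (P.rep a) (P.rep b) (Uq.gen q x) = D * (T' ⊗ₖ U') →
      Z φ * UqRep.std q (P.d γ) x = D * Z φ := by
    intro φ hφ x D hD
    simp only [Z]
    rw [Matrix.mul_assoc]
    erw [← w3 x]
    rw [← Matrix.mul_assoc, Matrix.mul_assoc _ φ]
    erw [hφ (Uq.gen q x)]
    rw [← Matrix.mul_assoc, hD]
    simp only [Matrix.mul_assoc]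
  have hE := fun φ hφ => hZ φ hφ .E (UqRep.std q (P.dim a) .E ⊗ₖ UqRep.std q (P.dim b) .K +
      1 ⊗ₖ UqRep.std q (P.dim b) .E) (by
    rw [tensorRep_E, rep_one, Matrix.mul_add, Matrix.add_mul, ← Matrix.mul_kronecker_mul,
      ← Matrix.mul_kronecker_mul, ← Matrix.mul_kronecker_mul, ← Matrix.mul_kronecker_mul,
      t4, u4, u4, Matrix.mul_one, Matrix.one_mul])
  have hF := fun φ hφ => hZ φ hφ .F (UqRep.std q (P.dim a) .F ⊗ₖ 1 +
      UqRep.std q (P.dim a) .Kinv ⊗ₖ UqRep.std q (P.dim b) .F) (by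
    rw [tensorRep_F, rep_one, Matrix.mul_add, Matrix.add_mul, ← Matrix.mul_kronecker_mul,
      ← Matrix.mul_kronecker_mul, ← Matrix.mul_kronecker_mul, ← Matrix.mul_kronecker_mul,
      t4, t4, u4, Matrix.mul_one, Matrix.one_mul])
  have hK := fun φ hφ => hZ φ hφ .K (UqRep.std q (P.dim a) .K ⊗ₖ UqRep.std q (P.dim b) .K) (by
    rw [tensorRep_K, ← Matrix.mul_kronecker_mul, ← Matrix.mul_kronecker_mul, t4, u4])
  have van := fun φ hφ => UqRep.eq_zero_of_hom hq ((P.physical a.1).pow_ne_one hq hq2)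
    (P.dim_pos a) (P.dim_pos (P.o γ)) (Z φ) (hE φ hφ) (hF φ hφ)
  have hex : ∃ j, Z φ' (⟨0, P.dim_pos a⟩, j) ⟨0, P.dim_pos (P.o γ)⟩ ≠ 0 := by
    by_contra! h0
    exact hne (hZ0 _ (van φ' h' h0))
  obtain ⟨j0, hj0⟩ := hex
  have wt := fun φ φ' (hφ : Intertwines (P.ρ γ) (tensorRep (P.rep a) (P.rep b)) φ)
    (hφ' : Intertwines (P.ρ γ) (tensorRep (P.rep a) (P.rep b)) φ') (j j' : P.Ix b) =>
    UqRep.eq_of_hom_weight (i := (⟨0, P.dim_pos a⟩ : Fin (P.dim a)))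
      (k := (⟨0, P.dim_pos (P.o γ)⟩ : Fin (P.d γ))) (j := j) (j' := j') hq
      ((P.physical b.1).pow_ne_one hq hq2) (hK φ hφ) (hK φ' hφ')
  set s := Z φ (⟨0, P.dim_pos a⟩, j0) ⟨0, P.dim_pos (P.o γ)⟩ with hs
  set s' := Z φ' (⟨0, P.dim_pos a⟩, j0) ⟨0, P.dim_pos (P.o γ)⟩ with hs'
  -- By weights, the image of the highest weight vector under φ or φ' has at most the one
  -- coefficient at j0 along the highest weight vector of the first factor. This ratio cancels it in
  -- φ - c φ', which then vanishes.
  refine ⟨s / s', ?_⟩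
  rw [← sub_eq_zero]
  apply hZ0
  have hlin : Z (φ - (s / s') • φ') = Z φ - (s / s') • Z φ' := by
    simp only [Z, Matrix.mul_sub, Matrix.sub_mul, Matrix.mul_smul, Matrix.smul_mul]
  apply van
  · intro ξ
    rw [Matrix.sub_mul, Matrix.mul_sub, Matrix.smul_mul, Matrix.mul_smul, h, h']
  · intro j
    rw [hlin, Matrix.sub_apply, Matrix.smul_apply, smul_eq_mul]
    by_cases hj : j = j0
    · subst hj
      rw [← hs, ← hs', div_mul_cancel₀ _ hj0, sub_self]
    · have e1 : Z φ (⟨0, P.dim_pos a⟩, j) ⟨0, P.dim_pos (P.o γ)⟩ = 0 := by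
        by_contra h1
        exact hj (wt φ φ' h h' j j0 h1 hj0)
      have e2 : Z φ' (⟨0, P.dim_pos a⟩, j) ⟨0, P.dim_pos (P.o γ)⟩ = 0 := by
        by_contra h1
        exact hj (wt φ' φ' h' h' j j0 h1 hj0)
      rw [e1, e2, mul_zero, sub_zero]

/-- The multiplicity of `γ` in `a ⊗ b` is at most one, as a quotient representation. -/
theorem eq_smul_of_intertwines' (hq : q ≠ 0) (hq2 : q ^ 2 ≠ 1)
    {ψ ψ' : Matrix (Fin (P.d γ)) (P.Ix a × P.Ix b) ℂ}
    (h : Intertwines (tensorRep (P.rep a) (P.rep b)) (P.ρ γ) ψ)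
    (h' : Intertwines (tensorRep (P.rep a) (P.rep b)) (P.ρ γ) ψ') (hne : ψ' ≠ 0) :
    ∃ c : ℂ, ψ = c • ψ' := by
  obtain ⟨T, T', t1, t2, t3, t4⟩ := P.exists_std hq hq2 a
  obtain ⟨U, U', u1, u2, u3, u4⟩ := P.exists_std hq hq2 b
  obtain ⟨W, W', w1, w2, w3, w4⟩ := P.exists_std hq hq2 (P.o γ)
  let Z (ψ : Matrix (Fin (P.d γ)) (P.Ix a × P.Ix b) ℂ) :
    Matrix (Fin (P.d γ)) (P.Ix a × P.Ix b) ℂ := W' * (ψ * (T ⊗ₖ U))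
  have hZ0 : ∀ ψ, Z ψ = 0 → ψ = 0 := by
    intro ψ h0
    have : W * (Z ψ * (T' ⊗ₖ U')) = ψ := by
      simp only [Z]
      rw [Matrix.mul_assoc, Matrix.mul_assoc, ← Matrix.mul_kronecker_mul, t1, u1,
        Matrix.one_kronecker_one, Matrix.mul_one, ← Matrix.mul_assoc, w1, Matrix.one_mul]
    rw [← this, h0]
    simp
  have hZ : ∀ ψ, Intertwines (tensorRep (P.rep a) (P.rep b)) (P.ρ γ) ψ → ∀ x D,
      tensorRep (P.rep a) (P.rep b) (Uq.gen q x) * (T ⊗ₖ U) = (T ⊗ₖ U) * D →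
      UqRep.std q (P.d γ) x * Z ψ = Z ψ * D := by
    intro ψ hψ x D hD
    simp only [Z]
    rw [← Matrix.mul_assoc]
    erw [← w4 x]
    rw [Matrix.mul_assoc, ← Matrix.mul_assoc _ ψ]
    erw [← hψ (Uq.gen q x)]
    rw [Matrix.mul_assoc, hD]
    simp only [Matrix.mul_assoc]
  have hE := fun ψ hψ => hZ ψ hψ .E (UqRep.std q (P.dim a) .E ⊗ₖ UqRep.std q (P.dim b) .K +
      1 ⊗ₖ UqRep.std q (P.dim b) .E) (by
    rw [tensorRep_E, rep_one, Matrix.mul_add, Matrix.add_mul, ← Matrix.mul_kronecker_mul,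
      ← Matrix.mul_kronecker_mul, ← Matrix.mul_kronecker_mul, ← Matrix.mul_kronecker_mul,
      t3, u3, u3, Matrix.mul_one, Matrix.one_mul])
  have hF := fun ψ hψ => hZ ψ hψ .F (UqRep.std q (P.dim a) .F ⊗ₖ 1 +
      UqRep.std q (P.dim a) .Kinv ⊗ₖ UqRep.std q (P.dim b) .F) (by
    rw [tensorRep_F, rep_one, Matrix.mul_add, Matrix.add_mul, ← Matrix.mul_kronecker_mul,
      ← Matrix.mul_kronecker_mul, ← Matrix.mul_kronecker_mul, ← Matrix.mul_kronecker_mul,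
      t3, t3, u3, Matrix.mul_one, Matrix.one_mul])
  have hK := fun ψ hψ => hZ ψ hψ .K (UqRep.std q (P.dim a) .K ⊗ₖ UqRep.std q (P.dim b) .K) (by
    rw [tensorRep_K, ← Matrix.mul_kronecker_mul, ← Matrix.mul_kronecker_mul, t3, u3])
  have van := fun ψ hψ => UqRep.eq_zero_of_cohom hq ((P.physical γ).pow_ne_one hq hq2)
    (P.dim_pos a) (P.dim_pos (P.o γ)) (Z ψ) (hE ψ hψ) (hF ψ hψ)
  have hex : ∃ j, Z ψ' ⟨0, P.dim_pos (P.o γ)⟩ (⟨0, P.dim_pos a⟩, j) ≠ 0 := by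
    by_contra! h0
    exact hne (hZ0 _ (van ψ' h' h0))
  obtain ⟨j0, hj0⟩ := hex
  have wt := fun ψ ψ' (hψ : Intertwines (tensorRep (P.rep a) (P.rep b)) (P.ρ γ) ψ)
    (hψ' : Intertwines (tensorRep (P.rep a) (P.rep b)) (P.ρ γ) ψ') (j j' : P.Ix b) =>
    UqRep.eq_of_cohom_weight (i := (⟨0, P.dim_pos a⟩ : Fin (P.dim a)))
      (k := (⟨0, P.dim_pos (P.o γ)⟩ : Fin (P.d γ))) (j := j) (j' := j') hq
      ((P.physical b.1).pow_ne_one hq hq2) (hK ψ hψ) (hK ψ' hψ')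
  set s := Z ψ ⟨0, P.dim_pos (P.o γ)⟩ (⟨0, P.dim_pos a⟩, j0) with hs
  set s' := Z ψ' ⟨0, P.dim_pos (P.o γ)⟩ (⟨0, P.dim_pos a⟩, j0) with hs'
  -- Again the ratio cancels the only entry that weights permit in the top row over the highest
  -- weight vector of the first factor.
  refine ⟨s / s', ?_⟩
  rw [← sub_eq_zero]
  apply hZ0
  have hlin : Z (ψ - (s / s') • ψ') = Z ψ - (s / s') • Z ψ' := by
    simp only [Z, Matrix.mul_sub, Matrix.sub_mul, Matrix.mul_smul, Matrix.smul_mul]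
  apply van
  · intro ξ
    rw [Matrix.sub_mul, Matrix.mul_sub, Matrix.smul_mul, Matrix.mul_smul, h, h']
  · intro j
    rw [hlin, Matrix.sub_apply, Matrix.smul_apply, smul_eq_mul]
    by_cases hj : j = j0
    · subst hj
      rw [← hs, ← hs', div_mul_cancel₀ _ hj0, sub_self]
    · have e1 : Z ψ ⟨0, P.dim_pos (P.o γ)⟩ (⟨0, P.dim_pos a⟩, j) = 0 := by
        by_contra h1
        exact hj (wt ψ ψ' h h' j j0 h1 hj0)
      have e2 : Z ψ' ⟨0, P.dim_pos (P.o γ)⟩ (⟨0, P.dim_pos a⟩, j) = 0 := by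
        by_contra h1
        exact hj (wt ψ' ψ' h' h' j j0 h1 hj0)
      rw [e1, e2, mul_zero, sub_zero]

end Multiplicity

end PhysSystem

/-! ### Covariant matrices and the operations that preserve covariance. -/

section Cov

variable {H : Type*} {m n o m' n' : Type*} [Fintype m] [Fintype n] [Fintype o] [Fintype m']
  [Fintype n']

/-- `X U = U' X` for matrices `U`, `U'` with entries in a vector space and a scalar matrix `X`. -/
def Cov [AddCommGroup H] [Module ℂ H] (U : Matrix m m H) (U' : Matrix n n H)
    (X : Matrix n m ℂ) : Prop :=
  ∀ ℓ : Module.Dual ℂ H, X * U.map ℓ = U'.map ℓ * X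

/-- The `1 × 1` matrix with entry `1`. -/
def unitMatrix (H : Type*) [One H] : Matrix Unit Unit H := fun _ _ => 1

section Contraction

variable [DecidableEq m'] {Z : Type*}

/-- Contraction of the second factor of a tensor product with a linear form. -/
def contractSnd (Y : Matrix Unit m ℂ) : Matrix m' (m' × m) ℂ :=
  fun b x => if b = x.1 then Y () x.2 else 0

/-- Contraction of the first factor of a tensor product with a linear form. -/
def contractFst (Y : Matrix Unit m ℂ) : Matrix m' (m × m') ℂ :=
  fun b x => if b = x.2 then Y () x.1 else 0

/-- Insertion of a vector as the second factor of a tensor product. -/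
def insertSnd (Y : Matrix m Unit ℂ) : Matrix (m' × m) m' ℂ :=
  fun x b => if x.1 = b then Y x.2 () else 0

theorem contractSnd_mul (Y : Matrix Unit m ℂ) (X : Matrix (m' × m) Z ℂ) (b : m') (z : Z) :
    ((contractSnd Y : Matrix m' (m' × m) ℂ) * X) b z = ∑ x, Y () x * X (b, x) z := by
  rw [Matrix.mul_apply, Fintype.sum_prod_type, Fintype.sum_eq_single b]
  · simp [contractSnd]
  · intro c hc
    simp [contractSnd, Ne.symm hc]

theorem contractFst_mul (Y : Matrix Unit m ℂ) (X : Matrix (m × m') Z ℂ) (b : m') (z : Z) :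
    ((contractFst Y : Matrix m' (m × m') ℂ) * X) b z = ∑ x, Y () x * X (x, b) z := by
  rw [Matrix.mul_apply, Fintype.sum_prod_type_right, Fintype.sum_eq_single b]
  · simp [contractFst]
  · intro c hc
    simp [contractFst, Ne.symm hc]

theorem mul_insertSnd (Y : Matrix m Unit ℂ) (X : Matrix Z (m' × m) ℂ) (b : m') (z : Z) :
    (X * (insertSnd Y : Matrix (m' × m) m' ℂ)) z b = ∑ x, X z (b, x) * Y x () := by
  rw [Matrix.mul_apply, Fintype.sum_prod_type, Fintype.sum_eq_single b]
  · simp [insertSnd]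
  · intro c hc
    simp [insertSnd, hc]

end Contraction

namespace Cov

section Module

variable [AddCommGroup H] [Module ℂ H] {U : Matrix m m H} {U' : Matrix n n H} {U'' : Matrix o o H}
  {X X' : Matrix n m ℂ}

theorem apply (h : Cov U U' X) (ℓ : Module.Dual ℂ H) (i : n) (k : m) :
    ∑ j, X i j * ℓ (U j k) = ∑ j, ℓ (U' i j) * X j k :=
  congrFun (congrFun (h ℓ) i) k

/-- Linear forms separate the points of a complex vector space. Testing against them allows complex
matrix algebra in proofs, although the entries of U lie in a non-associative ring; this lemma
returns to the entries. -/
theorem sum_smul (h : Cov U U' X) (i : n) (k : m) :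
    ∑ j, X i j • U j k = ∑ j, X j k • U' i j := by
  rw [← sub_eq_zero, ← Module.forall_dual_apply_eq_zero_iff ℂ]
  intro ℓ
  simp only [map_sub, map_sum, map_smul, smul_eq_mul]
  rw [h.apply ℓ i k, sub_eq_zero]
  exact Finset.sum_congr rfl fun _ _ => mul_comm _ _

theorem of_sum_smul (h : ∀ i k, ∑ j, X i j • U j k = ∑ j, X j k • U' i j) : Cov U U' X := by
  intro ℓ
  ext i k
  have := congrArg ℓ (h i k)
  simp only [map_sum, map_smul, smul_eq_mul] at this
  simp only [Matrix.mul_apply, Matrix.map_apply, this]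
  exact Finset.sum_congr rfl fun _ _ => mul_comm _ _

theorem one [DecidableEq m] : Cov U U 1 := fun ℓ => by rw [Matrix.one_mul, Matrix.mul_one]

theorem zero : Cov U U' 0 := fun ℓ => by rw [Matrix.zero_mul, Matrix.mul_zero]

theorem add (h : Cov U U' X) (h' : Cov U U' X') : Cov U U' (X + X') := fun ℓ => by
  rw [Matrix.add_mul, Matrix.mul_add, h, h']

theorem smul (c : ℂ) (h : Cov U U' X) : Cov U U' (c • X) := fun ℓ => by
  rw [Matrix.smul_mul, Matrix.mul_smul, h]

theorem mul {Y : Matrix o n ℂ} (hY : Cov U' U'' Y) (h : Cov U U' X) : Cov U U'' (Y * X) :=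
  fun ℓ => by rw [Matrix.mul_assoc, h, ← Matrix.mul_assoc, hY, Matrix.mul_assoc]

theorem sum {ι : Type*} (s : Finset ι) {X : ι → Matrix n m ℂ} (h : ∀ i ∈ s, Cov U U' (X i)) :
    Cov U U' (∑ i ∈ s, X i) := fun ℓ => by
  rw [Matrix.sum_mul, Matrix.mul_sum]
  exact Finset.sum_congr rfl fun i hi => h i hi ℓ

/-- The covariant matrices form a submonoid. -/
def submonoid (U : Matrix m m H) (U' : Matrix n n H) : AddSubmonoid (Matrix n m ℂ) where
  carrier := {X | Cov U U' X}
  zero_mem' := zero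
  add_mem' := add

/-- A quasi-inverse of a covariant matrix is covariant. -/
theorem quasiInverse {p : Matrix m m ℂ} {p' : Matrix n n ℂ} (h : Cov U U' X) (hp : Cov U U p)
    (hp' : Cov U' U' p') : Cov U' U (quasiInverse p p' X) := by
  unfold _root_.quasiInverse
  split_ifs with hex
  · obtain ⟨h1, h2, h3⟩ := hex.choose_spec
    intro ℓ
    set N := hex.choose
    -- N absorbs p on the left and p' on the right. Covariance of p' = X N and of p = N X then
    -- carries U' across N, with X as the intermediary.
    have h4 : p * N = N := by rw [← h1, Matrix.mul_assoc, h2, h3]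
    calc N * U'.map ℓ = N * (p' * U'.map ℓ) := by rw [← Matrix.mul_assoc, h3]
      _ = N * (U'.map ℓ * X) * N := by
        rw [hp', ← h2]; simp only [Matrix.mul_assoc]
      _ = N * X * (U.map ℓ) * N := by rw [← h]; simp only [Matrix.mul_assoc]
      _ = U.map ℓ * N := by rw [h1, hp, Matrix.mul_assoc, h4]
  · exact zero

end Module

section Ring

variable [NonAssocRing H] [Module ℂ H] [SMulCommClass ℂ H H] [IsScalarTower ℂ H H]
  {U : Matrix m m H} {U' : Matrix n n H} {V : Matrix m' m' H} {V' : Matrix n' n' H}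
  {X : Matrix n m ℂ} {Y : Matrix n' m' ℂ}

/-- Only scalars are moved past entries: X is moved with an entry of V fixed on the right, then Y
with an entry of U' fixed on the left. Neither associativity nor commutativity of the entries is
used. -/
theorem kronecker (hX : Cov U U' X) (hY : Cov V V' Y) : Cov (U ⊗ₖ V) (U' ⊗ₖ V') (X ⊗ₖ Y) := by
  intro ℓ
  ext ⟨i, i'⟩ ⟨k, k'⟩
  simp only [Matrix.mul_apply, Fintype.sum_prod_type, kroneckerMap_apply, Matrix.map_apply]
  have e1 : ∀ j', ∑ j, X i j * ℓ (U j k * V j' k') = ∑ j, ℓ (U' i j * V j' k') * X j k :=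
    fun j' => hX.apply (ℓ ∘ₗ LinearMap.mulRight ℂ (V j' k')) i k
  have e2 : ∀ j, ∑ j', Y i' j' * ℓ (U' i j * V j' k') = ∑ j', ℓ (U' i j * V' i' j') * Y j' k' :=
    fun j => hY.apply (ℓ ∘ₗ LinearMap.mulLeft ℂ (U' i j)) i' k'
  calc _ = ∑ j', Y i' j' * ∑ j, X i j * ℓ (U j k * V j' k') := by
        rw [Finset.sum_comm]
        refine Finset.sum_congr rfl fun j' _ => ?_
        rw [Finset.mul_sum]
        exact Finset.sum_congr rfl fun j _ => by ring
    _ = ∑ j, X j k * ∑ j', Y i' j' * ℓ (U' i j * V j' k') := by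
        simp only [e1, Finset.mul_sum]
        rw [Finset.sum_comm]
        exact Finset.sum_congr rfl fun j _ => Finset.sum_congr rfl fun j' _ => by ring
    _ = _ := by
        simp only [e2, Finset.mul_sum]
        exact Finset.sum_congr rfl fun j _ => Finset.sum_congr rfl fun j' _ => by ring

/-- Contraction of the second factor of a tensor product with an invariant linear form. -/
theorem contract_right [DecidableEq m'] {Y : Matrix Unit m ℂ} (hY : Cov U (unitMatrix H) Y) :
    Cov (V ⊗ₖ U) V (contractSnd Y) := by
  refine of_sum_smul fun b x => ?_
  have := congrArg (fun a => V b x.1 * a) (hY.sum_smul () x.2)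
  simp only [Finset.univ_unique, Finset.sum_singleton, unitMatrix, mul_smul_comm, mul_one,
    Finset.mul_sum] at this
  simpa [contractSnd, contractFst, insertSnd, Fintype.sum_prod_type, kroneckerMap_apply]
    using this

/-- Contraction of the first factor of a tensor product with an invariant linear form. -/
theorem contract_left [DecidableEq m'] {Y : Matrix Unit m ℂ} (hY : Cov U (unitMatrix H) Y) :
    Cov (U ⊗ₖ V) V (contractFst Y) := by
  refine of_sum_smul fun b x => ?_
  have := congrArg (fun a => a * V b x.2) (hY.sum_smul () x.1)
  simp only [Finset.univ_unique, Finset.sum_singleton, unitMatrix, smul_mul_assoc, one_mul,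
    Finset.sum_mul] at this
  simpa [contractSnd, contractFst, insertSnd, Fintype.sum_prod_type, kroneckerMap_apply]
    using this

/-- Insertion of an invariant vector as the second factor of a tensor product. -/
theorem insert_right [DecidableEq m'] {Y : Matrix m Unit ℂ} (hY : Cov (unitMatrix H) U Y) :
    Cov V (V ⊗ₖ U) (insertSnd Y) := by
  refine of_sum_smul fun x b => ?_
  have := congrArg (fun a => V x.1 b * a) (hY.sum_smul x.2 ())
  simp only [Finset.univ_unique, Finset.sum_singleton, unitMatrix, mul_smul_comm, mul_one,
    Finset.mul_sum] at this
  simpa [contractSnd, contractFst, insertSnd, Fintype.sum_prod_type, kroneckerMap_apply]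
    using this

end Ring

end Cov

end Cov

/-- This turns products of transported matrix entries into a product of complex matrices, where
associativity is available. -/
theorem dual_mul_eq {H m m' n n' : Type*} [Fintype m] [Fintype m'] [NonAssocRing H] [Module ℂ H]
    [SMulCommClass ℂ H H] [IsScalarTower ℂ H H] (ℓ : Module.Dual ℂ H)
    (U : Matrix m m H) (V : Matrix m' m' H) {X : Matrix n m ℂ} {Y : Matrix m n ℂ}
    {X' : Matrix n' m' ℂ} {Y' : Matrix m' n' ℂ} {u v : H} {i j : n} {k l : n'}
    (hu : u = ∑ a, ∑ b, (X i a * Y b j) • U a b) (hv : v = ∑ a, ∑ b, (X' k a * Y' b l) • V a b) :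
    ℓ (u * v) = ((X ⊗ₖ X') * (U ⊗ₖ V).map ℓ * (Y ⊗ₖ Y'))
      (i, k) (j, l) := by
  rw [hu, hv]
  simp only [Matrix.mul_apply, Fintype.sum_prod_type, kroneckerMap_apply, Matrix.map_apply]
  simp only [Finset.sum_mul]
  simp only [Finset.mul_sum, map_sum, smul_mul_assoc, mul_smul_comm, map_smul, smul_eq_mul]
  rw [Finset.sum_comm]
  refine Finset.sum_congr rfl fun b _ => ?_
  rw [Finset.sum_congr rfl fun a _ => Finset.sum_comm, Finset.sum_comm]
  exact Finset.sum_congr rfl fun _ _ => Finset.sum_congr rfl fun _ _ =>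
    Finset.sum_congr rfl fun _ _ => by ring

/-! ### The product of Γ on matrices of contragredient representations. -/

namespace QGamma

variable {q : ℂ} {P : PhysSystem q} (C : ClebschGordan P)

theorem sum_zero {M : Type*} [AddCommMonoid M] (f : Fin (P.d P.zero) → M) :
    ∑ k, f k = f P.ix0 :=
  Fintype.sum_eq_single _ fun k hk => absurd (eq_ix0 k) hk

theorem sum_prod_zero {M ι : Type*} [Fintype ι] [AddCommMonoid M]
    (f : ι × P.Ix (P.o P.zero) → M) : ∑ x, f x = ∑ i, f (i, P.ix0) := by
  rw [Fintype.sum_prod_type]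
  exact Finset.sum_congr rfl fun i _ => sum_zero fun k => f (i, k)

theorem tensorRep_zero (a : P.Obj) (ξ : Uq q) (x y : P.Ix a × P.Ix (P.o P.zero)) :
    tensorRep (P.rep a) (P.rep (P.o P.zero)) ξ x y = P.rep a ξ x.1 y.1 := by
  obtain ⟨i, k⟩ := x
  obtain ⟨j, l⟩ := y
  obtain rfl : k = P.ix0 := eq_ix0 k
  obtain rfl : l = P.ix0 := eq_ix0 l
  refine tensorRep_counit_apply _ _ P.ix0 (fun η => ?_) ξ i j
  change P.ρ P.zero η P.ix0 P.ix0 = _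
  rw [P.ρ_zero]
  simp

/-- a ⊗ 0 acts as `a`, which is equivalent to the underlying physical representation, so Schur's
lemma excludes every other summand. Consequently g^a is a conjugate of a single g^α. -/
theorem fusion_obj_zero (hq : q ≠ 0) (hq2 : q ^ 2 ≠ 1) (a : P.Obj) :
    P.fusion a (P.o P.zero) = {a.1} := by
  obtain ⟨X, Y, h1, h2, hX, hY⟩ := P.exists_equiv hq hq2 a
  ext γ
  simp only [PhysSystem.fusion, Set.Finite.mem_toFinset, Set.mem_ofPred_eq, Finset.mem_singleton]
  constructor
  · rintro ⟨φ, ψ, hφ, -, hφψ⟩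
    let φ1 : Matrix (P.Ix a) (Fin (P.d γ)) ℂ := Matrix.of fun i m => φ (i, P.ix0) m
    have hφ1 : Intertwines (P.ρ γ) (P.rep a) φ1 := by
      intro ξ
      ext i m
      have := congrFun (congrFun (hφ ξ) (i, P.ix0)) m
      simp only [Matrix.mul_apply, sum_prod_zero, tensorRep_zero] at this
      exact this
    refine P.schur (Y * φ1) (fun ξ => ?_) fun h0 => ?_
    · rw [Matrix.mul_assoc, hφ1, ← Matrix.mul_assoc, hY, Matrix.mul_assoc]
    · have h3 : φ1 = 0 := by
        have := congrArg (X * ·) h0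
        simpa [← Matrix.mul_assoc, h1] using this
      have h4 : φ = 0 := by
        ext ⟨i, k⟩ m
        obtain rfl : k = P.ix0 := eq_ix0 k
        exact congrFun (congrFun h3 i) m
      rw [h4, Matrix.mul_zero] at hφψ
      have hd : 0 < P.d γ := (P.physical γ).1.1
      simpa using congrFun (congrFun hφψ ⟨0, hd⟩) ⟨0, hd⟩
  · rintro rfl
    refine ⟨Matrix.of fun x m => X x.1 m, Matrix.of fun n x => Y n x.1, fun ξ => ?_, fun ξ => ?_, ?_⟩
    · ext x m
      simp only [Matrix.mul_apply, sum_prod_zero, tensorRep_zero, Matrix.of_apply]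
      exact congrFun (congrFun (hX ξ) x.1) m
    · ext n x
      simp only [Matrix.mul_apply, sum_prod_zero, tensorRep_zero, Matrix.of_apply]
      exact congrFun (congrFun (hY ξ) n) x.1
    · ext n m
      simp only [Matrix.mul_apply, sum_prod_zero, Matrix.of_apply]
      exact congrFun (congrFun h2 n) m

/-- The equivalence `φ^{a0}` between `a` and its physical representative. -/
def toObj (a : P.Obj) : Matrix (P.Ix a) (Fin (P.d a.1)) ℂ :=
  Matrix.of fun i m => C.φ a (P.o P.zero) a.1 (i, P.ix0) m

/-- The inverse equivalence `ψ_{a0}`. -/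
def ofObj (a : P.Obj) : Matrix (Fin (P.d a.1)) (P.Ix a) ℂ :=
  Matrix.of fun n j => C.ψ a (P.o P.zero) a.1 n (j, P.ix0)

theorem toObj_intertwines (a : P.Obj) : Intertwines (P.ρ a.1) (P.rep a) (toObj C a) := by
  intro ξ
  ext i m
  have := congrFun (congrFun (C.φ_intertwines a (P.o P.zero) a.1 ξ) (i, P.ix0)) m
  simp only [Matrix.mul_apply, sum_prod_zero, tensorRep_zero] at this
  exact this

theorem ofObj_intertwines (a : P.Obj) : Intertwines (P.rep a) (P.ρ a.1) (ofObj C a) := by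
  intro ξ
  ext i m
  have := congrFun (congrFun (C.ψ_intertwines a (P.o P.zero) a.1 ξ) i) (m, P.ix0)
  simp only [Matrix.mul_apply, sum_prod_zero, tensorRep_zero] at this
  exact this

theorem mem_fusion {a b : P.Obj} {γ : P.I} : γ ∈ P.fusion a b ↔ P.Occurs a b γ := by
  simp [PhysSystem.fusion]

theorem ofObj_mul_toObj (hq : q ≠ 0) (hq2 : q ^ 2 ≠ 1) (a : P.Obj) :
    ofObj C a * toObj C a = 1 := by
  have h := C.ψ_mul_φ a (P.o P.zero) a.1
    (mem_fusion.mp (by rw [fusion_obj_zero hq hq2]; exact Finset.mem_singleton_self _))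
  ext n m
  have := congrFun (congrFun h n) m
  simp only [Matrix.mul_apply, sum_prod_zero] at this
  exact this

theorem toObj_mul_ofObj (hq : q ≠ 0) (hq2 : q ^ 2 ≠ 1) (a : P.Obj) :
    toObj C a * ofObj C a = 1 :=
  mul_eq_one_comm.mp (ofObj_mul_toObj C hq hq2 a)

theorem gObj_eq (hq : q ≠ 0) (hq2 : q ^ 2 ≠ 1) (a : P.Obj) (i j : P.Ix a) :
    gObj C a i j = ∑ m, ∑ n, (toObj C a i m * ofObj C a n j) • g C a.1 m n := by
  rw [gObj, fusion_obj_zero hq hq2, Finset.sum_singleton]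
  rfl

theorem gObj_o (α : P.I) (i j : Fin (P.d α)) : gObj C (P.o α) i j = g C α i j := by
  rw [gObj, fusion_zero_right C, Finset.sum_singleton, C.φ_right_zero, C.ψ_right_zero]
  simp

/-- The normalisation of φ^{0α} and ψ_{0α}, taken at α = 0, covers both versions of the trivial
representation. -/
theorem gObj_zero (s : Bool) (i j : P.Ix (P.zero, s)) : gObj C (P.zero, s) i j = 1 := by
  obtain rfl : i = P.ix0 := eq_ix0 i
  obtain rfl : j = P.ix0 := eq_ix0 j
  have hf : P.fusion (P.zero, s) (P.o P.zero) = {P.zero} := by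
    refine fusion_eq_singleton C _ _ P.zero (occurs_of_ne_zero C _ _ _ fun h => ?_) ?_
    · have := congrFun (congrFun h (P.ix0, P.ix0)) P.ix0
      simp [C.φ_left_zero] at this
    · ext ⟨i, j⟩ ⟨k, l⟩
      rw [C.φ_left_zero, C.ψ_left_zero]
      simp [Matrix.mul_apply, Matrix.one_apply, eq_ix0 i, eq_ix0 k, eq_ix0 j, eq_ix0 l]
  rw [gObj, hf, Finset.sum_singleton, C.φ_left_zero, C.ψ_left_zero]
  simp only [sum_zero]
  simp
  rfl

/-- The product of the matrices attached to two representations. -/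
theorem gObj_mul_gObj (hq : q ≠ 0) (hq2 : q ^ 2 ≠ 1) (a b : P.Obj) (i j : P.Ix a) (k l : P.Ix b) :
    gObj C a i j * gObj C b k l = ∑ γ ∈ P.fusion a b, ∑ m, ∑ n,
      (C.φ a b γ (i, k) m * C.ψ a b γ n (j, l)) • g C γ m n := by
  -- The equivalences carry the splitting of the physical tensor product to one of a ⊗ b. By
  -- multiplicity one it is a rescaling of the chosen φ and ψ, and ψ φ = 1 on both sides forces c c'
  -- = 1, so φ g ψ does not change.
  have hterm : ∀ γ ∈ P.fusion (P.o a.1) (P.o b.1), γ ∈ P.fusion a b ∧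
      ∃ c c' : ℂ, c * c' = 1 ∧
      (toObj C a ⊗ₖ toObj C b) * C.φ (P.o a.1) (P.o b.1) γ = c • C.φ a b γ ∧
      C.ψ (P.o a.1) (P.o b.1) γ * (ofObj C a ⊗ₖ ofObj C b) = c' • C.ψ a b γ := by
    intro γ hγ
    have hφ : Intertwines (P.ρ γ) (tensorRep (P.rep a) (P.rep b))
        ((toObj C a ⊗ₖ toObj C b) * C.φ (P.o a.1) (P.o b.1) γ) := fun ξ => by
      rw [Matrix.mul_assoc, C.φ_intertwines, ← Matrix.mul_assoc]
      erw [tensorRep_intertwines (f := P.rep (P.o a.1)) (g := P.rep (P.o b.1))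
        (toObj_intertwines C a) (toObj_intertwines C b) ξ]
      rw [Matrix.mul_assoc]
    have hψ : Intertwines (tensorRep (P.rep a) (P.rep b)) (P.ρ γ)
        (C.ψ (P.o a.1) (P.o b.1) γ * (ofObj C a ⊗ₖ ofObj C b)) := fun ξ => by
      rw [Matrix.mul_assoc]
      erw [tensorRep_intertwines (f' := P.rep (P.o a.1)) (g' := P.rep (P.o b.1))
        (ofObj_intertwines C a) (ofObj_intertwines C b) ξ]
      rw [← Matrix.mul_assoc, C.ψ_intertwines, Matrix.mul_assoc]
    have h1 : C.ψ (P.o a.1) (P.o b.1) γ * (ofObj C a ⊗ₖ ofObj C b) *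
        ((toObj C a ⊗ₖ toObj C b) * C.φ (P.o a.1) (P.o b.1) γ) = 1 := by
      rw [Matrix.mul_assoc, ← Matrix.mul_assoc (ofObj C a ⊗ₖ ofObj C b),
        ← Matrix.mul_kronecker_mul, ofObj_mul_toObj C hq hq2, ofObj_mul_toObj C hq hq2,
        Matrix.one_kronecker_one, Matrix.one_mul, C.ψ_mul_φ _ _ _ (mem_fusion.mp hγ)]
    have hd : 0 < P.d γ := (P.physical γ).1.1
    have hne : (1 : Matrix (Fin (P.d γ)) (Fin (P.d γ)) ℂ) ≠ 0 := fun h => by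
      simpa using congrFun (congrFun h ⟨0, hd⟩) ⟨0, hd⟩
    have hocc : P.Occurs a b γ := ⟨_, _, hφ, hψ, h1⟩
    have h2 := C.ψ_mul_φ a b γ hocc
    obtain ⟨c, hc⟩ := P.eq_smul_of_intertwines hq hq2 hφ (C.φ_intertwines a b γ)
      fun h => hne (by rw [← h2, h, Matrix.mul_zero])
    obtain ⟨c', hc'⟩ := P.eq_smul_of_intertwines' hq hq2 hψ (C.ψ_intertwines a b γ)
      fun h => hne (by rw [← h2, h, Matrix.zero_mul])
    refine ⟨mem_fusion.mpr hocc, c, c', ?_, hc, hc'⟩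
    rw [hc, hc', Matrix.smul_mul, Matrix.mul_smul, h2, smul_smul] at h1
    have := congrFun (congrFun h1 ⟨0, hd⟩) ⟨0, hd⟩
    simpa [mul_comm] using this
  -- The inverse equivalences transport splittings back, so that no further γ occurs in a ⊗ b.
  have hfus : P.fusion a b = P.fusion (P.o a.1) (P.o b.1) := by
    ext γ
    refine ⟨fun hγ => ?_, fun hγ => (hterm γ hγ).1⟩
    obtain ⟨φ, ψ, hφ, hψ, h1⟩ := mem_fusion.mp hγ
    refine mem_fusion.mpr ⟨(ofObj C a ⊗ₖ ofObj C b) * φ, ψ * (toObj C a ⊗ₖ toObj C b),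
      fun ξ => ?_, fun ξ => ?_, ?_⟩
    · rw [Matrix.mul_assoc, hφ, ← Matrix.mul_assoc]
      erw [tensorRep_intertwines (f' := P.rep (P.o a.1)) (g' := P.rep (P.o b.1))
        (ofObj_intertwines C a) (ofObj_intertwines C b) ξ]
      rw [Matrix.mul_assoc]
    · rw [Matrix.mul_assoc]
      erw [tensorRep_intertwines (f := P.rep (P.o a.1)) (g := P.rep (P.o b.1))
        (toObj_intertwines C a) (toObj_intertwines C b) ξ]
      rw [← Matrix.mul_assoc, hψ, Matrix.mul_assoc]
    · rw [Matrix.mul_assoc, ← Matrix.mul_assoc (toObj C a ⊗ₖ toObj C b),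
        ← Matrix.mul_kronecker_mul, toObj_mul_ofObj C hq hq2, toObj_mul_ofObj C hq hq2,
        Matrix.one_kronecker_one, Matrix.one_mul, h1]
  rw [← sub_eq_zero, ← Module.forall_dual_apply_eq_zero_iff ℂ]
  intro ℓ
  rw [map_sub, sub_eq_zero]
  have hmat : ∀ (a b : P.Obj) (γ : P.I) (x y),
      ℓ (∑ m, ∑ n, (C.φ a b γ x m * C.ψ a b γ n y) • g C γ m n) =
        (C.φ a b γ * (Matrix.of fun m n => ℓ (g C γ m n)) * C.ψ a b γ) x y := by
    intro a b γ x y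
    simp only [map_sum, map_smul, smul_eq_mul, Matrix.mul_apply, Matrix.of_apply, Finset.sum_mul]
    rw [Finset.sum_comm]
    exact Finset.sum_congr rfl fun _ _ => Finset.sum_congr rfl fun _ _ => by ring
  have hg : ∀ x y : Fin (P.d a.1) × Fin (P.d b.1), ℓ (g C a.1 x.1 y.1 * g C b.1 x.2 y.2) =
      (∑ γ ∈ P.fusion (P.o a.1) (P.o b.1), C.φ (P.o a.1) (P.o b.1) γ *
        (Matrix.of fun m n => ℓ (g C γ m n)) * C.ψ (P.o a.1) (P.o b.1) γ) x y := by
    intro x y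
    rw [g_mul_g, map_sum, Matrix.sum_apply]
    exact Finset.sum_congr rfl fun γ _ => hmat (P.o a.1) (P.o b.1) γ x y
  calc ℓ (gObj C a i j * gObj C b k l)
      = ((toObj C a ⊗ₖ toObj C b) * (∑ γ ∈ P.fusion (P.o a.1) (P.o b.1),
          C.φ (P.o a.1) (P.o b.1) γ * (Matrix.of fun m n => ℓ (g C γ m n)) *
          C.ψ (P.o a.1) (P.o b.1) γ) * (ofObj C a ⊗ₖ ofObj C b)) (i, k) (j, l) := by
        rw [show (∑ γ ∈ P.fusion (P.o a.1) (P.o b.1), C.φ (P.o a.1) (P.o b.1) γ *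
          (Matrix.of fun m n => ℓ (g C γ m n)) * C.ψ (P.o a.1) (P.o b.1) γ) = Matrix.of fun x y =>
            ℓ (g C a.1 x.1 y.1 * g C b.1 x.2 y.2) from Matrix.ext fun x y => (hg x y).symm]
        exact dual_mul_eq ℓ (fun m n => g C a.1 m n) (fun m n => g C b.1 m n)
          (gObj_eq C hq hq2 a i j) (gObj_eq C hq hq2 b k l)
    _ = (∑ γ ∈ P.fusion a b, C.φ a b γ * (Matrix.of fun m n => ℓ (g C γ m n)) *
          C.ψ a b γ) (i, k) (j, l) := by
        rw [hfus, Matrix.mul_sum, Matrix.sum_mul]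
        refine congrFun (congrFun (Finset.sum_congr rfl fun γ hγ => ?_) _) _
        obtain ⟨-, c, c', hcc, h1, h2⟩ := hterm γ hγ
        rw [Matrix.mul_assoc, Matrix.mul_assoc, h2, ← Matrix.mul_assoc, ← Matrix.mul_assoc, h1,
          Matrix.mul_smul, Matrix.smul_mul, Matrix.smul_mul, smul_smul, mul_comm, hcc, one_smul]
    _ = _ := by
        rw [map_sum, Matrix.sum_apply]
        exact Finset.sum_congr rfl fun γ _ => (hmat a b γ _ _).symm

end QGamma

/-! ### Covariance of φ, ψ, the associators, A and B. -/

namespace ClebschGordan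

variable {q : ℂ} {P : PhysSystem q} (C : ClebschGordan P)

/-- The matrix `g^a`, for `a` physical or contragredient. -/
noncomputable def gMat (a : P.Obj) : Matrix (P.Ix a) (P.Ix a) (QGamma C) := QGamma.gObj C a

/-- The matrix of products of the `g^a` attached to a parenthesised word. -/
noncomputable def gTree : (T : PTree P.Obj) → Matrix T.Idx T.Idx (QGamma C)
  | .leaf a => C.gMat a
  | .node s t => gTree s ⊗ₖ gTree t

theorem ψ_mul_φ_of_ne (a b : P.Obj) {γ δ : P.I} (h : γ ≠ δ) : C.ψ a b γ * C.φ a b δ = 0 := by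
  by_contra h0
  refine h (P.schur (C.ψ a b γ * C.φ a b δ) (fun ξ => ?_) h0).symm
  rw [Matrix.mul_assoc, C.φ_intertwines, ← Matrix.mul_assoc, C.ψ_intertwines, Matrix.mul_assoc]

variable {C}

theorem gMat_o_map (γ : P.I) (ℓ : Module.Dual ℂ (QGamma C)) :
    (C.gMat (P.o γ)).map ℓ = Matrix.of fun m n => ℓ (QGamma.g C γ m n) := by
  ext i j
  exact congrArg ℓ (QGamma.gObj_o C γ i j)

theorem kronecker_gMat_map (hq : q ≠ 0) (hq2 : q ^ 2 ≠ 1) (a b : P.Obj)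
    (ℓ : Module.Dual ℂ (QGamma C)) : (C.gMat a ⊗ₖ C.gMat b).map ℓ =
      ∑ γ ∈ P.fusion a b, C.φ a b γ * (C.gMat (P.o γ)).map ℓ * C.ψ a b γ := by
  ext ⟨i, k⟩ ⟨j, l⟩
  rw [Matrix.sum_apply]
  change ℓ (QGamma.gObj C a i j * QGamma.gObj C b k l) = _
  rw [QGamma.gObj_mul_gObj C hq hq2, map_sum]
  refine Finset.sum_congr rfl fun γ _ => ?_
  simp only [gMat_o_map, map_sum, map_smul, smul_eq_mul, Matrix.mul_apply, Matrix.of_apply,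
    Finset.sum_mul]
  rw [Finset.sum_comm]
  exact Finset.sum_congr rfl fun _ _ => Finset.sum_congr rfl fun _ _ => by ring

theorem sum_φ_ψ_mul_φ {M : Type*} (a b : P.Obj) (γ : P.I)
    (X : ∀ δ, Matrix M (Fin (P.d δ)) ℂ) (h : γ ∈ P.fusion a b) :
    (∑ δ ∈ P.fusion a b, X δ * C.ψ a b δ) * C.φ a b γ = X γ := by
  rw [Matrix.sum_mul, Finset.sum_eq_single_of_mem γ h]
  · rw [Matrix.mul_assoc, C.ψ_mul_φ _ _ _ (QGamma.mem_fusion.mp h), Matrix.mul_one]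
  · intro δ _ hδ
    rw [Matrix.mul_assoc, C.ψ_mul_φ_of_ne _ _ hδ, Matrix.mul_zero]

theorem ψ_mul_sum_φ_ψ {M : Type*} (a b : P.Obj) (γ : P.I)
    (X : ∀ δ, Matrix (Fin (P.d δ)) M ℂ) (h : γ ∈ P.fusion a b) :
    C.ψ a b γ * (∑ δ ∈ P.fusion a b, C.φ a b δ * X δ) = X γ := by
  rw [Matrix.mul_sum, Finset.sum_eq_single_of_mem γ h]
  · rw [← Matrix.mul_assoc, C.ψ_mul_φ _ _ _ (QGamma.mem_fusion.mp h), Matrix.one_mul]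
  · intro δ _ hδ
    rw [← Matrix.mul_assoc, C.ψ_mul_φ_of_ne _ _ hδ.symm, Matrix.zero_mul]

/-- Multiplying g^a ⊗ g^b = ∑ φ_δ g^δ ψ^δ by φ_γ on the right leaves only the term φ_γ g^γ, by
orthogonality. -/
theorem cov_φ (hq : q ≠ 0) (hq2 : q ^ 2 ≠ 1) (a b : P.Obj) (γ : P.I) :
    Cov (C.gMat (P.o γ)) (C.gMat a ⊗ₖ C.gMat b) (C.φ a b γ) := by
  by_cases h : P.Occurs a b γ
  · intro ℓ
    rw [kronecker_gMat_map hq hq2, sum_φ_ψ_mul_φ a b γ (fun δ => C.φ a b δ * _)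
      (QGamma.mem_fusion.mpr h)]
  · rw [C.φ_eq_zero a b γ h]
    exact Cov.zero

theorem cov_ψ (hq : q ≠ 0) (hq2 : q ^ 2 ≠ 1) (a b : P.Obj) (γ : P.I) :
    Cov (C.gMat a ⊗ₖ C.gMat b) (C.gMat (P.o γ)) (C.ψ a b γ) := by
  by_cases h : P.Occurs a b γ
  · intro ℓ
    simp only [kronecker_gMat_map hq hq2, Matrix.mul_assoc]
    rw [ψ_mul_sum_φ_ψ a b γ _ (QGamma.mem_fusion.mpr h)]
  · rw [C.ψ_eq_zero a b γ h]
    exact Cov.zero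

section Associator

variable (a b c : P.Obj)

/-- The 6j symbols enter only as scalars in front of composites of φ and ψ. Γ is not associative,
and this intertwining of the two bracketings replaces associativity. -/
theorem cov_Θ (hq : q ≠ 0) (hq2 : q ^ 2 ≠ 1) : Cov ((C.gMat a ⊗ₖ C.gMat b) ⊗ₖ C.gMat c)
    (C.gMat a ⊗ₖ (C.gMat b ⊗ₖ C.gMat c)) (C.Θ a b c) :=
  Cov.sum _ fun μ _ => Cov.sum _ fun δ _ => Cov.sum _ fun ν _ => Cov.smul _ <|
    ((Cov.one.kronecker (cov_φ hq hq2 b c δ)).mul (cov_φ hq hq2 a (P.o δ) ν)).mul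
      ((cov_ψ hq hq2 (P.o μ) c ν).mul ((cov_ψ hq hq2 a b μ).kronecker Cov.one))

theorem cov_projL (hq : q ≠ 0) (hq2 : q ^ 2 ≠ 1) : Cov ((C.gMat a ⊗ₖ C.gMat b) ⊗ₖ C.gMat c)
    ((C.gMat a ⊗ₖ C.gMat b) ⊗ₖ C.gMat c) (C.projL a b c) :=
  Cov.sum _ fun μ _ => Cov.sum _ fun ν _ =>
    (((cov_φ hq hq2 a b μ).kronecker Cov.one).mul (cov_φ hq hq2 (P.o μ) c ν)).mul
      ((cov_ψ hq hq2 (P.o μ) c ν).mul ((cov_ψ hq hq2 a b μ).kronecker Cov.one))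

theorem cov_projR (hq : q ≠ 0) (hq2 : q ^ 2 ≠ 1) : Cov (C.gMat a ⊗ₖ (C.gMat b ⊗ₖ C.gMat c))
    (C.gMat a ⊗ₖ (C.gMat b ⊗ₖ C.gMat c)) (C.projR a b c) :=
  Cov.sum _ fun δ _ => Cov.sum _ fun ν _ =>
    ((Cov.one.kronecker (cov_φ hq hq2 b c δ)).mul (cov_φ hq hq2 a (P.o δ) ν)).mul
      ((cov_ψ hq hq2 a (P.o δ) ν).mul (Cov.one.kronecker (cov_ψ hq hq2 b c δ)))

theorem cov_Θinv (hq : q ≠ 0) (hq2 : q ^ 2 ≠ 1) : Cov (C.gMat a ⊗ₖ (C.gMat b ⊗ₖ C.gMat c))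
    ((C.gMat a ⊗ₖ C.gMat b) ⊗ₖ C.gMat c) (C.Θinv a b c) :=
  (cov_Θ a b c hq hq2).quasiInverse (cov_projL a b c hq hq2) (cov_projR a b c hq hq2)

end Associator

/-- The iterated inclusions and projections of a word are covariant by induction. Stating this for
an arbitrary submonoid lets the argument be nested, once per word, in associators of three words. -/
theorem sumComponents_mem (hq : q ≠ 0) (hq2 : q ^ 2 ≠ 1) {M : Type} [AddCommMonoid M]
    (S : AddSubmonoid M) : ∀ (T : PTree P.Obj)
      (f : ∀ a : P.Obj, Matrix T.Idx (P.Ix a) ℂ → Matrix (P.Ix a) T.Idx ℂ → M),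
      (∀ a e p, Cov (C.gMat a) (C.gTree T) e → Cov (C.gTree T) (C.gMat a) p → f a e p ∈ S) →
      C.sumComponents T f ∈ S
  | .leaf a, f, hf => hf a _ _ (Cov.one (m := P.Ix a)) (Cov.one (m := P.Ix a))
  | .node s t, f, hf => by
    refine sumComponents_mem hq hq2 S s _ fun a e p he hp =>
      sumComponents_mem hq hq2 S t _ fun b e' p' he' hp' => S.sum_mem fun γ _ => hf _ _ _ ?_ ?_
    · exact (he.kronecker he').mul (cov_φ hq hq2 a b γ)
    · exact (cov_ψ hq hq2 a b γ).mul (hp.kronecker hp')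

theorem cov_proj (hq : q ≠ 0) (hq2 : q ^ 2 ≠ 1) (T : PTree P.Obj) :
    Cov (C.gTree T) (C.gTree T) (C.proj T) :=
  sumComponents_mem hq hq2 (Cov.submonoid _ _) T _ fun _ _ _ he hp => he.mul hp

theorem cov_Θtree (hq : q ≠ 0) (hq2 : q ^ 2 ≠ 1) (r s t : PTree P.Obj) :
    Cov (C.gTree (.node (.node r s) t)) (C.gTree (.node r (.node s t))) (C.Θtree r s t) :=
  sumComponents_mem hq hq2 (Cov.submonoid _ _) r _ fun a _ _ he hp =>
    sumComponents_mem hq hq2 (Cov.submonoid _ _) s _ fun b _ _ he' hp' =>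
      sumComponents_mem hq hq2 (Cov.submonoid _ _) t _ fun c _ _ he'' hp'' =>
        ((he.kronecker (he'.kronecker he'')).mul (cov_Θ a b c hq hq2)).mul
          ((hp.kronecker hp').kronecker hp'')

theorem cov_Θinvtree (hq : q ≠ 0) (hq2 : q ^ 2 ≠ 1) (r s t : PTree P.Obj) :
    Cov (C.gTree (.node r (.node s t))) (C.gTree (.node (.node r s) t)) (C.Θinvtree r s t) :=
  sumComponents_mem hq hq2 (Cov.submonoid _ _) r _ fun a _ _ he hp =>
    sumComponents_mem hq hq2 (Cov.submonoid _ _) s _ fun b _ _ he' hp' =>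
      sumComponents_mem hq hq2 (Cov.submonoid _ _) t _ fun c _ _ he'' hp'' =>
        (((he.kronecker he').kronecker he'').mul (cov_Θinv a b c hq hq2)).mul
          (hp.kronecker (hp'.kronecker hp''))

theorem cov_reparenthesise (hq : q ≠ 0) (hq2 : q ^ 2 ≠ 1) {V : Type} [Fintype V] [DecidableEq V]
    {T : TriangulatedSurface V} {M M' : Word P T} {Θ} (h : Reparenthesise C T M M' Θ) (x : V) :
    Cov (C.gTree (M.at_ x)) (C.gTree (M'.at_ x)) (Θ x) := by
  induction h with
  | refl M => exact cov_proj hq hq2 _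
  | assoc M N K => exact cov_Θtree hq hq2 _ _ _
  | assoc_inv M N K => exact cov_Θinvtree hq hq2 _ _ _
  | node M M' N N' Θ Θ' _ _ ih ih' =>
    exact ((cov_proj hq hq2 _).mul (ih.kronecker ih')).mul (cov_proj hq hq2 _)
  | trans M M' M'' Θ Θ' _ _ ih ih' => exact ih'.mul ih

variable (C)

/-- The pairing of `ᾱ` and `α` given by `A`. -/
def pairing (α : P.I) : Matrix Unit (P.Ix (P.bar α) × P.Ix (P.o α)) ℂ := fun _ x => C.A α x.1 x.2

/-- The invariant vector in `α ⊗ ᾱ` given by `B`. -/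
def copairing (α : P.I) : Matrix (P.Ix (P.o α) × P.Ix (P.bar α)) Unit ℂ := fun x _ => C.B α x.1 x.2

variable {C}

theorem gMat_zero (s : Bool) : C.gMat (P.zero, s) = fun _ _ => 1 :=
  funext fun i => funext fun j => QGamma.gObj_zero C s i j

/-- A is the matrix of ψ^0_{ᾱα}, and g^0 = 1: covariance of ψ becomes invariance of the form. -/
theorem cov_pairing (hq : q ≠ 0) (hq2 : q ^ 2 ≠ 1) (α : P.I) :
    Cov (C.gMat (P.bar α) ⊗ₖ C.gMat (P.o α)) (unitMatrix (QGamma C)) (C.pairing α) := by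
  refine Cov.of_sum_smul fun i k => ?_
  have := (cov_ψ (C := C) hq hq2 (P.bar α) (P.o α) P.zero).sum_smul P.ix0 k
  rw [gMat_zero] at this
  exact (this.trans (QGamma.sum_zero _)).trans
    (Fintype.sum_unique fun j => C.pairing α j k • unitMatrix (QGamma C) i j).symm

theorem cov_copairing (hq : q ≠ 0) (hq2 : q ^ 2 ≠ 1) (α : P.I) :
    Cov (unitMatrix (QGamma C)) (C.gMat (P.o α) ⊗ₖ C.gMat (P.bar α)) (C.copairing α) := by
  refine Cov.of_sum_smul fun i k => ?_
  have := (cov_φ (C := C) hq hq2 (P.o α) (P.bar α) P.zero).sum_smul i P.ix0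
  rw [gMat_zero] at this
  exact (Fintype.sum_unique _).trans ((QGamma.sum_zero _).symm.trans this)

end ClebschGordan

/-! ### Covariance of G and of the components of f. -/

namespace ClebschGordan

variable {q : ℂ} {P : PhysSystem q} (C : ClebschGordan P)

/-- `G^{αβ}` as a linear form on `(β̄ ᾱ)(α β)`. -/
noncomputable def formG (α β : P.I) : Matrix Unit
    ((P.Ix (P.bar β) × P.Ix (P.bar α)) × (P.Ix (P.o α) × P.Ix (P.o β))) ℂ :=
  fun _ x => C.G α β (x.1.2, x.1.1) x.2

variable {C}

theorem cov_formG (hq : q ≠ 0) (hq2 : q ^ 2 ≠ 1) (α β : P.I) :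
    Cov ((C.gMat (P.bar β) ⊗ₖ C.gMat (P.bar α)) ⊗ₖ (C.gMat (P.o α) ⊗ₖ C.gMat (P.o β)))
      (unitMatrix (QGamma C)) (C.formG α β) := by
  set Z : Matrix (P.Ix (P.bar β)) ((P.Ix (P.bar β) × P.Ix (P.bar α)) × P.Ix (P.o α)) ℂ :=
    contractSnd (C.pairing α) * C.Θ (P.bar β) (P.bar α) (P.o α) with hZ
  set E : Matrix Unit (((P.Ix (P.bar β) × P.Ix (P.bar α)) × P.Ix (P.o α)) × P.Ix (P.o β)) ℂ :=
    C.pairing β * (Z ⊗ₖ (1 : Matrix (P.Ix (P.o β)) (P.Ix (P.o β)) ℂ)) with hE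
  have h1 := (Cov.contract_right (V := C.gMat (P.bar β)) (cov_pairing hq hq2 α)).mul
    (cov_Θ (C := C) (P.bar β) (P.bar α) (P.o α) hq hq2)
  have h2 := (cov_pairing hq hq2 β).mul (h1.kronecker (Cov.one (U := C.gMat (P.o β))))
  have h3 := h2.mul (cov_Θinvtree (C := C) hq hq2 (dualWord α β) (.leaf (P.o α)) (.leaf (P.o β)))
  -- `h3` concerns the composite of the inverse associator, the associator and the contractions with
  -- A, first of ᾱ with α and then of β̄ with β. What remains is to recognise the defining index sum
  -- of G in it.
  refine Eq.subst (motive := fun X => Cov ((C.gMat (P.bar β) ⊗ₖ C.gMat (P.bar α)) ⊗ₖ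
    (C.gMat (P.o α) ⊗ₖ C.gMat (P.o β))) (unitMatrix (QGamma C)) X) (Eq.symm ?_) h3
  ext u ⟨⟨x2, x1⟩, y⟩
  have e2 : ∀ x, E u x = ∑ j, ∑ i, ∑ k, C.A β j x.2 * (C.A α i k *
        C.Θ (P.bar β) (P.bar α) (P.o α) (j, (i, k)) x.1) := by
    intro x
    rw [hE, Matrix.mul_apply, Fintype.sum_prod_type]
    refine Finset.sum_congr rfl fun j _ => ?_
    rw [Fintype.sum_eq_single x.2]
    · have e1 : Z j x.1 = ∑ i, ∑ k, C.A α i k * C.Θ (P.bar β) (P.bar α) (P.o α) (j, (i, k)) x.1 :=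
        (contractSnd_mul (C.pairing α) (C.Θ (P.bar β) (P.bar α) (P.o α)) j x.1).trans
          (Fintype.sum_prod_type _)
      change C.A β j x.2 * (Z j x.1 * (1 : Matrix (P.Ix (P.o β)) (P.Ix (P.o β)) ℂ) x.2 x.2) = _
      rw [Matrix.one_apply_eq, mul_one, e1]
      simp only [Finset.mul_sum]
    · intro l hl
      rw [kroneckerMap_apply, Matrix.one_apply_ne hl, mul_zero, mul_zero]
  change _ = ∑ x : ((P.Ix (P.bar β) × P.Ix (P.bar α)) × P.Ix (P.o α)) × P.Ix (P.o β),
    E u x * C.Θinvtree (dualWord α β) (.leaf (P.o α)) (.leaf (P.o β)) x _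
  simp only [e2, Fintype.sum_prod_type, Finset.sum_mul]
  change C.G α β (x1, x2) y = _
  unfold G
  refine Finset.sum_congr rfl fun j₁ _ => Finset.sum_congr rfl fun i₁ _ =>
    Finset.sum_congr rfl fun k₁ _ => Finset.sum_congr rfl fun l₁ _ =>
    Finset.sum_congr rfl fun j₂ _ => Finset.sum_congr rfl fun i₂ _ =>
    Finset.sum_congr rfl fun k₂ _ => ?_
  simp only [← mul_assoc]
  congr 2
  exact mul_comm _ _

variable (C)

/-- The linear form on `(β̄ ᾱ) γ` obtained from `G^{αβ}` and `φ_γ^{αβ}`. -/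
noncomputable def formGφ (α β γ : P.I) : Matrix Unit
    ((P.Ix (P.bar β) × P.Ix (P.bar α)) × P.Ix (P.o γ)) ℂ :=
  fun _ x => (C.G α β * C.φ (P.o α) (P.o β) γ) (x.1.2, x.1.1) x.2

/-- The component `β̄ ⊗ ᾱ → γ̄` of `f^{αβ}`. -/
noncomputable def fComponent (α β γ : P.I) :
    Matrix (P.Ix (P.bar γ)) (P.Ix (P.bar β) × P.Ix (P.bar α)) ℂ :=
  fun n x => ∑ j, ∑ i, ∑ k, ∑ k', ∑ m, (C.G α β * C.φ (P.o α) (P.o β) γ) (i, j) k *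
    C.Θinvtree (dualWord α β) (.leaf (P.o γ)) (.leaf (P.bar γ))
      ((((j, i), k), n) : (_ × _) × _) (x, (k', m)) * C.B γ k' m

variable {C}

theorem cov_formGφ (hq : q ≠ 0) (hq2 : q ^ 2 ≠ 1) (α β γ : P.I) :
    Cov ((C.gMat (P.bar β) ⊗ₖ C.gMat (P.bar α)) ⊗ₖ C.gMat (P.o γ))
      (unitMatrix (QGamma C)) (C.formGφ α β γ) := by
  have h := (cov_formG (C := C) hq hq2 α β).mul ((Cov.one (U := C.gMat (P.bar β) ⊗ₖ
    C.gMat (P.bar α))).kronecker (cov_φ (C := C) hq hq2 (P.o α) (P.o β) γ))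
  convert h using 1
  ext u ⟨x, k⟩
  rw [Matrix.mul_apply, Fintype.sum_prod_type, Fintype.sum_eq_single x]
  · simp only [kroneckerMap_apply, Matrix.one_apply_eq, one_mul]
    rfl
  · intro y hy
    simp only [kroneckerMap_apply, Matrix.one_apply_ne hy, zero_mul, mul_zero, Finset.sum_const_zero]

theorem cov_fComponent (hq : q ≠ 0) (hq2 : q ^ 2 ≠ 1) (α β γ : P.I) :
    Cov (C.gMat (P.bar β) ⊗ₖ C.gMat (P.bar α)) (C.gMat (P.bar γ)) (C.fComponent α β γ) := by
  -- The component is a duality transpose: create γ ⊗ γ̄ with B, rebracket, and contract (β̄ ᾱ) γ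
  -- with the invariant form, leaving γ̄.
  have h1 := (cov_Θinvtree (C := C) hq hq2 (dualWord α β) (.leaf (P.o γ))
    (.leaf (P.bar γ))).mul (Cov.insert_right (V := C.gMat (P.bar β) ⊗ₖ C.gMat (P.bar α))
      (cov_copairing (C := C) hq hq2 γ))
  have h2 := (Cov.contract_left (V := C.gMat (P.bar γ)) (cov_formGφ (C := C) hq hq2 α β γ)).mul h1
  refine Eq.subst (motive := fun X => Cov (C.gMat (P.bar β) ⊗ₖ C.gMat (P.bar α))
    (C.gMat (P.bar γ)) X) (Eq.symm ?_) h2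
  ext n x
  set W : Matrix ((((P.Ix (P.bar β) × P.Ix (P.bar α)) × P.Ix (P.o γ)) × P.Ix (P.bar γ)))
    ((P.Ix (P.bar β) × P.Ix (P.bar α)) × (P.Ix (P.o γ) × P.Ix (P.bar γ))) ℂ :=
    C.Θinvtree (dualWord α β) (.leaf (P.o γ)) (.leaf (P.bar γ)) with hW
  let J : Matrix ((P.Ix (P.bar β) × P.Ix (P.bar α)) × (P.Ix (P.o γ) × P.Ix (P.bar γ)))
    (P.Ix (P.bar β) × P.Ix (P.bar α)) ℂ := insertSnd (C.copairing γ)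
  have hJ : ∀ y, (W * J) y x = ∑ z, W y (x, z) * C.copairing γ z () := fun y =>
    mul_insertSnd (C.copairing γ) W x y
  refine Eq.trans ?_ (contractFst_mul (C.formGφ α β γ) (W * J) n x).symm
  simp only [hJ]
  simp only [Fintype.sum_prod_type, Finset.mul_sum]
  unfold fComponent
  refine Finset.sum_congr rfl fun j _ => Finset.sum_congr rfl fun i _ =>
    Finset.sum_congr rfl fun k _ => Finset.sum_congr rfl fun k' _ =>
    Finset.sum_congr rfl fun m _ => ?_
  rw [mul_assoc]
  rfl

/-- Each summand passes from transposed contragredient indices to physical ones through the index of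
γ. The two factors are covariant for different matrices, (g^γ̄)ᵀ and g^γ, which is why f is handled
by components. -/
theorem f_eq_sum (α β : P.I) : C.f α β = ∑ γ ∈ P.fusion (P.o α) (P.o β),
    ((C.fComponent α β γ).submatrix id Prod.swap)ᵀ * C.ψ (P.o α) (P.o β) γ := by
  ext x y
  rw [Matrix.sum_apply]
  unfold f
  refine Finset.sum_congr rfl fun γ _ => ?_
  simp only [Matrix.mul_apply, Matrix.transpose_apply, Matrix.submatrix_apply, fComponent,
    Finset.sum_mul, id, Prod.swap]
  rw [Finset.sum_congr rfl fun j _ => Finset.sum_congr rfl fun i _ => Finset.sum_comm,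
    Finset.sum_congr rfl fun j _ => Finset.sum_comm, Finset.sum_comm]
  refine Finset.sum_congr rfl fun n _ => Finset.sum_congr rfl fun j _ =>
    Finset.sum_congr rfl fun i _ => Finset.sum_congr rfl fun k _ =>
    Finset.sum_congr rfl fun k' _ => Finset.sum_congr rfl fun m _ => ?_
  rfl

end ClebschGordan

/-! ### Covariance of the components of the quasi-inverse of f. -/

namespace ClebschGordan

variable {q : ℂ} {P : PhysSystem q} {C : ClebschGordan P}

/-- The components `γ̄ → β̄ ⊗ ᾱ` of the quasi-inverse of `f^{αβ}` are covariant. -/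
theorem cov_finv (hq : q ≠ 0) (hq2 : q ^ 2 ≠ 1) (α β γ : P.I)
    (hγ : γ ∈ P.fusion (P.o α) (P.o β)) :
    Cov (C.gMat (P.bar γ)) (C.gMat (P.bar β) ⊗ₖ C.gMat (P.bar α))
      ((C.ψ (P.o α) (P.o β) γ * C.finv α β).submatrix id Prod.swap)ᵀ := by
  set π : Matrix (P.Ix (P.bar β) × P.Ix (P.bar α)) (P.Ix (P.bar β) × P.Ix (P.bar α)) ℂ :=
    ∑ γ ∈ P.fusion (P.bar β) (P.bar α), C.φ (P.bar β) (P.bar α) γ * C.ψ (P.bar β) (P.bar α) γ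
    with hπ
  have cπ : Cov (C.gMat (P.bar β) ⊗ₖ C.gMat (P.bar α)) (C.gMat (P.bar β) ⊗ₖ C.gMat (P.bar α)) π :=
    Cov.sum _ fun γ _ => (cov_φ hq hq2 _ _ γ).mul (cov_ψ hq hq2 _ _ γ)
  set p : Matrix (Fin (P.d α) × Fin (P.d β)) (Fin (P.d α) × Fin (P.d β)) ℂ :=
    ∑ γ ∈ P.fusion (P.o α) (P.o β), C.φ (P.o α) (P.o β) γ * C.ψ (P.o α) (P.o β) γ with hp
  set p' : Matrix (Fin (P.d α) × Fin (P.d β)) (Fin (P.d α) × Fin (P.d β)) ℂ :=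
    (π.submatrix Prod.swap Prod.swap)ᵀ with hp'
  have hfinv : C.finv α β = quasiInverse p p' (C.f α β) := by
    unfold finv
    congr 1
    ext x y
    rw [hp', Matrix.transpose_apply, Matrix.submatrix_apply, hπ, Matrix.sum_apply]
    rfl
  rw [hfinv]
  unfold quasiInverse
  split_ifs with hex
  swap
  · rw [Matrix.mul_zero]
    exact Cov.zero
  obtain ⟨h1, h2, h3⟩ := hex.choose_spec
  set N := hex.choose
  let S : ∀ δ : P.I, Matrix (Fin (P.d α) × Fin (P.d β)) (Fin (P.d δ)) ℂ := fun δ =>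
    ((C.fComponent α β δ).submatrix id Prod.swap)ᵀ
  have hf : C.f α β = ∑ δ ∈ P.fusion (P.o α) (P.o β), S δ * C.ψ (P.o α) (P.o β) δ :=
    f_eq_sum α β
  -- Restricting N f = p to the component δ, by multiplying with φ_δ, shows what N does to each
  -- component of f.
  have hNS : ∀ δ ∈ P.fusion (P.o α) (P.o β), N * S δ = C.φ (P.o α) (P.o β) δ := by
    intro δ hδ
    have e1 := sum_φ_ψ_mul_φ (C := C) (P.o α) (P.o β) δ S hδ
    have e2 := sum_φ_ψ_mul_φ (C := C) (P.o α) (P.o β) δ (C.φ (P.o α) (P.o β)) hδ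
    rw [← hf] at e1
    rw [← e1, ← Matrix.mul_assoc, h1, hp, e2]
  intro ℓ
  set U := (C.gMat (P.bar β) ⊗ₖ C.gMat (P.bar α)).map ℓ with hU
  set W : Matrix (Fin (P.d α) × Fin (P.d β)) (Fin (P.d α) × Fin (P.d β)) ℂ :=
    (U.submatrix Prod.swap Prod.swap)ᵀ with hW
  have hWp : p' * W = W * p' := by
    rw [hp', hW, ← Matrix.transpose_mul, ← Matrix.transpose_mul]
    have := congrArg (fun X => (X.submatrix Prod.swap Prod.swap)ᵀ) (cπ ℓ)
    rw [← hU] at this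
    rw [← Matrix.submatrix_mul_equiv _ _ _ (Equiv.prodComm (Fin (P.d α)) (Fin (P.d β))) _,
      ← Matrix.submatrix_mul_equiv _ _ _ (Equiv.prodComm (Fin (P.d α)) (Fin (P.d β))) _] at this
    exact this.symm
  have hWS : ∀ δ, W * S δ = S δ * ((C.gMat (P.bar δ)).map ℓ)ᵀ := by
    intro δ
    have := congrArg (fun X => (X.submatrix id Prod.swap)ᵀ)
      (cov_fComponent (C := C) hq hq2 α β δ ℓ)
    rw [← hU] at this
    rw [← Matrix.submatrix_mul_equiv _ _ _ (Equiv.prodComm (Fin (P.d α)) (Fin (P.d β))) _,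
      ← Matrix.submatrix_mul_equiv _ _ _ (Equiv.refl _) _] at this
    rw [hW]
    change _ * ((C.fComponent α β δ).submatrix id Prod.swap)ᵀ =
      ((C.fComponent α β δ).submatrix id Prod.swap)ᵀ * _
    rw [← Matrix.transpose_mul, ← Matrix.transpose_mul]
    exact this
  set Q := C.ψ (P.o α) (P.o β) γ * N with hQ
  -- Insert p' = f N behind W and expand f. W crosses each S_δ by covariance, N S_δ becomes φ_δ, and
  -- ψ^γ selects δ = γ.
  have key : Q * W = ((C.gMat (P.bar γ)).map ℓ)ᵀ * Q := by
    have e : W * p' = ∑ δ ∈ P.fusion (P.o α) (P.o β),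
        S δ * (((C.gMat (P.bar δ)).map ℓ)ᵀ * (C.ψ (P.o α) (P.o β) δ * N)) := by
      rw [← h2, hf, Matrix.sum_mul, Matrix.mul_sum]
      refine Finset.sum_congr rfl fun δ _ => ?_
      rw [Matrix.mul_assoc, ← Matrix.mul_assoc, hWS, Matrix.mul_assoc]
    calc Q * W = Q * (W * p') := by
          rw [← hWp, hQ, ← Matrix.mul_assoc, Matrix.mul_assoc _ N p', h3]
      _ = C.ψ (P.o α) (P.o β) γ * ∑ δ ∈ P.fusion (P.o α) (P.o β), C.φ (P.o α) (P.o β) δ *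
          (((C.gMat (P.bar δ)).map ℓ)ᵀ * (C.ψ (P.o α) (P.o β) δ * N)) := by
        rw [e, hQ, Matrix.mul_assoc, Matrix.mul_sum]
        congr 1
        refine Finset.sum_congr rfl fun δ hδ => ?_
        rw [← Matrix.mul_assoc, hNS δ hδ]
      _ = _ := ψ_mul_sum_φ_ψ (P.o α) (P.o β) γ _ hγ
  have h4 := congrArg (fun X => (X.submatrix id Prod.swap)ᵀ) key
  have e5 : ((Q * W).submatrix id Prod.swap)ᵀ = U * (Q.submatrix id Prod.swap)ᵀ := by
    rw [← Matrix.submatrix_mul_equiv Q W id (Equiv.prodComm (Fin (P.d β)) (Fin (P.d α))) Prod.swap,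
      Matrix.transpose_mul]
    rfl
  have e6 : ((((C.gMat (P.bar γ)).map ℓ)ᵀ * Q).submatrix id Prod.swap)ᵀ =
      (Q.submatrix id Prod.swap)ᵀ * (C.gMat (P.bar γ)).map ℓ := by
    rw [← Matrix.submatrix_mul_equiv _ Q id (Equiv.refl _) Prod.swap, Matrix.transpose_mul]
    rfl
  exact e6.symm.trans (h4.symm.trans e5)

end ClebschGordan

/-! ### The factors Γ_x of Γ̂ and the quotient map onto Λ. -/

namespace GaugeSymmetry

variable {q : ℂ} {P : PhysSystem q} (C : ClebschGordan P) {V : Type} [Fintype V] [DecidableEq V]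

theorem single_eq_update (x : V) (a : QGamma C) :
    single C x a = PiTensorProduct.tprod ℂ (Function.update (fun _ : V => (1 : QGamma C)) x a) := by
  unfold single
  congr 1
  ext z
  by_cases h : z = x
  · subst h; simp
  · simp [h]

/-- The embedding of `Γ` as the factor `Γ_x`, as a linear map. -/
noncomputable def singleLin (x : V) : QGamma C →ₗ[ℂ] GaugeSymmetry C V where
  toFun := single C x
  map_add' a b := by simp only [single_eq_update, MultilinearMap.map_update_add]
  map_smul' s a := by simp only [single_eq_update, MultilinearMap.map_update_smul, RingHom.id_apply]

theorem single_one (x : V) : single C x 1 = 1 := by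
  simp [single, PiTensorProduct.one_def]
  rfl

theorem single_mul_single (x y : V) (a b : QGamma C) : single C x a * single C y b =
    PiTensorProduct.tprod ℂ fun z => (if z = x then a else 1) * (if z = y then b else 1) :=
  PiTensorProduct.tprod_mul_tprod _ _

end GaugeSymmetry

namespace GaugeFields

variable {q : ℂ} {P : PhysSystem q} (C : ClebschGordan P) {V : Type} [Fintype V] [DecidableEq V]
  {T : TriangulatedSurface V} (c : Ciliation T) (r : P.Obj → P.Obj → P.I → ℂ)

/-- The quotient map as a linear map. -/
noncomputable def mkLin : FreeFields P T →ₗ[ℂ] GaugeFields C T c r where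
  toFun := mk C c r
  map_add' _ _ := rfl
  map_smul' _ _ := rfl

theorem mk_smul (s : ℂ) (a : FreeFields P T) : mk C c r (s • a) = s • mk C c r a := rfl

theorem mk_sum {ι : Type*} (s : Finset ι) (f : ι → FreeFields P T) :
    mk C c r (∑ i ∈ s, f i) = ∑ i ∈ s, mk C c r (f i) :=
  map_sum (mkLin C c r) f s

theorem mk_rel {a b : FreeFields P T} (h : FieldRel C T c r a b) : mk C c r a = mk C c r b :=
  (RingCon.eq _).mpr (RingConGen.Rel.of _ _ h)

theorem mk_surjective : Function.Surjective (mk C c r : FreeFields P T → _) :=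
  Quotient.mk_surjective

theorem sum_tmul_mul_sum_tmul {ι κ : Type*} [Fintype ι] [Fintype κ] (a : ι → GaugeFields C T c r)
    (x : ι → GaugeSymmetry C V) (b : κ → GaugeFields C T c r) (y : κ → GaugeSymmetry C V) :
    (∑ i, a i ⊗ₜ[ℂ] x i) * (∑ j, b j ⊗ₜ[ℂ] y j) =
      ∑ i, ∑ j, (a i * b j) ⊗ₜ[ℂ] (x i * y j) := by
  refine (Finset.sum_mul_sum (R := GaugeFields C T c r ⊗[ℂ] GaugeSymmetry C V) _ _ _ _).trans ?_
  exact Finset.sum_congr rfl fun i _ => Finset.sum_congr rfl fun j _ =>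
    Algebra.TensorProduct.tmul_mul_tmul _ _ _ _

end GaugeFields

/-! ### The coaction on monomials, and quasi-associativity. -/

section Coaction

variable {q : ℂ} {P : PhysSystem q} (C : ClebschGordan P) {V : Type} [Fintype V] [DecidableEq V]
  {T : TriangulatedSurface V} (c : Ciliation T) (r : P.Obj → P.Obj → P.I → ℂ)

theorem TriangulatedSurface.Link.ne (l : T.Link) : l.1.1 ≠ l.1.2 := by
  obtain ⟨w, hw⟩ := l.2
  exact (T.ne _ _ _ hw).symm

theorem TriangulatedSurface.incidence_target (l : T.Link) : T.incidence l.1.1 l = .target :=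
  if_pos rfl

theorem TriangulatedSurface.incidence_source (l : T.Link) : T.incidence l.1.2 l = .source := by
  rw [incidence, if_neg l.ne.symm, if_pos rfl]

theorem freeCoaction_single (w : WithOne (FreeMagma (FieldGen P T))) :
    freeCoaction C c r (MonoidAlgebra.single w 1) =
      WithOne.lift (FreeMagma.lift fun x : FieldGen P T =>
        gaugeTransform C c r x.1 x.2.1 x.2.2.1 x.2.2.2) w :=
  DFunLike.congr_fun ((MonoidAlgebra.liftMagma ℂ).symm_apply_apply
    (WithOne.lift (FreeMagma.lift fun x : FieldGen P T =>
      gaugeTransform C c r x.1 x.2.1 x.2.2.1 x.2.2.2)).toMulHom) w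

theorem freeCoaction_uFree (l : T.Link) (α : P.I) (i j : Fin (P.d α)) :
    freeCoaction C c r (uFree P T l α i j) = gaugeTransform C c r l α i j :=
  freeCoaction_single C c r _

theorem freeCoaction_one : freeCoaction C c r (1 : FreeFields P T) = 1 :=
  freeCoaction_single C c r 1

/-- The end point of a link carries its row index, the departure point its column index, and any
other vertex the unique index of the trivial representation. This is what lets sums over indices of
a monomial factor over the vertices. -/
theorem Word.indexAt_bijective (M : Word P T) :
    Function.Bijective fun (i : M.Idx) (x : V) => M.indexAt x i := by
  induction M with
  | leaf l =>
    have ht : ∀ (c : Incidence) (_ : c = .target) (g : P.Ix (c.obj l.2)),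
        ∃ i, ∀ j, c.index l.2 (i, j) = g := by
      rintro _ rfl g
      exact ⟨g, fun _ => rfl⟩
    have hs : ∀ (c : Incidence) (_ : c = .source) (g : P.Ix (c.obj l.2)),
        ∃ j, ∀ i, c.index l.2 (i, j) = g := by
      rintro _ rfl g
      exact ⟨g, fun _ => rfl⟩
    have hti : ∀ (c : Incidence) (_ : c = .target) (i j : Fin (P.d l.2) × Fin (P.d l.2)),
        c.index l.2 i = c.index l.2 j → i.1 = j.1 := by
      rintro _ rfl i j h
      exact h
    have hsi : ∀ (c : Incidence) (_ : c = .source) (i j : Fin (P.d l.2) × Fin (P.d l.2)),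
        c.index l.2 i = c.index l.2 j → i.2 = j.2 := by
      rintro _ rfl i j h
      exact h
    have ha : ∀ (c : Incidence) (_ : c = .away) (i : Fin (P.d l.2) × Fin (P.d l.2))
        (g : P.Ix (c.obj l.2)), c.index l.2 i = g := by
      rintro _ rfl i g
      exact (QGamma.eq_ix0 g).symm
    constructor
    · intro i j h
      exact Prod.ext (hti _ (T.incidence_target l.1) i j (congrFun h l.1.1.1))
        (hsi _ (T.incidence_source l.1) i j (congrFun h l.1.1.2))
    · intro f
      obtain ⟨i, hi⟩ := ht _ (T.incidence_target l.1) (f l.1.1.1)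
      obtain ⟨j, hj⟩ := hs _ (T.incidence_source l.1) (f l.1.1.2)
      refine ⟨(i, j), funext fun x => ?_⟩
      by_cases h1 : x = l.1.1.1
      · subst h1
        exact hi j
      by_cases h2 : x = l.1.1.2
      · subst h2
        exact hj i
      exact ha _ (by rw [TriangulatedSurface.incidence, if_neg h1, if_neg h2]) (i, j) (f x)
  | node s t ihs iht =>
    constructor
    · intro i j h
      refine Prod.ext (ihs.1 (funext fun x => ?_)) (iht.1 (funext fun x => ?_))
      · exact congrArg Prod.fst (congrFun h x)
      · exact congrArg Prod.snd (congrFun h x)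
    · intro f
      obtain ⟨i, hi⟩ := ihs.2 fun x => (f x).1
      obtain ⟨j, hj⟩ := iht.2 fun x => (f x).2
      exact ⟨(i, j), funext fun x => Prod.ext (congrFun hi x) (congrFun hj x)⟩

theorem Word.sum_indexAt {A : Type*} [AddCommMonoid A] (M : Word P T)
    (F : (∀ x : V, (M.at_ x).Idx) → A) :
    ∑ i : M.Idx, F (fun x => M.indexAt x i) = ∑ f, F f :=
  M.indexAt_bijective.sum_comp F

/-- The matrix coefficients by which `Γ̂` coacts on the monomials of a given form. -/
noncomputable def Word.coeff (M : Word P T) (i k : M.Idx) : GaugeSymmetry C V :=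
  PiTensorProduct.tprod ℂ fun x => C.gTree (M.at_ x) (M.indexAt x i) (M.indexAt x k)

theorem Word.coeff_leaf (l : T.Link) (α : P.I) (i k : Fin (P.d α) × Fin (P.d α)) :
    Word.coeff C (.leaf (l, α) : Word P T) i k =
      GaugeSymmetry.single C l.1.1 (QGamma.g C α i.1 k.1) *
        GaugeSymmetry.single C l.1.2 (QGamma.antipode C (QGamma.g C α k.2 i.2)) := by
  rw [GaugeSymmetry.single_mul_single]
  unfold Word.coeff
  congr 1
  funext x
  change QGamma.gObj C ((T.incidence x l).obj α) ((T.incidence x l).index α i)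
    ((T.incidence x l).index α k) = _
  by_cases h1 : x = l.1.1
  · subst h1
    rw [if_pos rfl, if_neg l.ne, mul_one, TriangulatedSurface.incidence_target]
    exact QGamma.gObj_o C α _ _
  by_cases h2 : x = l.1.2
  · subst h2
    rw [if_pos rfl, if_neg h1, one_mul, TriangulatedSurface.incidence_source]
    unfold QGamma.antipode QGamma.g
    rw [Module.Basis.constr_basis]
    rfl
  · rw [if_neg h1, if_neg h2, one_mul,
      show T.incidence x l = .away by rw [TriangulatedSurface.incidence, if_neg h1, if_neg h2]]
    exact QGamma.gObj_zero C false _ _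

theorem freeCoaction_monomial (M : Word P T) (i : M.Idx) :
    freeCoaction C c r (M.monomial i) =
      ∑ k : M.Idx, GaugeFields.mk C c r (M.monomial k) ⊗ₜ[ℂ] M.coeff C i k := by
  induction M with
  | leaf l =>
    obtain ⟨l, α⟩ := l
    refine (freeCoaction_uFree C c r l α i.1 i.2).trans ?_
    refine Eq.trans ?_ (Fintype.sum_prod_type (fun k : Fin (P.d α) × Fin (P.d α) =>
      GaugeFields.u C c r l α k.1 k.2 ⊗ₜ[ℂ] (Word.coeff C (.leaf (l, α) : Word P T) i k))).symm
    refine Finset.sum_congr rfl fun k _ => Finset.sum_congr rfl fun m _ => ?_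
    exact congrArg (GaugeFields.u C c r l α k m ⊗ₜ[ℂ] ·) (Word.coeff_leaf C l α i (k, m)).symm
  | node s t ihs iht =>
    refine (map_mul (freeCoaction C c r) (Word.monomial s i.1) (Word.monomial t i.2)).trans ?_
    rw [ihs, iht]
    refine (GaugeFields.sum_tmul_mul_sum_tmul C c r _ _ _ _).trans ?_
    refine Eq.trans ?_ (Fintype.sum_prod_type (fun k : Word.Idx s × Word.Idx t =>
      GaugeFields.mk C c r (Word.monomial s k.1 * Word.monomial t k.2) ⊗ₜ[ℂ]
        (Word.coeff C (.node s t : Word P T) i k))).symm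
    refine Finset.sum_congr rfl fun k _ => Finset.sum_congr rfl fun m _ => ?_
    congr 1
    exact PiTensorProduct.tprod_mul_tprod _ _

/-- By multilinearity of the pure tensor, both sides are tensors over the vertices, and the factors
at each x agree by covariance of Θ_x. -/
theorem Word.coeff_cov {M M' : Word P T} {Θ : ∀ x : V, Matrix (M'.at_ x).Idx (M.at_ x).Idx ℂ}
    (h : ∀ x, Cov (C.gTree (M.at_ x)) (C.gTree (M'.at_ x)) (Θ x)) (i : M'.Idx) (k : M.Idx) :
    ∑ j : M.Idx, (∏ x, Θ x (M'.indexAt x i) (M.indexAt x j)) • M.coeff C j k =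
      ∑ j : M'.Idx, (∏ x, Θ x (M'.indexAt x j) (M.indexAt x k)) • M'.coeff C i j := by
  have e1 := M.sum_indexAt (F := fun f => (∏ x, Θ x (M'.indexAt x i) (f x)) •
    PiTensorProduct.tprod ℂ fun x => C.gTree (M.at_ x) (f x) (M.indexAt x k))
  have e2 := M'.sum_indexAt (F := fun f => (∏ x, Θ x (f x) (M.indexAt x k)) •
    PiTensorProduct.tprod ℂ fun x => C.gTree (M'.at_ x) (M'.indexAt x i) (f x))
  refine e1.trans (Eq.trans ?_ e2.symm)
  simp only [← MultilinearMap.map_smul_univ]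
  rw [← MultilinearMap.map_sum (f := PiTensorProduct.tprod ℂ) (g := fun x j =>
      Θ x (M'.indexAt x i) j • C.gTree (M.at_ x) j (M.indexAt x k)),
    ← MultilinearMap.map_sum (f := PiTensorProduct.tprod ℂ) (g := fun x j =>
      Θ x j (M.indexAt x k) • C.gTree (M'.at_ x) (M'.indexAt x i) j)]
  congr 1
  funext x
  exact (h x).sum_smul _ _

theorem freeCoaction_quasi_assoc (hq : q ≠ 0) (hq2 : q ^ 2 ≠ 1) {M M' : Word P T}
    {Θ : ∀ x : V, Matrix (M'.at_ x).Idx (M.at_ x).Idx ℂ}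
    (h : Reparenthesise C T M M' Θ) (i : M'.Idx) :
    freeCoaction C c r
        (∑ j : M.Idx, (∏ x, Θ x (M'.indexAt x i) (M.indexAt x j)) • M.monomial j) =
      freeCoaction C c r (M'.monomial i) := by
  simp only [map_sum, map_smul, freeCoaction_monomial, Finset.smul_sum]
  rw [Finset.sum_comm]
  simp only [← TensorProduct.tmul_smul, ← TensorProduct.tmul_sum]
  simp only [Word.coeff_cov C (fun x => ClebschGordan.cov_reparenthesise hq hq2 h x),
    TensorProduct.tmul_sum, TensorProduct.tmul_smul]
  rw [Finset.sum_comm]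
  refine Finset.sum_congr rfl fun j _ => ?_
  -- The Θ_x now stand on the Λ side of the tensor product, where they rebracket the monomial by the
  -- relation itself.
  rw [← GaugeFields.mk_rel C c r (FieldRel.quasi_assoc M M' Θ h j), GaugeFields.mk_sum,
    TensorProduct.sum_tmul]
  simp only [GaugeFields.mk_smul, TensorProduct.smul_tmul']

end Coaction

/-! ### Products of elements supported at one or two vertices. -/

namespace GaugeSymmetry

variable {q : ℂ} {P : PhysSystem q} (C : ClebschGordan P) {V : Type} [Fintype V] [DecidableEq V]

theorem tprod_mul (f g : V → QGamma C) :
    (PiTensorProduct.tprod ℂ f * PiTensorProduct.tprod ℂ g : GaugeSymmetry C V) =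
      PiTensorProduct.tprod ℂ fun z => f z * g z :=
  PiTensorProduct.tprod_mul_tprod _ _

variable {x y z w : V}

/-- Pure tensors multiply factor by factor, and off their own vertex the elements contribute 1.
Rearrangement across distinct vertices is thus free, although Γ is neither associative nor
commutative. -/
theorem single_mul_single_mul (hxy : x ≠ y) (a a' b b' : QGamma C) :
    (single C x a * single C y b) * (single C x a' * single C y b') =
      single C x (a * a') * single C y (b * b') := by
  unfold single
  simp only [tprod_mul]
  congr 1
  funext v
  by_cases h : v = x
  · subst h; simp [hxy]
  · simp only [if_neg h, one_mul]
    split_ifs <;> simp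

theorem single_mul_single_mul_swap (hxy : x ≠ y) (a a' b b' : QGamma C) :
    (single C x a * single C y b) * (single C y b' * single C x a') =
      single C x (a * a') * single C y (b * b') := by
  unfold single
  simp only [tprod_mul]
  congr 1
  funext v
  by_cases h : v = x
  · subst h; simp [hxy]
  · simp only [if_neg h, one_mul, mul_one]
    split_ifs <;> simp

theorem single_mul_single_comm (hxy : x ≠ y) (a b : QGamma C) :
    single C x a * single C y b = single C y b * single C x a := by
  unfold single
  simp only [tprod_mul]
  congr 1
  funext v
  by_cases h : v = x
  · subst h; simp [hxy]
  · simp [h]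

theorem single_mul_single_mul_third (hyx : y ≠ x) (hyz : y ≠ z) (hxz : x ≠ z)
    (a a' b b' : QGamma C) :
    (single C y a * single C x b) * (single C y a' * single C z b') =
      single C y (a * a') * (single C x b * single C z b') := by
  unfold single
  simp only [tprod_mul]
  congr 1
  funext v
  by_cases h : v = y
  · subst h; simp [hyx, hyz]
  by_cases h' : v = x
  · subst h'; simp [hyx.symm, hxz]
  · simp only [if_neg h, if_neg h', one_mul]

theorem single_mul_single_disjoint (hxz : x ≠ z) (hxw : x ≠ w) (hyz : y ≠ z) (hyw : y ≠ w)
    (a b a' b' : QGamma C) :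
    (single C x a * single C y b) * (single C z a' * single C w b') =
      (single C z a' * single C w b') * (single C x a * single C y b) := by
  unfold single
  simp only [tprod_mul]
  refine congrArg (PiTensorProduct.tprod ℂ) ?_
  funext v
  by_cases h : v = x
  · subst h; simp [hxz, hxw]
  by_cases h' : v = y
  · subst h'; simp [hyz, hyw]
  · simp only [if_neg h, if_neg h', one_mul, mul_one]

end GaugeSymmetry

/-! ### Compatibility of the coaction with the other relations. -/

section Relations

variable {q : ℂ} {P : PhysSystem q} (C : ClebschGordan P) {V : Type} [Fintype V] [DecidableEq V]
  {T : TriangulatedSurface V} (c : Ciliation T) (r : P.Obj → P.Obj → P.I → ℂ)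

theorem gMat_o_apply (α : P.I) (i j : Fin (P.d α)) :
    C.gMat (P.o α) i j = QGamma.g C α i j := QGamma.gObj_o C α i j

theorem antipode_g (α : P.I) (i j : Fin (P.d α)) :
    QGamma.antipode C (QGamma.g C α i j) = C.gMat (P.bar α) j i := by
  unfold QGamma.antipode QGamma.g
  rw [Module.Basis.constr_basis]
  rfl

theorem freeCoaction_uFree_eq (l : T.Link) (α : P.I) (i j : Fin (P.d α)) :
    freeCoaction C c r (uFree P T l α i j) = ∑ k : Fin (P.d α) × Fin (P.d α),
      GaugeFields.u C c r l α k.1 k.2 ⊗ₜ[ℂ]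
        (GaugeSymmetry.single C l.1.1 (C.gMat (P.o α) i k.1) *
          GaugeSymmetry.single C l.1.2 (C.gMat (P.bar α) j k.2)) := by
  rw [freeCoaction_uFree, gaugeTransform, Fintype.sum_prod_type]
  simp only [antipode_g, gMat_o_apply]

/-- A linear relation between elements of a comodule is preserved by the coaction when the
matrix coefficients satisfy the same relation. -/
theorem sum_smul_tmul_exchange {A B m n : Type*} [AddCommGroup A] [Module ℂ A] [AddCommGroup B]
    [Module ℂ B] [Fintype m] [Fintype n] (X : Matrix n m ℂ) (w : m → A) (w' : n → A)
    (S : m → m → B) (S' : n → n → B)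
    (hS : ∀ i k, ∑ j, X i j • S j k = ∑ j, X j k • S' i j)
    (hw : ∀ i, ∑ j, X i j • w j = w' i) (i : n) :
    ∑ j, X i j • ∑ k, w k ⊗ₜ[ℂ] S j k = ∑ k, w' k ⊗ₜ[ℂ] S' i k := by
  calc _ = ∑ k, w k ⊗ₜ[ℂ] ∑ j, X i j • S j k := by
        simp only [Finset.smul_sum, TensorProduct.tmul_sum, TensorProduct.tmul_smul]
        exact Finset.sum_comm
    _ = ∑ k, (∑ j, X k j • w j) ⊗ₜ[ℂ] S' i k := by
        simp only [hS, TensorProduct.sum_tmul, TensorProduct.tmul_sum, TensorProduct.tmul_smul,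
          ← TensorProduct.smul_tmul']
        exact Finset.sum_comm
    _ = _ := by simp only [hw]

/-- The `R`-matrix followed by the exchange of the two factors. -/
noncomputable def ClebschGordan.braiding (a b : P.Obj) :
    Matrix (P.Ix b × P.Ix a) (P.Ix a × P.Ix b) ℂ :=
  fun x y => C.R r a b (x.2, x.1) y

/-- The numbers λ^{1/2} are scalars on each component, so covariance comes from that of φ^{ba}
ψ_{ab}. -/
theorem ClebschGordan.cov_braiding (hq : q ≠ 0) (hq2 : q ^ 2 ≠ 1) (a b : P.Obj) :
    Cov (C.gMat a ⊗ₖ C.gMat b) (C.gMat b ⊗ₖ C.gMat a) (C.braiding r a b) := by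
  have h : C.braiding r a b = ∑ γ ∈ P.fusion a b, r a b γ • (C.φ b a γ * C.ψ a b γ) := by
    ext x y
    rw [Matrix.sum_apply]
    rfl
  rw [h]
  exact Cov.sum _ fun γ _ => ((cov_φ hq hq2 b a γ).mul (cov_ψ hq hq2 a b γ)).smul _

theorem sum_prod_comm_four {M ι κ σ τ : Type*} [AddCommMonoid M] [Fintype ι] [Fintype κ]
    [Fintype σ] [Fintype τ] (F : ι → σ → κ → τ → M) :
    ∑ x : ι × σ, ∑ y : κ × τ, F x.1 x.2 y.1 y.2 =
      ∑ y : σ × τ, ∑ x : ι × κ, F x.1 y.1 x.2 y.2 := by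
  simp only [Fintype.sum_prod_type]
  rw [Finset.sum_comm]
  refine Finset.sum_congr rfl fun s _ => ?_
  rw [Finset.sum_congr rfl fun i _ => Finset.sum_comm]
  exact Finset.sum_comm

/-- Covariance of the exchange relations of two links with a common vertex `y`. -/
theorem braid_covariant (hq : q ≠ 0) (hq2 : q ^ 2 ≠ 1) {x y z : V} (hyx : y ≠ x) (hyz : y ≠ z)
    (hxz : x ≠ z) (a b a' b' : P.Obj) (u : P.Ix a → P.Ix a' → GaugeFields C T c r)
    (v : P.Ix b → P.Ix b' → GaugeFields C T c r)
    (h : ∀ p q s t, ∑ m, ∑ n, C.R r a b (p, q) (m, n) • (u m s * v n t) = v q t * u p s)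
    (p : P.Ix a) (q : P.Ix b) (s : P.Ix a') (t : P.Ix b') :
    ∑ m, ∑ n, C.R r a b (p, q) (m, n) •
      ((∑ k : P.Ix a × P.Ix a', u k.1 k.2 ⊗ₜ[ℂ]
          (GaugeSymmetry.single C y (C.gMat a m k.1) *
            GaugeSymmetry.single C x (C.gMat a' s k.2))) *
        (∑ k : P.Ix b × P.Ix b', v k.1 k.2 ⊗ₜ[ℂ]
          (GaugeSymmetry.single C y (C.gMat b n k.1) *
            GaugeSymmetry.single C z (C.gMat b' t k.2)))) =
      (∑ k : P.Ix b × P.Ix b', v k.1 k.2 ⊗ₜ[ℂ]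
          (GaugeSymmetry.single C y (C.gMat b q k.1) *
            GaugeSymmetry.single C z (C.gMat b' t k.2))) *
        (∑ k : P.Ix a × P.Ix a', u k.1 k.2 ⊗ₜ[ℂ]
          (GaugeSymmetry.single C y (C.gMat a p k.1) *
            GaugeSymmetry.single C x (C.gMat a' s k.2))) := by
  let W : P.Ix a' × P.Ix b' → P.Ix a × P.Ix b → GaugeFields C T c r :=
    fun σ k => u k.1 σ.1 * v k.2 σ.2
  let W' : P.Ix a' × P.Ix b' → P.Ix b × P.Ix a → GaugeFields C T c r :=
    fun σ k => v k.1 σ.2 * u k.2 σ.1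
  let Z : P.Ix a' × P.Ix b' → GaugeSymmetry C V := fun σ =>
    GaugeSymmetry.single C x (C.gMat a' s σ.1) * GaugeSymmetry.single C z (C.gMat b' t σ.2)
  -- The indices σ at the far ends x and z are spectators. With them fixed, the coefficient depends
  -- linearly on an element of Γ_y, and the exchange takes place there.
  let L : P.Ix a' × P.Ix b' → QGamma C →ₗ[ℂ] GaugeSymmetry C V := fun σ =>
    LinearMap.mulRight ℂ (Z σ) ∘ₗ GaugeSymmetry.singleLin C y
  have h1 : ∀ m n, (∑ k : P.Ix a × P.Ix a', u k.1 k.2 ⊗ₜ[ℂ]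
          (GaugeSymmetry.single C y (C.gMat a m k.1) *
            GaugeSymmetry.single C x (C.gMat a' s k.2))) *
        (∑ k : P.Ix b × P.Ix b', v k.1 k.2 ⊗ₜ[ℂ]
          (GaugeSymmetry.single C y (C.gMat b n k.1) *
            GaugeSymmetry.single C z (C.gMat b' t k.2))) =
      ∑ σ, ∑ k, W σ k ⊗ₜ[ℂ] L σ ((C.gMat a ⊗ₖ C.gMat b) (m, n) k) := by
    intro m n
    rw [GaugeFields.sum_tmul_mul_sum_tmul]
    simp only [GaugeSymmetry.single_mul_single_mul_third C hyx hyz hxz]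
    exact sum_prod_comm_four fun i s' k t' =>
      (u i s' * v k t') ⊗ₜ[ℂ] (GaugeSymmetry.single C y (C.gMat a m i * C.gMat b n k) *
        (GaugeSymmetry.single C x (C.gMat a' s s') * GaugeSymmetry.single C z (C.gMat b' t t')))
  have h2 : (∑ k : P.Ix b × P.Ix b', v k.1 k.2 ⊗ₜ[ℂ]
          (GaugeSymmetry.single C y (C.gMat b q k.1) *
            GaugeSymmetry.single C z (C.gMat b' t k.2))) *
        (∑ k : P.Ix a × P.Ix a', u k.1 k.2 ⊗ₜ[ℂ]
          (GaugeSymmetry.single C y (C.gMat a p k.1) *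
            GaugeSymmetry.single C x (C.gMat a' s k.2))) =
      ∑ σ, ∑ k, W' σ k ⊗ₜ[ℂ] L σ ((C.gMat b ⊗ₖ C.gMat a) (q, p) k) := by
    rw [GaugeFields.sum_tmul_mul_sum_tmul]
    simp only [GaugeSymmetry.single_mul_single_mul_third C hyz hyx hxz.symm,
      GaugeSymmetry.single_mul_single_comm C hxz.symm]
    refine (sum_prod_comm_four fun k t' i s' =>
      (v k t' * u i s') ⊗ₜ[ℂ] (GaugeSymmetry.single C y (C.gMat b q k * C.gMat a p i) *
        (GaugeSymmetry.single C x (C.gMat a' s s') *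
          GaugeSymmetry.single C z (C.gMat b' t t')))).trans ?_
    exact (Equiv.prodComm _ _).sum_comp fun σ =>
      ∑ k, W' σ k ⊗ₜ[ℂ] L σ ((C.gMat b ⊗ₖ C.gMat a) (q, p) k)
  rw [h2]
  simp only [h1]
  refine (Fintype.sum_prod_type (fun k : P.Ix a × P.Ix b => C.R r a b (p, q) k •
    ∑ σ, ∑ l, W σ l ⊗ₜ[ℂ] L σ ((C.gMat a ⊗ₖ C.gMat b) k l))).symm.trans ?_
  simp only [Finset.smul_sum]
  rw [Finset.sum_comm]
  refine Finset.sum_congr rfl fun σ _ => ?_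
  have h3 := sum_smul_tmul_exchange (C.braiding r a b) (W σ) (W' σ)
    (fun j k => L σ ((C.gMat a ⊗ₖ C.gMat b) j k)) (fun j k => L σ ((C.gMat b ⊗ₖ C.gMat a) j k))
    (fun i k => by
      simp only [← map_smul, ← map_sum, (C.cov_braiding r hq hq2 a b).sum_smul])
    (fun i => (Fintype.sum_prod_type _).trans (h i.2 i.1 σ.1 σ.2)) (q, p)
  simp only [Finset.smul_sum] at h3
  exact h3

theorem freeCoaction_target_target (hq : q ≠ 0) (hq2 : q ^ 2 ≠ 1) (x y z : V) (hx : T.IsLink y x)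
    (hz : T.IsLink y z) (hne : x ≠ z) (hlt : c.lt y x z) (α β : P.I) (i j : Fin (P.d α))
    (k l : Fin (P.d β)) :
    freeCoaction C c r (∑ m, ∑ n, C.R r (P.o α) (P.o β) (i, k) (m, n) •
        (uFree P T ⟨(y, x), hx⟩ α m j * uFree P T ⟨(y, z), hz⟩ β n l)) =
      freeCoaction C c r (uFree P T ⟨(y, z), hz⟩ β k l * uFree P T ⟨(y, x), hx⟩ α i j) := by
  simp only [map_sum, map_smul, map_mul, freeCoaction_uFree_eq]
  refine braid_covariant C c r hq hq2 (TriangulatedSurface.Link.ne (⟨(y, x), hx⟩ : T.Link))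
    (TriangulatedSurface.Link.ne (⟨(y, z), hz⟩ : T.Link)) hne (P.o α) (P.o β) (P.bar α) (P.bar β)
    (fun m j => GaugeFields.u C c r ⟨(y, x), hx⟩ α m j)
    (fun m j => GaugeFields.u C c r ⟨(y, z), hz⟩ β m j) (fun p q s t => ?_) i k j l
  have := GaugeFields.mk_rel C c r
    (FieldRel.target_target x y z hx hz hne hlt α β p s q t)
  simp only [GaugeFields.mk_sum, GaugeFields.mk_smul] at this
  exact this

/-- This puts the departure vertex first, so that one statement, `braid_covariant`, serves all three
exchange relations with u or its transpose. -/
theorem sum_tmul_single_swap {α : P.I} {x y : V} (hxy : x ≠ y)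
    (u : Fin (P.d α) → Fin (P.d α) → GaugeFields C T c r) (i j : Fin (P.d α)) :
    (∑ k : Fin (P.d α) × Fin (P.d α), u k.1 k.2 ⊗ₜ[ℂ]
        (GaugeSymmetry.single C x (C.gMat (P.o α) i k.1) *
          GaugeSymmetry.single C y (C.gMat (P.bar α) j k.2))) =
      ∑ k : Fin (P.d α) × Fin (P.d α), u k.2 k.1 ⊗ₜ[ℂ]
        (GaugeSymmetry.single C y (C.gMat (P.bar α) j k.1) *
          GaugeSymmetry.single C x (C.gMat (P.o α) i k.2)) := by
  refine ((Equiv.prodComm _ _).sum_comp fun k : Fin (P.d α) × Fin (P.d α) => u k.1 k.2 ⊗ₜ[ℂ]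
    (GaugeSymmetry.single C x (C.gMat (P.o α) i k.1) *
      GaugeSymmetry.single C y (C.gMat (P.bar α) j k.2))).symm.trans ?_
  refine Finset.sum_congr rfl fun k _ => ?_
  rw [GaugeSymmetry.single_mul_single_comm C hxy]
  rfl

theorem freeCoaction_source_target (hq : q ≠ 0) (hq2 : q ^ 2 ≠ 1) (x y z : V) (hx : T.IsLink x y)
    (hz : T.IsLink y z) (hne : x ≠ z) (hlt : c.lt y x z) (α β : P.I) (i j : Fin (P.d α))
    (k l : Fin (P.d β)) :
    freeCoaction C c r (∑ m, ∑ n, C.SidR r α β (m, k) (j, n) •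
        (uFree P T ⟨(x, y), hx⟩ α i m * uFree P T ⟨(y, z), hz⟩ β n l)) =
      freeCoaction C c r (uFree P T ⟨(y, z), hz⟩ β k l * uFree P T ⟨(x, y), hx⟩ α i j) := by
  have hxy : x ≠ y := TriangulatedSurface.Link.ne (⟨(x, y), hx⟩ : T.Link)
  simp only [map_sum, map_smul, map_mul, freeCoaction_uFree_eq,
    sum_tmul_single_swap C c r hxy (GaugeFields.u C c r ⟨(x, y), hx⟩ α)]
  -- The link xy meets y at its departure point, hence is attached there through ᾱ. The relation
  -- involves (S ⊗ id)(R), which is R on ᾱ ⊗ β up to transposition.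
  refine braid_covariant C c r hq hq2 hxy.symm
    (TriangulatedSurface.Link.ne (⟨(y, z), hz⟩ : T.Link)) hne (P.bar α) (P.o β) (P.o α) (P.bar β)
    (fun m j => GaugeFields.u C c r ⟨(x, y), hx⟩ α j m)
    (fun m j => GaugeFields.u C c r ⟨(y, z), hz⟩ β m j) (fun p q s t => ?_) j k i l
  have := GaugeFields.mk_rel C c r
    (FieldRel.source_target x y z hx hz hne hlt α β s p q t)
  simp only [GaugeFields.mk_sum, GaugeFields.mk_smul] at this
  exact this

theorem freeCoaction_source_source (hq : q ≠ 0) (hq2 : q ^ 2 ≠ 1) (x y z : V) (hx : T.IsLink x y)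
    (hz : T.IsLink z y) (hne : x ≠ z) (hlt : c.lt y x z) (α β : P.I) (i j : Fin (P.d α))
    (k l : Fin (P.d β)) :
    freeCoaction C c r (∑ m, ∑ n, C.SSR r α β (m, n) (j, l) •
        (uFree P T ⟨(x, y), hx⟩ α i m * uFree P T ⟨(z, y), hz⟩ β k n)) =
      freeCoaction C c r (uFree P T ⟨(z, y), hz⟩ β k l * uFree P T ⟨(x, y), hx⟩ α i j) := by
  have hxy : x ≠ y := TriangulatedSurface.Link.ne (⟨(x, y), hx⟩ : T.Link)
  have hzy : z ≠ y := TriangulatedSurface.Link.ne (⟨(z, y), hz⟩ : T.Link)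
  simp only [map_sum, map_smul, map_mul, freeCoaction_uFree_eq,
    sum_tmul_single_swap C c r hxy (GaugeFields.u C c r ⟨(x, y), hx⟩ α),
    sum_tmul_single_swap C c r hzy (GaugeFields.u C c r ⟨(z, y), hz⟩ β)]
  refine braid_covariant C c r hq hq2 hxy.symm hzy.symm hne (P.bar α) (P.bar β) (P.o α) (P.o β)
    (fun m j => GaugeFields.u C c r ⟨(x, y), hx⟩ α j m)
    (fun m j => GaugeFields.u C c r ⟨(z, y), hz⟩ β j m) (fun p q s t => ?_) j l i k
  have := GaugeFields.mk_rel C c r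
    (FieldRel.source_source x y z hx hz hne hlt α β s p t q)
  simp only [GaugeFields.mk_sum, GaugeFields.mk_smul] at this
  exact this

theorem freeCoaction_disjoint (x y z w : V) (h : T.IsLink x y) (h' : T.IsLink z w) (hxz : x ≠ z)
    (hxw : x ≠ w) (hyz : y ≠ z) (hyw : y ≠ w) (α β : P.I) (i j : Fin (P.d α))
    (k l : Fin (P.d β)) :
    freeCoaction C c r (uFree P T ⟨(x, y), h⟩ α i j * uFree P T ⟨(z, w), h'⟩ β k l) =
      freeCoaction C c r (uFree P T ⟨(z, w), h'⟩ β k l * uFree P T ⟨(x, y), h⟩ α i j) := by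
  simp only [map_mul, freeCoaction_uFree_eq, GaugeFields.sum_tmul_mul_sum_tmul]
  rw [Finset.sum_comm]
  refine Finset.sum_congr rfl fun m _ => Finset.sum_congr rfl fun n _ => ?_
  rw [GaugeSymmetry.single_mul_single_disjoint C hxz hxw hyz hyw]
  congr 1
  exact GaugeFields.mk_rel C c r
    (FieldRel.disjoint x y z w h h' hxz hxw hyz hyw α β n.1 n.2 m.1 m.2)

theorem freeCoaction_unit (a : T.Link) (i j : Fin (P.d P.zero)) :
    freeCoaction C c r (uFree P T a P.zero i j) = freeCoaction C c r (1 : FreeFields P T) := by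
  rw [freeCoaction_uFree_eq, freeCoaction_one, Fintype.sum_prod_type]
  rw [QGamma.sum_zero, QGamma.sum_zero]
  have h : GaugeFields.u C c r a P.zero P.ix0 P.ix0 = 1 :=
    GaugeFields.mk_rel C c r (FieldRel.unit a P.ix0 P.ix0)
  rw [h, ClebschGordan.gMat_zero, ClebschGordan.gMat_zero, GaugeSymmetry.single_one,
    GaugeSymmetry.single_one, mul_one]
  rfl

theorem freeCoaction_inverse (hq : q ≠ 0) (hq2 : q ^ 2 ≠ 1) (x y : V) (h : T.IsLink x y)
    (h' : T.IsLink y x) (α : P.I) (i j : Fin (P.d α)) :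
    freeCoaction C c r (∑ m, ∑ n, C.A α m n •
        (uFree P T ⟨(x, y), h⟩ α i m * uFree P T ⟨(y, x), h'⟩ α n j)) =
      freeCoaction C c r (C.B α i j • (1 : FreeFields P T)) := by
  have hxy : x ≠ y := TriangulatedSurface.Link.ne (⟨(x, y), h⟩ : T.Link)
  simp only [map_sum, map_smul, map_mul, freeCoaction_uFree_eq, freeCoaction_one,
    GaugeFields.sum_tmul_mul_sum_tmul, GaugeSymmetry.single_mul_single_mul_swap C hxy]
  let u := GaugeFields.u C c r ⟨(x, y), h⟩ α
  let v := GaugeFields.u C c r ⟨(y, x), h'⟩ α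
  -- The factor at x is kept aside while A contracts the factor g^ᾱ g^α at y to 1.
  let S : Fin (P.d α) × Fin (P.d α) → GaugeSymmetry C V := fun σ =>
    GaugeSymmetry.single C x (C.gMat (P.o α) i σ.1 * C.gMat (P.bar α) j σ.2)
  let L : Fin (P.d α) × Fin (P.d α) → QGamma C →ₗ[ℂ] GaugeSymmetry C V := fun σ =>
    LinearMap.mulLeft ℂ (S σ) ∘ₗ GaugeSymmetry.singleLin C y
  have h1 : ∀ m n, (∑ k : Fin (P.d α) × Fin (P.d α), ∑ l : Fin (P.d α) × Fin (P.d α),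
      (u k.1 k.2 * v l.1 l.2) ⊗ₜ[ℂ]
        (GaugeSymmetry.single C x (C.gMat (P.o α) i k.1 * C.gMat (P.bar α) j l.2) *
          GaugeSymmetry.single C y (C.gMat (P.bar α) m k.2 * C.gMat (P.o α) n l.1))) =
      ∑ σ, ∑ k : P.Ix (P.bar α) × P.Ix (P.o α), (u σ.1 k.1 * v k.2 σ.2) ⊗ₜ[ℂ]
        L σ ((C.gMat (P.bar α) ⊗ₖ C.gMat (P.o α)) (m, n) k) := by
    intro m n
    have e := (Equiv.prodComm _ _).sum_comp fun k : Fin (P.d α) × Fin (P.d α) =>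
      ∑ l : Fin (P.d α) × Fin (P.d α), (u k.1 k.2 * v l.1 l.2) ⊗ₜ[ℂ]
        (GaugeSymmetry.single C x (C.gMat (P.o α) i k.1 * C.gMat (P.bar α) j l.2) *
          GaugeSymmetry.single C y (C.gMat (P.bar α) m k.2 * C.gMat (P.o α) n l.1))
    refine e.symm.trans ?_
    exact sum_prod_comm_four fun k s l t => (u s k * v l t) ⊗ₜ[ℂ]
      (S (s, t) * GaugeSymmetry.single C y (C.gMat (P.bar α) m k * C.gMat (P.o α) n l))
  refine Eq.trans (Finset.sum_congr rfl fun m _ => Finset.sum_congr rfl fun n _ =>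
    congrArg (C.A α m n • ·) (h1 m n)) ?_
  refine (Fintype.sum_prod_type (fun k : P.Ix (P.bar α) × P.Ix (P.o α) => C.A α k.1 k.2 •
    ∑ σ, ∑ l : P.Ix (P.bar α) × P.Ix (P.o α), (u σ.1 l.1 * v l.2 σ.2) ⊗ₜ[ℂ]
        L σ ((C.gMat (P.bar α) ⊗ₖ C.gMat (P.o α)) k l))).symm.trans ?_
  simp only [Finset.smul_sum]
  rw [Finset.sum_comm]
  have h2 : ∀ σ : Fin (P.d α) × Fin (P.d α),
      (∑ k : P.Ix (P.bar α) × P.Ix (P.o α), ∑ l : P.Ix (P.bar α) × P.Ix (P.o α),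
        C.A α k.1 k.2 • (u σ.1 l.1 * v l.2 σ.2) ⊗ₜ[ℂ]
          L σ ((C.gMat (P.bar α) ⊗ₖ C.gMat (P.o α)) k l)) =
      (1 : GaugeFields C T c r) ⊗ₜ[ℂ] (C.B α σ.1 σ.2 • S σ) := by
    intro σ
    have e := sum_smul_tmul_exchange (C.pairing α)
      (fun l : P.Ix (P.bar α) × P.Ix (P.o α) => u σ.1 l.1 * v l.2 σ.2)
      (fun _ : Unit => C.B α σ.1 σ.2 • (1 : GaugeFields C T c r))
      (fun j k => L σ ((C.gMat (P.bar α) ⊗ₖ C.gMat (P.o α)) j k))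
      (fun j k => L σ (unitMatrix _ j k))
      (fun i k => by
        simp only [← map_smul, ← map_sum, (ClebschGordan.cov_pairing hq hq2 α).sum_smul])
      (fun _ => by
        have e' := GaugeFields.mk_rel C c r (FieldRel.inverse x y h h' α σ.1 σ.2)
        simp only [GaugeFields.mk_sum, GaugeFields.mk_smul] at e'
        exact (Fintype.sum_prod_type _).trans e') ()
    simp only [Finset.smul_sum] at e
    refine e.trans ?_
    rw [Fintype.sum_unique, TensorProduct.smul_tmul]
    congr 2
    exact (congrArg (S σ * ·) (GaugeSymmetry.single_one C y)).trans (mul_one _)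
  refine (Finset.sum_congr rfl fun σ _ => h2 σ).trans ?_
  rw [← TensorProduct.tmul_sum]
  have h3 := (ClebschGordan.cov_copairing (C := C) hq hq2 α).sum_smul (i, j) ()
  -- Once u(l) A u(-l) has been replaced by B, what remains at x is g^α g^ᾱ applied to the invariant
  -- vector B.
  have h4 : ∑ σ, C.B α σ.1 σ.2 • S σ = C.B α i j • 1 := by
    have := congrArg (GaugeSymmetry.singleLin C x) h3
    simp only [map_sum, map_smul] at this
    refine this.symm.trans ?_
    rw [Fintype.sum_unique]
    exact congrArg (C.B α i j • ·) (GaugeSymmetry.single_one C x)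
  rw [h4, TensorProduct.tmul_smul]
  rfl

theorem freeCoaction_decomposition (hq : q ≠ 0) (hq2 : q ^ 2 ≠ 1) (a : T.Link) (α β : P.I)
    (i j : Fin (P.d α)) (k l : Fin (P.d β)) :
    freeCoaction C c r (uFree P T a α i j * uFree P T a β k l) =
      freeCoaction C c r (∑ γ ∈ P.fusion (P.o α) (P.o β), ∑ m, ∑ n,
          (C.φ (P.o α) (P.o β) γ (i, k) m *
            (C.ψ (P.o β) (P.o α) γ * C.finv β α) n (l, j)) • uFree P T a γ m n) := by
  have hxy := a.ne
  let D : QGamma C →ₗ[ℂ] QGamma C →ₗ[ℂ] GaugeSymmetry C V :=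
    (LinearMap.mul ℂ (GaugeSymmetry C V)).compl₁₂ (GaugeSymmetry.singleLin C a.1.1)
      (GaugeSymmetry.singleLin C a.1.2)
  have hD : ∀ s t, D s t = GaugeSymmetry.single C a.1.1 s * GaugeSymmetry.single C a.1.2 t :=
    fun _ _ => rfl
  -- The column indices live at the departure point and transform by ᾱ and β̄. Hence the right-hand
  -- factor of the relation, transposed and with the order of its two indices exchanged, is a map γ̄
  -- → ᾱ ⊗ β̄.
  let Q : ∀ γ, Matrix (P.Ix (P.bar α) × P.Ix (P.bar β)) (P.Ix (P.bar γ)) ℂ := fun γ =>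
    ((C.ψ (P.o β) (P.o α) γ * C.finv β α).submatrix id Prod.swap)ᵀ
  have hQ : ∀ γ, Cov (C.gMat (P.bar γ)) (C.gMat (P.bar α) ⊗ₖ C.gMat (P.bar β)) (Q γ) := by
    intro γ
    -- The relation sums over γ in α ⊗ β, while `cov_finv` asks for γ in β ⊗ α; if γ is not there,
    -- ψ_{βα}^γ is zero.
    by_cases hγ : γ ∈ P.fusion (P.o β) (P.o α)
    · exact ClebschGordan.cov_finv hq hq2 β α γ hγ
    · have h0 : Q γ = 0 := by
        ext s t
        change (C.ψ (P.o β) (P.o α) γ * C.finv β α) t (s.2, s.1) = 0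
        rw [C.ψ_eq_zero _ _ _ fun h => hγ (QGamma.mem_fusion.mpr h), Matrix.zero_mul]
        rfl
      rw [h0]
      exact Cov.zero
  let w : ∀ γ, Fin (P.d γ) → Fin (P.d γ) → GaugeFields C T c r := GaugeFields.u C c r a
  have hrel : ∀ (K : P.Ix (P.o α) × P.Ix (P.o β)) (N : P.Ix (P.bar α) × P.Ix (P.bar β)),
      w α K.1 N.1 * w β K.2 N.2 = ∑ γ ∈ P.fusion (P.o α) (P.o β), ∑ m, ∑ n,
        (C.φ (P.o α) (P.o β) γ K m * Q γ N n) • w γ m n := by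
    intro K N
    have e := GaugeFields.mk_rel C c r (FieldRel.decomposition a α β K.1 N.1 K.2 N.2)
    simp only [GaugeFields.mk_sum, GaugeFields.mk_smul] at e
    exact e
  have hbil : ∀ {ι κ : Type} [Fintype ι] [Fintype κ] (s : ι → ℂ) (s' : κ → ℂ)
      (x : ι → QGamma C) (y : κ → QGamma C),
      ∑ i, ∑ k, (s i * s' k) • D (x i) (y k) = D (∑ i, s i • x i) (∑ k, s' k • y k) := by
    intro ι κ _ _ s s' x y
    simp only [map_sum, LinearMap.sum_apply, map_smul, LinearMap.smul_apply, Finset.smul_sum,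
      smul_smul]
    rw [Finset.sum_comm]
    exact Finset.sum_congr rfl fun _ _ => Finset.sum_congr rfl fun _ _ => by rw [mul_comm]
  have hL : freeCoaction C c r (uFree P T a α i j * uFree P T a β k l) =
      ∑ K : P.Ix (P.o α) × P.Ix (P.o β), ∑ N : P.Ix (P.bar α) × P.Ix (P.bar β),
        (w α K.1 N.1 * w β K.2 N.2) ⊗ₜ[ℂ] D ((C.gMat (P.o α) ⊗ₖ C.gMat (P.o β)) (i, k) K)
          ((C.gMat (P.bar α) ⊗ₖ C.gMat (P.bar β)) (j, l) N) := by
    simp only [map_mul, freeCoaction_uFree_eq, GaugeFields.sum_tmul_mul_sum_tmul,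
      GaugeSymmetry.single_mul_single_mul C hxy]
    refine (sum_prod_comm_four fun i' j' k' l' => (w α i' j' * w β k' l') ⊗ₜ[ℂ]
      D (C.gMat (P.o α) i i' * C.gMat (P.o β) k k')
        (C.gMat (P.bar α) j j' * C.gMat (P.bar β) l l')).trans ?_
    exact Finset.sum_comm
  rw [hL]
  simp only [map_sum, map_smul, freeCoaction_uFree_eq]
  have h1 : ∀ γ, ∑ m, ∑ n, (C.φ (P.o α) (P.o β) γ (i, k) m *
      (C.ψ (P.o β) (P.o α) γ * C.finv β α) n (l, j)) •
        ∑ K : Fin (P.d γ) × Fin (P.d γ), GaugeFields.u C c r a γ K.1 K.2 ⊗ₜ[ℂ]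
          (GaugeSymmetry.single C a.1.1 (C.gMat (P.o γ) m K.1) *
            GaugeSymmetry.single C a.1.2 (C.gMat (P.bar γ) n K.2)) =
      ∑ K : Fin (P.d γ) × Fin (P.d γ), w γ K.1 K.2 ⊗ₜ[ℂ]
        D (∑ m, C.φ (P.o α) (P.o β) γ (i, k) m • C.gMat (P.o γ) m K.1)
          (∑ n, Q γ (j, l) n • C.gMat (P.bar γ) n K.2) := by
    intro γ
    simp only [← hbil, Finset.smul_sum, TensorProduct.tmul_sum, TensorProduct.tmul_smul]
    rw [Finset.sum_congr rfl fun m _ => Finset.sum_comm, Finset.sum_comm]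
    rfl
  refine Eq.trans ?_ (Finset.sum_congr rfl fun γ _ => (h1 γ).symm)
  have h2 : ∀ γ m n, D (∑ m', C.φ (P.o α) (P.o β) γ (i, k) m' • C.gMat (P.o γ) m' m)
      (∑ n', Q γ (j, l) n' • C.gMat (P.bar γ) n' n) =
      ∑ K, ∑ N, (C.φ (P.o α) (P.o β) γ K m * Q γ N n) •
        D ((C.gMat (P.o α) ⊗ₖ C.gMat (P.o β)) (i, k) K)
          ((C.gMat (P.bar α) ⊗ₖ C.gMat (P.bar β)) (j, l) N) := by
    intro γ m n
    rw [hbil]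
    exact congrArg₂ (fun s t => D s t)
      ((ClebschGordan.cov_φ (C := C) hq hq2 (P.o α) (P.o β) γ).sum_smul (i, k) m)
      ((hQ γ).sum_smul (j, l) n)
  simp only [h2, hrel, TensorProduct.sum_tmul, TensorProduct.tmul_sum]
  rw [Finset.sum_congr rfl fun K _ => Finset.sum_comm, Finset.sum_comm]
  refine Finset.sum_congr rfl fun γ _ => ?_
  refine Eq.trans ?_ (Fintype.sum_prod_type (fun M : Fin (P.d γ) × Fin (P.d γ) =>
    ∑ K, ∑ N, w γ M.1 M.2 ⊗ₜ[ℂ] ((C.φ (P.o α) (P.o β) γ K M.1 * Q γ N M.2) •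
        D ((C.gMat (P.o α) ⊗ₖ C.gMat (P.o β)) (i, k) K)
          ((C.gMat (P.bar α) ⊗ₖ C.gMat (P.bar β)) (j, l) N)))).symm
  simp only [TensorProduct.smul_tmul]
  rw [Finset.sum_congr rfl fun K _ => (Finset.sum_comm.trans
    (Finset.sum_congr rfl fun m _ => Finset.sum_comm)), Finset.sum_comm]
  exact Finset.sum_congr rfl fun m _ => Finset.sum_comm

end Relations

/-! ### The coproduct and counit of Γ on matrices of products. -/

namespace QGamma

variable {q : ℂ} {P : PhysSystem q} (C : ClebschGordan P)

theorem comul_g (α : P.I) (i j : Fin (P.d α)) :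
    comul C (g C α i j) = ∑ k, g C α i k ⊗ₜ[ℂ] g C α k j := by
  unfold comul g
  rw [Module.Basis.constr_basis]

theorem counit_g (α : P.I) (i j : Fin (P.d α)) :
    counit C (g C α i j) = if i = j then 1 else 0 := by
  unfold counit g
  rw [Module.Basis.constr_basis]

/-- A matrix assembled covariantly from the `g^γ` is comultiplicative. -/
theorem comul_of_cov {m : Type} [Fintype m] (U : Matrix m m (QGamma C)) (s : Finset P.I)
    (X : ∀ γ, Matrix m (Fin (P.d γ)) ℂ) (Y : ∀ γ, Matrix (Fin (P.d γ)) m ℂ)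
    (hU : ∀ i k, U i k = ∑ γ ∈ s, ∑ a, ∑ b, (X γ i a * Y γ b k) • g C γ a b)
    (hY : ∀ γ, Cov U (C.gMat (P.o γ)) (Y γ)) (i k : m) :
    comul C (U i k) = ∑ j, U i j ⊗ₜ[ℂ] U j k := by
  -- Δ inserts a sum over the index of γ between X and Y. Covariance pulls Y through the second
  -- tensor factor, turning g^γ there into U, and leaves Y in the first factor.
  have h1 : ∀ γ a, ∑ b, (X γ i a * Y γ b k) • comul C (g C γ a b) =
      ∑ j, ∑ b, (X γ i a * Y γ b j) • (g C γ a b ⊗ₜ[ℂ] U j k) := by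
    intro γ a
    rw [Finset.sum_comm]
    simp only [mul_smul, ← Finset.smul_sum, comul_g]
    congr 1
    simp only [← TensorProduct.tmul_smul, ← TensorProduct.tmul_sum, (hY γ).sum_smul]
    simp only [TensorProduct.tmul_smul, TensorProduct.tmul_sum, Finset.smul_sum]
    rw [Finset.sum_comm]
    simp only [gMat_o_apply]
  calc comul C (U i k) = ∑ γ ∈ s, ∑ a, ∑ b, (X γ i a * Y γ b k) • comul C (g C γ a b) := by
        rw [hU]
        simp only [map_sum, map_smul]
    _ = ∑ γ ∈ s, ∑ a, ∑ j, ∑ b, (X γ i a * Y γ b j) • (g C γ a b ⊗ₜ[ℂ] U j k) := by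
        simp only [h1]
    _ = ∑ γ ∈ s, ∑ j, ∑ a, ∑ b, (X γ i a * Y γ b j) • (g C γ a b ⊗ₜ[ℂ] U j k) :=
        Finset.sum_congr rfl fun _ _ => Finset.sum_comm
    _ = ∑ j, (∑ γ ∈ s, ∑ a, ∑ b, (X γ i a * Y γ b j) • g C γ a b) ⊗ₜ[ℂ] U j k := by
        rw [Finset.sum_comm]
        simp only [TensorProduct.sum_tmul, TensorProduct.smul_tmul']
    _ = _ := by simp only [← hU]

/-- The matrix g^α ⊗ g^β is assembled from the g^γ through φ and the covariant ψ, so `comul_of_cov`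
applies to it. -/
theorem comul_mul (hq : q ≠ 0) (hq2 : q ^ 2 ≠ 1) (a b : QGamma C) :
    comul C (a * b) = comul C a * comul C b := by
  have h : (LinearMap.mul ℂ (QGamma C)).compr₂ (comul C) =
      (LinearMap.mul ℂ (QGamma C ⊗[ℂ] QGamma C)).compl₁₂ (comul C) (comul C) := by
    refine (basis C).ext fun x => (basis C).ext fun y => ?_
    obtain ⟨α, i, j⟩ := x
    obtain ⟨β, k, l⟩ := y
    change comul C (g C α i j * g C β k l) = comul C (g C α i j) * comul C (g C β k l)
    have := comul_of_cov C (C.gMat (P.o α) ⊗ₖ C.gMat (P.o β)) (P.fusion (P.o α) (P.o β))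
      (C.φ (P.o α) (P.o β)) (C.ψ (P.o α) (P.o β))
      (fun i k => gObj_mul_gObj C hq hq2 (P.o α) (P.o β) i.1 k.1 i.2 k.2)
      (ClebschGordan.cov_ψ hq hq2 (P.o α) (P.o β)) (i, k) (j, l)
    simp only [kroneckerMap_apply, gMat_o_apply] at this
    rw [this, comul_g, comul_g]
    refine Eq.trans ?_ (Finset.sum_mul_sum (R := QGamma C ⊗[ℂ] QGamma C) _ _ _ _).symm
    rw [Fintype.sum_prod_type]
    exact Finset.sum_congr rfl fun _ _ => Finset.sum_congr rfl fun _ _ =>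
      (Algebra.TensorProduct.tmul_mul_tmul _ _ _ _).symm
  exact congrArg (fun L => L a b) h

theorem comul_gMat (hq : q ≠ 0) (hq2 : q ^ 2 ≠ 1) (a : P.Obj) (i k : P.Ix a) :
    comul C (C.gMat a i k) = ∑ j, C.gMat a i j ⊗ₜ[ℂ] C.gMat a j k := by
  refine comul_of_cov C (C.gMat a) (P.fusion a (P.o P.zero))
    (fun γ => Matrix.of fun i m => C.φ a (P.o P.zero) γ (i, P.ix0) m)
    (fun γ => Matrix.of fun n j => C.ψ a (P.o P.zero) γ n (j, P.ix0))
    (fun i k => rfl) (fun γ => Cov.of_sum_smul fun n k => ?_) i k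
  have := (ClebschGordan.cov_ψ (C := C) hq hq2 a (P.o P.zero) γ).sum_smul n (k, P.ix0)
  rw [sum_prod_zero, ClebschGordan.gMat_zero] at this
  refine Eq.trans (Finset.sum_congr rfl fun j _ => ?_) this
  change _ • C.gMat a j k = _ • (C.gMat a j k * 1)
  rw [mul_one]
  rfl

theorem comul_gTree (hq : q ≠ 0) (hq2 : q ^ 2 ≠ 1) : ∀ (t : PTree P.Obj) (i k : t.Idx),
    comul C (C.gTree t i k) = ∑ j, C.gTree t i j ⊗ₜ[ℂ] C.gTree t j k
  | .leaf a, i, k => comul_gMat C hq hq2 a i k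
  | .node s t, i, k => by
    refine (comul_mul C hq hq2 (C.gTree s i.1 k.1) (C.gTree t i.2 k.2)).trans ?_
    rw [comul_gTree hq hq2 s, comul_gTree hq hq2 t]
    refine (Finset.sum_mul_sum (R := QGamma C ⊗[ℂ] QGamma C) _ _ _ _).trans ?_
    refine (Finset.sum_congr rfl fun _ _ => Finset.sum_congr rfl fun _ _ =>
      Algebra.TensorProduct.tmul_mul_tmul _ _ _ _).trans ?_
    exact (Fintype.sum_prod_type (fun j : s.Idx × t.Idx =>
      (C.gTree s i.1 j.1 * C.gTree t i.2 j.2) ⊗ₜ[ℂ]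
        (C.gTree s j.1 k.1 * C.gTree t j.2 k.2))).symm

theorem comul_one : comul C (1 : QGamma C) = 1 ⊗ₜ[ℂ] 1 := by
  change comul C (g C P.zero P.ix0 P.ix0) = _
  rw [comul_g, sum_zero]
  rfl

theorem counit_one : counit C (1 : QGamma C) = 1 := by
  change counit C (g C P.zero P.ix0 P.ix0) = _
  rw [counit_g, if_pos rfl]

theorem counit_gMat (hq : q ≠ 0) (hq2 : q ^ 2 ≠ 1) (a : P.Obj) (i j : P.Ix a) :
    counit C (C.gMat a i j) = (1 : Matrix (P.Ix a) (P.Ix a) ℂ) i j := by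
  rw [← toObj_mul_ofObj C hq hq2 a, ClebschGordan.gMat, gObj_eq C hq hq2, Matrix.mul_apply]
  simp [counit_g]

end QGamma

/-! ### The counit of a product and the truncation projectors. -/

namespace ClebschGordan

variable {q : ℂ} {P : PhysSystem q} (C : ClebschGordan P)

theorem map_sumComponents {M N : Type} [AddCommMonoid M] [AddCommMonoid N] (F : M →+ N) :
    ∀ (t : PTree P.Obj) (f : ∀ a : P.Obj, Matrix t.Idx (P.Ix a) ℂ → Matrix (P.Ix a) t.Idx ℂ → M),
      F (C.sumComponents t f) = C.sumComponents t fun a e p => F (f a e p)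
  | .leaf a, f => rfl
  | .node s t, f => by
    change F (C.sumComponents s _) = C.sumComponents s _
    rw [map_sumComponents F s]
    congr 1
    funext a e p
    rw [map_sumComponents F t]
    congr 1
    funext b e' p'
    exact map_sum F _ _

theorem sumComponents_mul_sumComponents {A : Type} [NonAssocRing A] (s t : PTree P.Obj)
    (F : ∀ a : P.Obj, Matrix s.Idx (P.Ix a) ℂ → Matrix (P.Ix a) s.Idx ℂ → A)
    (G : ∀ a : P.Obj, Matrix t.Idx (P.Ix a) ℂ → Matrix (P.Ix a) t.Idx ℂ → A) :
    C.sumComponents s F * C.sumComponents t G =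
      C.sumComponents s fun a e p => C.sumComponents t fun b e' p' => F a e p * G b e' p' := by
  refine (C.map_sumComponents (AddMonoidHom.mulRight (C.sumComponents t G)) s F).trans ?_
  refine congrArg (C.sumComponents s) (funext fun a => funext fun e => funext fun p => ?_)
  exact C.map_sumComponents (AddMonoidHom.mulLeft (F a e p)) t G

theorem sum_gMat_one (a : P.Obj) (i k : P.Ix a) :
    C.gMat a i k = ∑ m, ∑ n, ((1 : Matrix (P.Ix a) (P.Ix a) ℂ) i m *
      (1 : Matrix (P.Ix a) (P.Ix a) ℂ) n k) • C.gMat a m n := by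
  simp [Matrix.one_apply]

/-- The product law of Γ applied to one component of each of two words; this is the inductive step
in decomposing a whole word. -/
theorem sum_gMat_mul_sum_gMat (hq : q ≠ 0) (hq2 : q ^ 2 ≠ 1) {I J : Type} (a b : P.Obj)
    (e : Matrix I (P.Ix a) ℂ) (p : Matrix (P.Ix a) I ℂ) (e' : Matrix J (P.Ix b) ℂ)
    (p' : Matrix (P.Ix b) J ℂ) (i k : I) (i' k' : J) :
    (∑ m, ∑ n, (e i m * p n k) • C.gMat a m n) * (∑ m, ∑ n, (e' i' m * p' n k') • C.gMat b m n) =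
      ∑ γ ∈ P.fusion a b, ∑ m, ∑ n, (((e ⊗ₖ e') * C.φ a b γ) (i, i') m *
        (C.ψ a b γ * (p ⊗ₖ p')) n (k, k')) • C.gMat (P.o γ) m n := by
  rw [← sub_eq_zero, ← Module.forall_dual_apply_eq_zero_iff ℂ]
  intro ℓ
  rw [map_sub, sub_eq_zero]
  refine (dual_mul_eq ℓ (C.gMat a) (C.gMat b) rfl rfl).trans ?_
  rw [kronecker_gMat_map hq hq2, Matrix.mul_sum, Matrix.sum_mul, Matrix.sum_apply, map_sum]
  refine Finset.sum_congr rfl fun γ _ => ?_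
  have h : (e ⊗ₖ e') * (C.φ a b γ * (C.gMat (P.o γ)).map ℓ * C.ψ a b γ) * (p ⊗ₖ p') =
      ((e ⊗ₖ e') * C.φ a b γ) * (C.gMat (P.o γ)).map ℓ * (C.ψ a b γ * (p ⊗ₖ p')) := by
    simp only [Matrix.mul_assoc]
  rw [h]
  generalize (e ⊗ₖ e') * C.φ a b γ = X
  generalize C.ψ a b γ * (p ⊗ₖ p') = Y
  simp only [map_sum, map_smul, smul_eq_mul, Matrix.mul_apply, Matrix.map_apply, Finset.sum_mul]
  rw [Finset.sum_comm]
  exact Finset.sum_congr rfl fun _ _ => Finset.sum_congr rfl fun _ _ => mul_right_comm _ _ _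

/-- Decomposition of the matrix coefficients of a word along its components. -/
theorem gTree_eq_sumComponents (hq : q ≠ 0) (hq2 : q ^ 2 ≠ 1) (t : PTree P.Obj) (i k : t.Idx) :
    C.gTree t i k = C.sumComponents t fun a e p => ∑ m, ∑ n, (e i m * p n k) • C.gMat a m n := by
  induction t with
  | leaf a => exact C.sum_gMat_one a i k
  | node s t ihs iht =>
    change C.gTree s i.1 k.1 * C.gTree t i.2 k.2 = C.sumComponents s fun a e p =>
      C.sumComponents t fun b e' p' => ∑ γ ∈ P.fusion a b, ∑ m, ∑ n,
        (((e ⊗ₖ e') * C.φ a b γ) (i.1, i.2) m * (C.ψ a b γ * (p ⊗ₖ p')) n (k.1, k.2)) •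
          C.gMat (P.o γ) m n
    rw [ihs, iht, sumComponents_mul_sumComponents]
    simp only [C.sum_gMat_mul_sum_gMat hq hq2]

/-- On each component g^a is replaced by the identity, which leaves ∑ e p. This is the truncation
projector, not the product of the counits of the letters unless nothing is truncated. -/
theorem counit_gTree (hq : q ≠ 0) (hq2 : q ^ 2 ≠ 1) (t : PTree P.Obj) (i k : t.Idx) :
    QGamma.counit C (C.gTree t i k) = C.proj t i k := by
  rw [gTree_eq_sumComponents C hq hq2]
  refine (C.map_sumComponents (QGamma.counit C).toAddMonoidHom t _).trans ?_
  refine Eq.trans ?_ (C.map_sumComponents (Matrix.entryAddMonoidHom ℂ i k) t _).symm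
  congr 1
  funext a e p
  change QGamma.counit C (∑ m, ∑ n, (e i m * p n k) • C.gMat a m n) = (e * p) i k
  simp [QGamma.counit_gMat C hq hq2, Matrix.one_apply, Matrix.mul_apply]

end ClebschGordan

/-! ### The coproduct and counit of Γ̂ on pure tensors. -/

namespace GaugeSymmetry

variable {q : ℂ} {P : PhysSystem q} (C : ClebschGordan P) {V : Type} [Fintype V] [DecidableEq V]

theorem basis_apply (x : V → Σ α : P.I, Fin (P.d α) × Fin (P.d α)) :
    basis C x = PiTensorProduct.tprod ℂ fun z => QGamma.basis C (x z) :=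
  Basis.piTensorProduct_apply _ _

/-- Factorwise tensor product of two elements of `Γ̂`. -/
noncomputable def interleave : GaugeSymmetry C V ⊗[ℂ] GaugeSymmetry C V →ₗ[ℂ]
    PiTensorProduct ℂ fun _ : V => QGamma C ⊗[ℂ] QGamma C :=
  TensorProduct.lift (PiTensorProduct.map₂ fun _ => TensorProduct.mk ℂ (QGamma C) (QGamma C))

theorem interleave_tmul (a b : V → QGamma C) :
    interleave C (PiTensorProduct.tprod ℂ a ⊗ₜ[ℂ] PiTensorProduct.tprod ℂ b) =
      PiTensorProduct.tprod ℂ fun z => a z ⊗ₜ[ℂ] b z := by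
  unfold interleave
  rw [TensorProduct.lift.tmul, PiTensorProduct.map₂_tprod_tprod]
  rfl

/-- The rearrangement sends a basis of pure tensors to basis elements and is undone there.
Identities about the coproduct of Γ̂, which is defined on a basis, can thus be checked one vertex at
a time. -/
theorem interleave_injective : Function.Injective (interleave C (V := V)) := by
  let e := Basis.piTensorProduct fun _ : V => (QGamma.basis C).tensorProduct (QGamma.basis C)
  let W := e.constr ℂ fun x => basis C (fun z => (x z).1) ⊗ₜ[ℂ] basis C fun z => (x z).2
  have h : W ∘ₗ interleave C (V := V) = LinearMap.id := by
    refine ((basis C).tensorProduct (basis C)).ext fun x => ?_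
    rw [Module.Basis.tensorProduct_apply, LinearMap.comp_apply, basis_apply, basis_apply,
      interleave_tmul]
    have : (PiTensorProduct.tprod ℂ fun z => QGamma.basis C (x.1 z) ⊗ₜ[ℂ] QGamma.basis C (x.2 z)) =
        e fun z => (x.1 z, x.2 z) := by
      rw [Basis.piTensorProduct_apply]
      simp only [Module.Basis.tensorProduct_apply]
    rw [this, Module.Basis.constr_basis, basis_apply, basis_apply]
    rfl
  exact Function.LeftInverse.injective (g := W) fun a => congrArg (fun L => L a) h

theorem interleave_comul (a : V → QGamma C) :
    interleave C (comul C (PiTensorProduct.tprod ℂ a)) =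
      PiTensorProduct.tprod ℂ fun z => QGamma.comul C (a z) := by
  have h : (interleave C ∘ₗ comul C).compMultilinearMap (PiTensorProduct.tprod ℂ) =
      (PiTensorProduct.tprod ℂ).compLinearMap fun _ : V => QGamma.comul C := by
    refine Module.Basis.ext_multilinear (fun _ => QGamma.basis C) fun x => ?_
    change interleave C (comul C (PiTensorProduct.tprod ℂ fun z => QGamma.basis C (x z))) =
      PiTensorProduct.tprod ℂ fun z => QGamma.comul C (QGamma.basis C (x z))
    rw [← basis_apply, comul, Module.Basis.constr_basis, map_sum]
    simp only [interleave_tmul]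
    rw [← MultilinearMap.map_sum (f := PiTensorProduct.tprod ℂ) (g := fun z k =>
      QGamma.g C (x z).1 (x z).2.1 k ⊗ₜ[ℂ] QGamma.g C (x z).1 k (x z).2.2)]
    simp only [← QGamma.comul_g]
    rfl
  exact congrArg (fun L => L a) h

theorem comul_tprod {J : V → Type} [∀ z, Fintype (J z)] (a : V → QGamma C)
    (b b' : ∀ z, J z → QGamma C) (h : ∀ z, QGamma.comul C (a z) = ∑ j, b z j ⊗ₜ[ℂ] b' z j) :
    comul C (PiTensorProduct.tprod ℂ a) = ∑ f : ∀ z, J z,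
      (PiTensorProduct.tprod ℂ fun z => b z (f z)) ⊗ₜ[ℂ]
        (PiTensorProduct.tprod ℂ fun z => b' z (f z)) := by
  apply interleave_injective
  rw [interleave_comul, map_sum]
  simp only [interleave_tmul, h]
  exact MultilinearMap.map_sum (PiTensorProduct.tprod ℂ) (fun z j => b z j ⊗ₜ[ℂ] b' z j)

theorem comul_one : comul C (1 : GaugeSymmetry C V) = 1 ⊗ₜ[ℂ] 1 := by
  have h := comul_tprod C (J := fun _ : V => Unit) (fun _ => 1) (fun _ _ => 1) (fun _ _ => 1)
    fun z => by rw [QGamma.comul_one, Fintype.sum_unique]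
  rw [Fintype.sum_unique] at h
  exact h

theorem counit_tprod (a : V → QGamma C) :
    counit C (PiTensorProduct.tprod ℂ a) = ∏ z, QGamma.counit C (a z) := by
  have h : (counit C).compMultilinearMap (PiTensorProduct.tprod ℂ) =
      (MultilinearMap.mkPiAlgebra ℂ V ℂ).compLinearMap fun _ : V => QGamma.counit C := by
    refine Module.Basis.ext_multilinear (fun _ => QGamma.basis C) fun x => ?_
    change counit C (PiTensorProduct.tprod ℂ fun z => QGamma.basis C (x z)) = _
    rw [← basis_apply, counit, Module.Basis.constr_basis]
    simp
  exact (congrArg (fun L => L a) h).trans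
    (MultilinearMap.mkPiAlgebra_apply (R := ℂ) (A := ℂ) fun z => QGamma.counit C (a z))

theorem counit_one : counit C (1 : GaugeSymmetry C V) = 1 := by
  have h := counit_tprod C (fun _ : V => (1 : QGamma C))
  simp only [QGamma.counit_one, Finset.prod_const_one] at h
  exact h

end GaugeSymmetry

/-! ### Descent to Λ and the comodule axioms. -/

section GaugeFields

variable {q : ℂ} {P : PhysSystem q} (C : ClebschGordan P) {V : Type} [Fintype V] [DecidableEq V]
  {T : TriangulatedSurface V} (c : Ciliation T) (r : P.Obj → P.Obj → P.I → ℂ)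

theorem Word.comul_coeff (hq : q ≠ 0) (hq2 : q ^ 2 ≠ 1) (M : Word P T) (i k : M.Idx) :
    GaugeSymmetry.comul C (M.coeff C i k) = ∑ j : M.Idx, M.coeff C i j ⊗ₜ[ℂ] M.coeff C j k :=
  (GaugeSymmetry.comul_tprod C _
    (fun x j => C.gTree (M.at_ x) (M.indexAt x i) j)
    (fun x j => C.gTree (M.at_ x) j (M.indexAt x k))
    fun x => QGamma.comul_gTree C hq hq2 (M.at_ x) _ _).trans
  (M.sum_indexAt fun f =>
    (PiTensorProduct.tprod ℂ fun x => C.gTree (M.at_ x) (M.indexAt x i) (f x)) ⊗ₜ[ℂ]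
      (PiTensorProduct.tprod ℂ fun x => C.gTree (M.at_ x) (f x) (M.indexAt x k))).symm

theorem Word.counit_coeff (hq : q ≠ 0) (hq2 : q ^ 2 ≠ 1) (M : Word P T) (i k : M.Idx) :
    GaugeSymmetry.counit C (M.coeff C i k) =
      ∏ x, C.proj (M.at_ x) (M.indexAt x i) (M.indexAt x k) := by
  unfold Word.coeff
  rw [GaugeSymmetry.counit_tprod]
  simp only [ClebschGordan.counit_gTree C hq hq2]

theorem exists_monomial (m : FreeMagma (FieldGen P T)) :
    ∃ (M : Word P T) (i : M.Idx),
      (MonoidAlgebra.single (m : WithOne _) 1 : FreeFields P T) = M.monomial i := by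
  induction m using FreeMagma.recOnMul with
  | ih1 x => exact ⟨.leaf (x.1, x.2.1), x.2.2, rfl⟩
  | ih2 m n hm hn =>
    obtain ⟨M, i, hM⟩ := hm
    obtain ⟨N, j, hN⟩ := hn
    refine ⟨.node M N, (i, j), ?_⟩
    change _ = M.monomial i * N.monomial j
    rw [← hM, ← hN, MonoidAlgebra.single_mul_single, one_mul]
    rfl

/-- Linear maps that agree on `1` and on the monomials are equal. -/
theorem GaugeFields.linearMap_ext {A : Type*} [AddCommGroup A] [Module ℂ A]
    {F G : GaugeFields C T c r →ₗ[ℂ] A} (h1 : F 1 = G 1)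
    (h : ∀ (M : Word P T) (i : M.Idx), F (mk C c r (M.monomial i)) = G (mk C c r (M.monomial i))) :
    F = G := by
  ext a
  obtain ⟨a, rfl⟩ := mk_surjective C c r a
  have : F ∘ₗ mkLin C c r = G ∘ₗ mkLin C c r := by
    refine MonoidAlgebra.lhom_ext' fun w => LinearMap.ext_ring ?_
    change F (mk C c r (MonoidAlgebra.single w 1)) = G (mk C c r (MonoidAlgebra.single w 1))
    cases w with
    | one => exact h1
    | coe m =>
      obtain ⟨M, i, hM⟩ := exists_monomial m
      rw [hM]
      exact h M i
  exact congrArg (fun L => L a) this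

theorem freeCoaction_rel (hq : q ≠ 0) (hq2 : q ^ 2 ≠ 1) {a b : FreeFields P T}
    (h : FieldRel C T c r a b) : freeCoaction C c r a = freeCoaction C c r b := by
  cases h with
  | target_target x y z hx hz hne hlt α β i j k l =>
    exact freeCoaction_target_target C c r hq hq2 x y z hx hz hne hlt α β i j k l
  | source_target x y z hx hz hne hlt α β i j k l =>
    exact freeCoaction_source_target C c r hq hq2 x y z hx hz hne hlt α β i j k l
  | source_source x y z hx hz hne hlt α β i j k l =>
    exact freeCoaction_source_source C c r hq hq2 x y z hx hz hne hlt α β i j k l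
  | inverse x y h h' α i j => exact freeCoaction_inverse C c r hq hq2 x y h h' α i j
  | disjoint x y z w h h' hxz hxw hyz hyw α β i j k l =>
    exact freeCoaction_disjoint C c r x y z w h h' hxz hxw hyz hyw α β i j k l
  | decomposition a α β i j k l => exact freeCoaction_decomposition C c r hq hq2 a α β i j k l
  | unit a i j => exact freeCoaction_unit C c r a i j
  | quasi_assoc M M' Θ h i => exact freeCoaction_quasi_assoc C c r hq hq2 h i

theorem freeCoaction_eq_of_ringConGen (hq : q ≠ 0) (hq2 : q ^ 2 ≠ 1) {a b : FreeFields P T}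
    (h : ringConGen (FieldRel C T c r) a b) : freeCoaction C c r a = freeCoaction C c r b := by
  change RingConGen.Rel (FieldRel C T c r) a b at h
  induction h with
  | of x y h => exact freeCoaction_rel C c r hq hq2 h
  | refl x => rfl
  | symm _ ih => exact ih.symm
  | trans _ _ ih ih' => exact ih.trans ih'
  | add _ _ ih ih' => rw [map_add, map_add, ih, ih']
  | mul _ _ ih ih' => rw [map_mul, map_mul, ih, ih']

/-- The coaction of `Γ̂` on the algebra of gauge fields. -/
noncomputable def GaugeFields.coaction (hq : q ≠ 0) (hq2 : q ^ 2 ≠ 1) :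
    GaugeFields C T c r →ₗ[ℂ] GaugeFields C T c r ⊗[ℂ] GaugeSymmetry C V where
  toFun := Quotient.lift (freeCoaction C c r) fun _ _ h =>
    freeCoaction_eq_of_ringConGen C c r hq hq2 h
  map_add' a b := by
    obtain ⟨a, rfl⟩ := mk_surjective C c r a
    obtain ⟨b, rfl⟩ := mk_surjective C c r b
    exact map_add (freeCoaction C c r) a b
  map_smul' s a := by
    obtain ⟨a, rfl⟩ := mk_surjective C c r a
    exact map_smul (freeCoaction C c r) s a

namespace GaugeFields

variable (hq : q ≠ 0) (hq2 : q ^ 2 ≠ 1)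

theorem coaction_one : coaction C c r hq hq2 (1 : GaugeFields C T c r) = 1 :=
  freeCoaction_one C c r

theorem coaction_mul (a b : GaugeFields C T c r) :
    coaction C c r hq hq2 (a * b) = coaction C c r hq hq2 a * coaction C c r hq hq2 b := by
  obtain ⟨a, rfl⟩ := mk_surjective C c r a
  obtain ⟨b, rfl⟩ := mk_surjective C c r b
  exact map_mul (freeCoaction C c r) a b

theorem coaction_u (l : T.Link) (α : P.I) (i j : Fin (P.d α)) :
    coaction C c r hq hq2 (u C c r l α i j) = gaugeTransform C c r l α i j :=
  freeCoaction_uFree C c r l α i j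

theorem coaction_monomial (M : Word P T) (i : M.Idx) :
    coaction C c r hq hq2 (mk C c r (M.monomial i)) =
      ∑ k : M.Idx, mk C c r (M.monomial k) ⊗ₜ[ℂ] M.coeff C i k :=
  freeCoaction_monomial C c r M i

/-- In M_i ↦ ∑ M_k ⊗ c_{ik} the index summed with the field is the second one of c. A second
application yields M_j ⊗ c_{kj} ⊗ c_{ik}, the two factors of Δ(c_{ij}) exchanged: hence Δ^op. -/
theorem coaction_coassoc :
    (TensorProduct.assoc ℂ _ _ _).toLinearMap ∘ₗ
        (coaction C c r hq hq2).rTensor (GaugeSymmetry C V) ∘ₗ coaction C c r hq hq2 =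
      (GaugeSymmetry.comulOp C).lTensor (GaugeFields C T c r) ∘ₗ coaction C c r hq hq2 := by
  refine linearMap_ext C c r ?_ fun M i => ?_
  · simp only [LinearMap.comp_apply, coaction_one, Algebra.TensorProduct.one_def,
      LinearMap.rTensor_tmul, LinearMap.lTensor_tmul, GaugeSymmetry.comulOp,
      GaugeSymmetry.comul_one]
    rfl
  · simp only [LinearMap.comp_apply, coaction_monomial, map_sum, LinearMap.rTensor_tmul,
      LinearMap.lTensor_tmul, GaugeSymmetry.comulOp, Word.comul_coeff C hq hq2,
      TensorProduct.sum_tmul, TensorProduct.tmul_sum]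
    exact Finset.sum_comm

theorem coaction_counit (a : GaugeFields C T c r) :
    (GaugeSymmetry.counit C).lTensor _ (coaction C c r hq hq2 a) = a ⊗ₜ[ℂ] 1 := by
  have h : (GaugeSymmetry.counit C).lTensor (GaugeFields C T c r) ∘ₗ coaction C c r hq hq2 =
      (TensorProduct.mk ℂ (GaugeFields C T c r) ℂ).flip 1 := by
    refine linearMap_ext C c r ?_ fun M i => ?_
    · simp only [LinearMap.comp_apply, coaction_one, Algebra.TensorProduct.one_def,
        LinearMap.lTensor_tmul, GaugeSymmetry.counit_one]
      rfl
    · have e := mk_rel C c r (FieldRel.quasi_assoc M M _ (Reparenthesise.refl M) i)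
      simp only [mk_sum, mk_smul] at e
      simp only [LinearMap.comp_apply, coaction_monomial, map_sum, LinearMap.lTensor_tmul,
        Word.counit_coeff C hq hq2]
      change _ = mk C c r (M.monomial i) ⊗ₜ[ℂ] (1 : ℂ)
      rw [← e, TensorProduct.sum_tmul]
      refine Finset.sum_congr rfl fun k _ => ?_
      rw [TensorProduct.smul_tmul, smul_eq_mul, mul_one]
  exact congrArg (fun L => L a) h

theorem coaction_unique
    (Ω' : GaugeFields C T c r →ₗ[ℂ] GaugeFields C T c r ⊗[ℂ] GaugeSymmetry C V)
    (h1 : Ω' 1 = 1) (hmul : ∀ a b, Ω' (a * b) = Ω' a * Ω' b)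
    (hu : ∀ (l : T.Link) (α : P.I) (i j : Fin (P.d α)),
      Ω' (u C c r l α i j) = coaction C c r hq hq2 (u C c r l α i j)) :
    Ω' = coaction C c r hq hq2 := by
  refine linearMap_ext C c r (h1.trans (coaction_one C c r hq hq2).symm) fun M => ?_
  induction M with
  | leaf l => exact fun i => hu l.1 l.2 i.1 i.2
  | node s t ihs iht =>
    intro i
    refine (hmul (mk C c r (Word.monomial s i.1)) (mk C c r (Word.monomial t i.2))).trans ?_
    rw [ihs, iht]
    exact (coaction_mul C c r hq hq2 _ _).symm

end GaugeFields

end GaugeFields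

theorem mainTheorem12 (q : ℂ) (hq0 : q ≠ 0) (hq1 : q ≠ 1) (hq2 : q ≠ -1) (t : ℂ) (ht : t ^ 2 = q)
    (P : PhysSystem q) (C : ClebschGordan P) (hC : C.AmbientIsotopy)
    (r : P.Obj → P.Obj → P.I → ℂ) (hr : IsSqrtCasimirRatio P t r)
    (V : Type) [Fintype V] [DecidableEq V] (T : TriangulatedSurface V) (c : Ciliation T) :
    (∀ a b : FreeFields P T, FieldRel C T c r a b →
      freeCoaction C c r a = freeCoaction C c r b) ∧
    ∃ Ω : GaugeFields C T c r →ₗ[ℂ] GaugeFields C T c r ⊗[ℂ] GaugeSymmetry C V,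
      Ω 1 = 1 ∧
      (∀ a b, Ω (a * b) = Ω a * Ω b) ∧
      (∀ (x y : V) (h : T.IsLink x y) (α : P.I) (i j : Fin (P.d α)),
        Ω (GaugeFields.u C c r ⟨(x, y), h⟩ α i j) =
          ∑ k, ∑ m, GaugeFields.u C c r ⟨(x, y), h⟩ α k m ⊗ₜ[ℂ]
            (GaugeSymmetry.single C x (QGamma.g C α i k) *
              GaugeSymmetry.single C y (QGamma.antipode C (QGamma.g C α m j)))) ∧
      (∀ a, TensorProduct.assoc ℂ _ _ _ (Ω.rTensor _ (Ω a)) =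
        (GaugeSymmetry.comulOp C).lTensor _ (Ω a)) ∧
      (∀ a, (GaugeSymmetry.counit C).lTensor _ (Ω a) = a ⊗ₜ[ℂ] 1) ∧
      (∀ Ω' : GaugeFields C T c r →ₗ[ℂ] GaugeFields C T c r ⊗[ℂ] GaugeSymmetry C V,
        Ω' 1 = 1 → (∀ a b, Ω' (a * b) = Ω' a * Ω' b) →
        (∀ (l : T.Link) (α : P.I) (i j : Fin (P.d α)),
          Ω' (GaugeFields.u C c r l α i j) = Ω (GaugeFields.u C c r l α i j)) →
        Ω' = Ω) := by
  have hsq : q ^ 2 ≠ 1 := fun h => (sq_eq_one_iff.mp h).elim hq1 hq2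
  refine ⟨fun a b h => freeCoaction_rel C c r hq0 hsq h, GaugeFields.coaction C c r hq0 hsq,
    GaugeFields.coaction_one C c r hq0 hsq, GaugeFields.coaction_mul C c r hq0 hsq,
    fun x y h α i j => GaugeFields.coaction_u C c r hq0 hsq ⟨(x, y), h⟩ α i j,
    fun a => congrArg (fun L => L a) (GaugeFields.coaction_coassoc C c r hq0 hsq),
    GaugeFields.coaction_counit C c r hq0 hsq, GaugeFields.coaction_unique C c r hq0 hsq⟩
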